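/- Let $M$ be a $C^1$ manifold of dimension $d$ without boundary (not necessarily compact), whose tangent bundle carries a Finsler norm $\|\cdot\|$ (a norm on each $T_xM$, depending continuously on $x$), and let $d(\cdot,\cdot)$ be the associated distance (infimum of the lengths of $C^1$ paths), assumed to be finite, i.e. $M$ is connected. Let $f:M\to M$ be a $C^1$ map, not necessarily invertible or transitive, and let $\Lambda\subseteq M$ be a nonempty compact set with $f(\Lambda)=\Lambda$ which is * hyperbolic: there are $\lambda^s<0<\lambda^u$, $C_\Lambda\ge 1$, $d^u,d^s\ge 1$ and a splitting $T_xM=E^u(x)\oplus E^s(x)$, $x\in\Lambda$, with $\dim E^u(x)=d^u$, $\dim E^s(x)=d^s$, where $E^u,E^s$ depend continuously on $x\in\Lambda$ (as maps into the Grassmann bundles), such that for all $x\in\Lambda$, $T_xf(E^u(x))=E^u(f(x))$, $T_xf(E^s(x))\subseteq E^s(f(x))$, and for all $n\ge0$, $\|T_xf^n(v)\|\le C_\Lambda e^{n\lambda^s}\|v\|$ for $v\in E^s(x)$ and $\|T_xf^n(v)\|\ge C_\Lambda^{-1}e^{n\lambda^u}\|v\|$ for $v\in E^u(x)$; * locally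 maximal: there is an open set $U\supseteq\Lambda$ of compact closure with $\bigcap_{n\in\mathbb Z}f^n(\bar U)=\Lambda$ ($f^n(\bar U)$ is a preimage for $n<0$). For $\varepsilon>0$ write $\Omega(\varepsilon)=\{x\in M: d(x,\Lambda)<\varepsilon\}$; a sequence $(x_i)_{0\le i\le n}$ in $\Omega(\varepsilon)$ is an $\varepsilon$-pseudo orbit if $d(f(x_i),x_{i+1})\le\varepsilon$ for $0\le i<n$, and it is periodic if $x_n=x_0$. Then there exist constants $\varepsilon_{AS}>0$, $K_{AS}\ge1$, $\lambda_{AS}>0$ such that, with $\Omega_{AS}=\Omega(\varepsilon_{AS})$ and $K_{APS}=K_{AS}\frac{1+e^{-\lambda_{AS}}}{1-e^{-\lambda_{AS}}}$: 1. (Shadowing) for every $n\ge1$ and every $\varepsilon_{AS}$-pseudo orbit $(x_i)_{0\le i\le n}$ of $\Omega_{AS}$ there is $y\in M$ with $$\max_{0\le i\le n}d(x_i,f^i(y))\le K_{AS}\max_{1\le k\le n}d(f(x_{k-1}),x_k),$$ $$d(x_i,f^i(y))\le K_{AS}\sum_{k=1}^n d(f(x_{k-1}),x_k)\,e^{-\lambda_{AS}|k-i|}\quad(0\le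 i\le n),$$ $$\sum_{i=0}^n d(x_i,f^i(y))\le K_{AS}\sum_{k=1}^n d(f(x_{k-1}),x_k);$$ 2. (Periodic shadowing) for every $n\ge1$ and every periodic $\varepsilon_{AS}$-pseudo orbit $(x_i)_{0\le i\le n}$ of $\Omega_{AS}$ there is $p\in\Lambda$ with $f^n(p)=p$, $$\sum_{i=1}^n d(x_i,f^i(p))\le K_{APS}\sum_{k=1}^n d(f(x_{k-1}),x_k),\qquad \max_{0\le i\le n-1}d(x_i,f^i(p))\le K_{APS}\max_{0\le k\le n-1}d(f(x_k),x_{k+1});$$ 3. $\Omega_{AS}$ has compact closure; let $N_{AS}$ be the smallest number of balls of radius $\varepsilon_{AS}/2$ that can cover $\Omega_{AS}$ and put $$K_\Lambda=\max\Big\{\frac{(N_{AS}+1)\,\mathrm{diam}(\Omega_{AS})}{\varepsilon_{AS}},\ K_{APS}\Big\};$$ 4. for every Lipschitz function $\phi:M\to\mathbb R$, the ergodic minimizing value $$\bar\phi_\Lambda=\lim_{n\to+\infty}\frac1n\inf_{x\in\Lambda}\sum_{k=0}^{n-1}\phi\circ f^k(x)$$ exists, and there are an open set $\Omega\supseteq\Lambda$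 and a Lipschitz function $u:M\to\mathbb R$ such that $$\forall x\in\Omega,\quad \phi(x)-\bar\phi_\Lambda\ge u\circ f(x)-u(x),\qquad\text{and}\qquad \mathrm{Lip}(u)\le K_\Lambda\,\mathrm{Lip}(\phi),$$ where $\mathrm{Lip}(g)=\sup_{x\ne y}|g(y)-g(x)|/d(x,y)$ over $x,y\in M$. In particular $K_\Lambda$ does not depend on $\phi$. -/

import Mathlib

open Set Filter Topology Manifold
open scoped ENNReal ContDiff

noncomputable section

/-- A Finsler norm on a `C^1` manifold `M` of dimension `d` without boundary: a norm on every
tangent space which depends continuously on the base point, that is, which is continuous as a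
function on the tangent bundle. -/
structure FinslerNorm (d : ℕ) (M : Type*) [TopologicalSpace M]
    [ChartedSpace (EuclideanSpace ℝ (Fin d)) M] [IsManifold (𝓡 d) 1 M] where
  /-- The norm on the tangent space at `x`. -/
  normAt : ∀ x : M, Seminorm ℝ (TangentSpace (𝓡 d) x)
  eq_zero_of_normAt_eq_zero : ∀ (x : M) (v : TangentSpace (𝓡 d) x), normAt x v = 0 → v = 0
  continuous_normAt : Continuous fun p : TangentBundle (𝓡 d) M => normAt p.1 p.2

/-- The (extended) distance associated to a Finsler norm: the infimum of the lengths
`∫₀¹ ‖γ'(t)‖ dt` of the `C^1` paths `γ` from `x` to `y`.  (Mathlib's `riemannianEDist` is this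
infimum for an arbitrary family of norms on the tangent spaces.) -/
def FinslerNorm.pathEDist {d : ℕ} {M : Type*} [TopologicalSpace M]
    [ChartedSpace (EuclideanSpace ℝ (Fin d)) M] [IsManifold (𝓡 d) 1 M]
    (F : FinslerNorm d M) (x y : M) : ℝ≥0∞ :=
  letI : ∀ z : M, ENorm (TangentSpace (𝓡 d) z) := fun z => ⟨fun v => ENNReal.ofReal (F.normAt z v)⟩
  riemannianEDist (𝓡 d) x y

/-- The field of tangent subspaces `V` is continuous on `Λ`, as a map into the Grassmann bundle:
read in the trivialization of the tangent bundle around any point `x₀` of `Λ`, it is continuous at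
`x₀` within `Λ` as a map into the Grassmannian of `ℝ^d`, a subspace of `ℝ^d` being identified with
the orthogonal projection onto it. -/
def ContinuousSubspaceFieldOn {d : ℕ} {M : Type*} [TopologicalSpace M]
    [ChartedSpace (EuclideanSpace ℝ (Fin d)) M] [IsManifold (𝓡 d) 1 M]
    (V : ∀ x : M, Submodule ℝ (TangentSpace (𝓡 d) x)) (Λ : Set M) : Prop :=
  ∀ x₀ ∈ Λ, ContinuousWithinAt
    (fun x : M => Submodule.starProjection
      ((V x).map ((trivializationAt (EuclideanSpace ℝ (Fin d))
        (TangentSpace (𝓡 d) : M → Type _) x₀).continuousLinearMapAt ℝ x).toLinearMap)) Λ x₀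

/-- `Λ` is a hyperbolic set of `f`, with respect to the Finsler norm `F`. -/
def IsHyperbolicSet {d : ℕ} {M : Type*} [TopologicalSpace M]
    [ChartedSpace (EuclideanSpace ℝ (Fin d)) M] [IsManifold (𝓡 d) 1 M]
    (F : FinslerNorm d M) (f : M → M) (Λ : Set M) : Prop :=
  f '' Λ = Λ ∧
  ∃ (du ds : ℕ) (Eu Es : ∀ x : M, Submodule ℝ (TangentSpace (𝓡 d) x)) (lams lamu C : ℝ),
    1 ≤ du ∧ 1 ≤ ds ∧ lams < 0 ∧ 0 < lamu ∧ 1 ≤ C ∧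
    (∀ x ∈ Λ, IsCompl (Eu x) (Es x) ∧
      Module.finrank ℝ (Eu x) = du ∧ Module.finrank ℝ (Es x) = ds) ∧
    ContinuousSubspaceFieldOn Eu Λ ∧ ContinuousSubspaceFieldOn Es Λ ∧
    (∀ x ∈ Λ, (Eu x).map (mfderiv (𝓡 d) (𝓡 d) f x).toLinearMap = Eu (f x) ∧
      (Es x).map (mfderiv (𝓡 d) (𝓡 d) f x).toLinearMap ≤ Es (f x)) ∧
    ∀ x ∈ Λ, ∀ n : ℕ,
      (∀ v ∈ Es x, F.normAt (f^[n] x) (mfderiv (𝓡 d) (𝓡 d) (f^[n]) x v)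
        ≤ C * Real.exp (n * lams) * F.normAt x v) ∧
      (∀ v ∈ Eu x, C⁻¹ * Real.exp (n * lamu) * F.normAt x v
        ≤ F.normAt (f^[n] x) (mfderiv (𝓡 d) (𝓡 d) (f^[n]) x v))

/-- `Λ` is locally maximal: it has an open neighbourhood `U` of compact closure such that
`⋂_{n ∈ ℤ} f^n(closure U) = Λ`, where `f^n(A)` is the image of `A` for `n ≥ 0` and the preimage of
`A` under `f^{-n}` for `n ≤ 0`. -/
def IsLocallyMaximal {M : Type*} [TopologicalSpace M] (f : M → M) (Λ : Set M) : Prop :=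
  ∃ U : Set M, IsOpen U ∧ Λ ⊆ U ∧ IsCompact (closure U) ∧
    (⋂ n : ℕ, f^[n] '' closure U) ∩ (⋂ n : ℕ, f^[n] ⁻¹' closure U) = Λ

/-- The ergodic minimizing value of `φ` restricted to `Λ`:
`lim_{n → ∞} (1/n) inf_{x ∈ Λ} ∑_{k < n} φ (f^k x)`. -/
def ergodicMinimizingValue {M : Type*} (f : M → M) (Λ : Set M) (φ : M → ℝ) : ℝ :=
  limUnder atTop fun n : ℕ => (1 / (n : ℝ)) * ⨅ x : Λ, birkhoffSum f φ n (x : M)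

/-- The Lipschitz constant `sup_{x ≠ y} |g y - g x| / d(x, y)`. -/
def lipConst {M : Type*} [MetricSpace M] (g : M → ℝ) : ℝ :=
  sSup {r : ℝ | ∃ x y : M, x ≠ y ∧ r = |g y - g x| / dist x y}

/-- `(x_0, …, x_n)` is an `ε`-pseudo orbit of `f` made of points of `Ω`. -/
def IsPseudoOrbit {M : Type*} [MetricSpace M] (f : M → M) (Ω : Set M) (ε : ℝ) (n : ℕ)
    (x : ℕ → M) : Prop :=
  (∀ i ≤ n, x i ∈ Ω) ∧ ∀ i < n, dist (f (x i)) (x (i + 1)) ≤ ε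

/-- `ε`, `K`, `lam` are constants for the (improved) shadowing property of `Λ`: every
`ε`-pseudo orbit of the `ε`-neighbourhood of `Λ` is shadowed by a true orbit, with the three
stated estimates. -/
def IsShadowingConstants {M : Type*} [MetricSpace M] (f : M → M) (Λ : Set M)
    (ε K lam : ℝ) : Prop :=
  0 < ε ∧ 1 ≤ K ∧ 0 < lam ∧
  ∀ n : ℕ, 1 ≤ n → ∀ x : ℕ → M, IsPseudoOrbit f (Metric.thickening ε Λ) ε n x →
    ∃ y : M,
      (∀ i ≤ n, dist (x i) (f^[i] y) ≤ K * ⨆ k : Fin n, dist (f (x k)) (x (k + 1))) ∧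
      (∀ i ≤ n, dist (x i) (f^[i] y) ≤ K * ∑ k ∈ Finset.Icc 1 n,
        dist (f (x (k - 1))) (x k) * Real.exp (-lam * |(k : ℝ) - (i : ℝ)|)) ∧
      ∑ i ∈ Finset.Icc 0 n, dist (x i) (f^[i] y)
        ≤ K * ∑ k ∈ Finset.Icc 1 n, dist (f (x (k - 1))) (x k)

/-- Periodic shadowing of `Λ` with the constants `ε` and `K`: every periodic `ε`-pseudo orbit of the
`ε`-neighbourhood of `Λ` is shadowed by a periodic orbit of `Λ`, with the two stated estimates. -/
def IsPeriodicShadowing {M : Type*} [MetricSpace M] (f : M → M) (Λ : Set M) (ε K : ℝ) : Prop :=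
  ∀ n : ℕ, 1 ≤ n → ∀ x : ℕ → M, IsPseudoOrbit f (Metric.thickening ε Λ) ε n x → x n = x 0 →
    ∃ p ∈ Λ, f^[n] p = p ∧
      ∑ i ∈ Finset.Icc 1 n, dist (x i) (f^[i] p)
        ≤ K * ∑ k ∈ Finset.Icc 1 n, dist (f (x (k - 1))) (x k) ∧
      ∀ i < n, dist (x i) (f^[i] p) ≤ K * ⨆ k : Fin n, dist (f (x k)) (x (k + 1))

/-- The periodic shadowing constant `K (1 + e^{-lam}) / (1 - e^{-lam})`. -/
def periodicShadowingConst (K lam : ℝ) : ℝ :=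
  K * ((1 + Real.exp (-lam)) / (1 - Real.exp (-lam)))

/-- The smallest number of (open) balls of radius `r` that can cover `A`. -/
def coveringCount {M : Type*} [MetricSpace M] (A : Set M) (r : ℝ) : ℕ :=
  sInf {N : ℕ | ∃ s : Finset M, s.card = N ∧ A ⊆ ⋃ c ∈ s, Metric.ball c r}

/-- The constant `max {(N + 1) diam(Ω_ε) / ε, K (1 + e^{-lam}) / (1 - e^{-lam})}`, where `Ω_ε` is
the `ε`-neighbourhood of `Λ` and `N` the smallest number of balls of radius `ε / 2` covering it. -/
def subactionConst {M : Type*} [MetricSpace M] (Λ : Set M) (ε K lam : ℝ) : ℝ :=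
  max (((coveringCount (Metric.thickening ε Λ) (ε / 2) : ℝ) + 1)
      * Metric.diam (Metric.thickening ε Λ) / ε)
    (periodicShadowingConst K lam)

end

/-! Shadowing is a fixed point problem. Summing the Finsler norm along finite orbit segments with
exponential weights gives norms in which expansion and contraction over `Λ` are visible after one
iterate (`AdaptedSplitting`). Read in finitely many bi-Lipschitz charts, with the splitting frozen
at the centre of each chart, `f` is uniformly close near `Λ` to linear maps compatible with the
splittings. The relation `h' = F h` is then solved for the stable part of `h'` and the unstable part
of `h` (`HasCrossForm`). Only the unstable direction is inverted, so `f` need not be invertible.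

An orbit that follows a pseudo orbit becomes a solution of a finite system in which each component
is a contraction of its neighbours. The system is solved on a cycle of indices in an invariant
compact box (`exists_cyclic_solution`). A periodic pseudo orbit is such a cycle; a finite one
becomes a cycle after adding a trivial closing link. Box radii given by exponentially weighted sums
of the jumps yield the three shadowing estimates, and local maximality puts the periodic orbits
inside `Λ`.

For the sub-action, a chain of points pays `φ - m`, with `m` the ergodic minimizing value, at each
point, and `C` times the size of each jump. Periodic shadowing makes closed chains with small jumps
nonnegative, since periodic orbits in `Λ` have average at least `m`. Cutting a chain at its last
visit to each of finitely many cells bounds all chains with small jumps from below; for large `C`,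
each large jump pays for the piece before it. The infimum over chains ending with a jump to `y` is
then finite, `C`-Lipschitz in `y`, and a sub-action.

All these bounds are proportional to `lipConst φ`, so `C` may be `K₃ * lipConst φ` with `K₃`
independent of `φ`. Shadowing persists when `K` grows, hence `K` can be taken above `K₃`, and the
periodic shadowing constant inside `subactionConst` already dominates it. -/

noncomputable section

/-! ### Seminorms on finite-dimensional spaces -/

section Seminorms

variable {V : Type*} [NormedAddCommGroup V] [NormedSpace ℝ V] [FiniteDimensional ℝ V]

theorem Seminorm.continuous_of_finiteDimensional (n : Seminorm ℝ V) : Continuous n :=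
  continuousOn_univ.1 (n.convexOn.continuousOn isOpen_univ)

theorem Seminorm.exists_le_mul_norm (n : Seminorm ℝ V) : ∃ K > 0, ∀ v, n v ≤ K * ‖v‖ :=
  Seminorm.bound_of_continuous_normedSpace n n.continuous_of_finiteDimensional

theorem Seminorm.exists_norm_le_mul (n : Seminorm ℝ V) (hn : ∀ v, n v = 0 → v = 0) :
    ∃ K > 0, ∀ v, ‖v‖ ≤ K * n v := by
  rcases (Metric.sphere (0 : V) 1).eq_empty_or_nonempty with h | h
  · refine ⟨1, one_pos, fun v => ?_⟩
    rcases eq_or_ne v 0 with rfl | hv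
    · simp
    · exact absurd (show ‖v‖⁻¹ • v ∈ Metric.sphere (0 : V) 1 by
        simp [norm_smul, hv]) (by simp [h])
  · obtain ⟨w, hw, hmin⟩ := (isCompact_sphere (0 : V) 1).exists_isMinOn h
      n.continuous_of_finiteDimensional.continuousOn
    have hw1 : ‖w‖ = 1 := by simpa using hw
    have hpos : 0 < n w := lt_of_le_of_ne (apply_nonneg n w) fun h0 => by
      have := hn w h0.symm
      simp [this] at hw1
    refine ⟨(n w)⁻¹, inv_pos.2 hpos, fun v => ?_⟩
    rcases eq_or_ne v 0 with rfl | hv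
    · simp
    · have h1 : n w ≤ n (‖v‖⁻¹ • v) := hmin (show ‖v‖⁻¹ • v ∈ Metric.sphere (0 : V) 1 by
        simp [norm_smul, hv])
      rw [map_smul_eq_mul, norm_inv, norm_norm] at h1
      have hv' : 0 < ‖v‖ := norm_pos_iff.2 hv
      field_simp at h1 ⊢
      exact h1

end Seminorms

/-- A family of absolutely homogeneous functions which is jointly continuous at a base point is
uniformly close to its value at the base point, relatively to the norm. -/
theorem eventually_forall_abs_sub_le_of_homogeneous {X V : Type*} [TopologicalSpace X]
    [NormedAddCommGroup V] [NormedSpace ℝ V] [FiniteDimensional ℝ V]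
    {l : Filter X} {g : X → V → ℝ} {g₀ : V → ℝ}
    (hg : ∀ᶠ z in l, ∀ (t : ℝ) (w : V), g z (t • w) = |t| * g z w)
    (hg₀ : ∀ (t : ℝ) (w : V), g₀ (t • w) = |t| * g₀ w)
    (hcont : Continuous g₀)
    (h : ∀ w, Tendsto (Function.uncurry g) (l ×ˢ 𝓝 w) (𝓝 (g₀ w))) {δ : ℝ} (hδ : 0 < δ) :
    ∀ᶠ z in l, ∀ w, |g z w - g₀ w| ≤ δ * ‖w‖ := by
  -- Compactness of the unit sphere makes the pointwise joint limits uniform; homogeneity then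
  -- extends the estimate to all vectors.
  have key : ∀ᶠ p in l ×ˢ 𝓝ˢ (Metric.sphere (0 : V) 1), |g p.1 p.2 - g₀ p.2| < δ := by
    refine (isCompact_sphere (0 : V) 1).mem_prod_nhdsSet_of_forall fun w _ => ?_
    have h1 : Tendsto (fun p : X × V => |g p.1 p.2 - g₀ p.2|) (l ×ˢ 𝓝 w)
        (𝓝 |g₀ w - g₀ w|) :=
      ((h w).sub ((hcont.tendsto w).comp tendsto_snd)).abs
    rw [sub_self, abs_zero] at h1
    exact h1.eventually (gt_mem_nhds hδ)
  obtain ⟨p, hp, q, hq, hpq⟩ := eventually_prod_iff.1 key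
  filter_upwards [hp, hg] with z hz hgz w
  rcases eq_or_ne w 0 with rfl | hw
  · have h1 := hgz 0 0
    have h2 := hg₀ 0 0
    simp only [smul_zero, abs_zero, zero_mul] at h1 h2
    simp [h1, h2]
  · have hw' : 0 < ‖w‖ := norm_pos_iff.2 hw
    have hs : ‖w‖⁻¹ • w ∈ Metric.sphere (0 : V) 1 := by simp [norm_smul, hw]
    have := (hpq hz (subset_of_mem_nhdsSet hq hs)).le
    rw [hgz, hg₀, ← mul_sub, abs_mul, abs_abs, abs_inv, abs_norm] at this
    field_simp at this
    linarith

/-! ### Finsler distance and lengths of paths -/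

namespace FinslerNorm

variable {d : ℕ} {M : Type*} [TopologicalSpace M]
    [ChartedSpace (EuclideanSpace ℝ (Fin d)) M] [IsManifold (𝓡 d) 1 M] (F : FinslerNorm d M)

theorem pathEDist_le {γ : ℝ → M} {a b : ℝ} (hab : a ≤ b)
    (hγ : ContMDiffOn 𝓘(ℝ, ℝ) (𝓡 d) 1 γ (Icc a b)) :
    F.pathEDist (γ a) (γ b) ≤ ∫⁻ t in Icc a b, ENNReal.ofReal
      (F.normAt (γ t) (mfderivWithin 𝓘(ℝ, ℝ) (𝓡 d) γ (Icc a b) t (1 : ℝ))) := by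
  let _ : ∀ z : M, ENorm (TangentSpace (𝓡 d) z) := fun z => ⟨fun v => ENNReal.ofReal (F.normAt z v)⟩
  have : ∀ z : M, ENormSMulClass ℝ (TangentSpace (𝓡 d) z) := fun z => ⟨fun r v => by
    change ENNReal.ofReal (F.normAt z (r • v)) = ‖r‖ₑ * ENNReal.ofReal (F.normAt z v)
    rw [map_smul_eq_mul, ENNReal.ofReal_mul (norm_nonneg _), ofReal_norm]⟩
  have := riemannianEDist_le_pathELength (I := 𝓡 d) hγ rfl rfl hab
  rw [pathELength_eq_lintegral_mfderivWithin_Icc] at this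
  exact this

theorem exists_path_of_pathEDist_lt {x y : M} {r : ℝ≥0∞} (h : F.pathEDist x y < r) :
    ∃ γ : ℝ → M, γ 0 = x ∧ γ 1 = y ∧ ContMDiffOn 𝓘(ℝ, ℝ) (𝓡 d) 1 γ (Icc 0 1) ∧
      ∫⁻ t in Icc (0 : ℝ) 1, ENNReal.ofReal
        (F.normAt (γ t) (mfderiv 𝓘(ℝ, ℝ) (𝓡 d) γ t (1 : ℝ))) < r := by
  let _ : ∀ z : M, ENorm (TangentSpace (𝓡 d) z) := fun z => ⟨fun v => ENNReal.ofReal (F.normAt z v)⟩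
  obtain ⟨γ, h0, h1, hγ, hl⟩ := exists_lt_of_riemannianEDist_lt (I := 𝓡 d) h
  rw [pathELength_eq_lintegral_mfderiv_Icc] at hl
  exact ⟨γ, h0, h1, hγ, hl⟩

end FinslerNorm

/-! ### The Finsler norm in charts -/

section TangentCoordinates

variable {d : ℕ} {M : Type*} [TopologicalSpace M]
    [ChartedSpace (EuclideanSpace ℝ (Fin d)) M] [IsManifold (𝓡 d) 1 M]

/-- The derivative at `z` of the preferred chart at `c`. -/
def chartDeriv (c z : M) : TangentSpace (𝓡 d) z →L[ℝ] EuclideanSpace ℝ (Fin d) :=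
  (trivializationAt (EuclideanSpace ℝ (Fin d)) (TangentSpace (𝓡 d) : M → Type _) c).continuousLinearMapAt ℝ z

/-- The inverse of the derivative at `z` of the preferred chart at `c`. -/
def chartDerivSymm (c z : M) : EuclideanSpace ℝ (Fin d) →L[ℝ] TangentSpace (𝓡 d) z :=
  (trivializationAt (EuclideanSpace ℝ (Fin d)) (TangentSpace (𝓡 d) : M → Type _) c).symmL ℝ z

theorem chartDeriv_eq_mfderiv {c z : M} (hz : z ∈ (chartAt (EuclideanSpace ℝ (Fin d)) c).source) :
    chartDeriv c z = mfderiv (𝓡 d) 𝓘(ℝ, EuclideanSpace ℝ (Fin d)) (extChartAt (𝓡 d) c) z :=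
  TangentBundle.continuousLinearMapAt_trivializationAt hz

theorem chartDeriv_chartDerivSymm {c z : M}
    (hz : z ∈ (chartAt (EuclideanSpace ℝ (Fin d)) c).source) (w : EuclideanSpace ℝ (Fin d)) :
    chartDeriv c z (chartDerivSymm c z w) = w :=
  Bundle.Trivialization.continuousLinearMapAt_symmL _ (by simpa using hz) w

theorem chartDerivSymm_chartDeriv {c z : M}
    (hz : z ∈ (chartAt (EuclideanSpace ℝ (Fin d)) c).source) (v : TangentSpace (𝓡 d) z) :
    chartDerivSymm c z (chartDeriv c z v) = v :=
  Bundle.Trivialization.symmL_continuousLinearMapAt _ (by simpa using hz) v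

theorem continuousAt_chartDerivSymm {c z : M}
    (hz : z ∈ (chartAt (EuclideanSpace ℝ (Fin d)) c).source) (w : EuclideanSpace ℝ (Fin d)) :
    ContinuousAt (fun p : M × EuclideanSpace ℝ (Fin d) =>
      (⟨p.1, chartDerivSymm c p.1 p.2⟩ : TangentBundle (𝓡 d) M)) (z, w) := by
  set e := trivializationAt (EuclideanSpace ℝ (Fin d)) (TangentSpace (𝓡 d) : M → Type _) c
  have hb : z ∈ e.baseSet := by simpa [e] using hz
  have h1 : ContinuousAt e.toOpenPartialHomeomorph.symm (z, w) :=
    e.toOpenPartialHomeomorph.symm.continuousAt (e.mem_target.2 hb)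
  refine h1.congr ?_
  have : ∀ᶠ p : M × EuclideanSpace ℝ (Fin d) in 𝓝 (z, w), p.1 ∈ e.baseSet :=
    continuousAt_fst.eventually (e.open_baseSet.mem_nhds hb)
  filter_upwards [this] with p hp
  have h2 : e.symm p.1 p.2 = chartDerivSymm c p.1 p.2 :=
    (Bundle.Trivialization.symmL_apply (R := ℝ) e hp p.2).symm
  rw [← h2]
  exact (e.mk_symm hp p.2).symm

/-- Over its own centre the trivialization is the identity. This allows seminorms on the tangent
space at `c` to be used directly as seminorms on `ℝ^d`. -/
theorem chartDeriv_self (c : M) (v : TangentSpace (𝓡 d) c) : chartDeriv c c v = v := by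
  rw [chartDeriv_eq_mfderiv (mem_chart_source _ c), mfderiv_extChartAt_self]
  rfl

theorem chartDerivSymm_self (c : M) (v : EuclideanSpace ℝ (Fin d)) : chartDerivSymm c c v = v :=
  (congrArg (chartDerivSymm c c) (chartDeriv_self c v).symm).trans
    (chartDerivSymm_chartDeriv (mem_chart_source _ c) v)

namespace FinslerNorm

variable (F : FinslerNorm d M)

/-- In a chart, a Finsler norm is comparable to the Euclidean norm near every point. -/
theorem exists_eventually_normAt_comparable (c : M) :
    ∃ K > 0, ∀ᶠ z in 𝓝 c, ∀ v : TangentSpace (𝓡 d) z,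
      F.normAt z v ≤ K * ‖chartDeriv c z v‖ ∧ ‖chartDeriv c z v‖ ≤ K * F.normAt z v := by
  let n : Seminorm ℝ (EuclideanSpace ℝ (Fin d)) :=
    (F.normAt c).comp (chartDerivSymm c c).toLinearMap
  have hn : ∀ w, n w = F.normAt c (chartDerivSymm c c w) := fun w => rfl
  obtain ⟨K₁, hK₁, h₁⟩ := n.exists_le_mul_norm
  obtain ⟨K₂, hK₂, h₂⟩ := n.exists_norm_le_mul fun v hv => by
    have := F.eq_zero_of_normAt_eq_zero c _ hv
    rw [← chartDeriv_chartDerivSymm (mem_chart_source _ c) v]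
    exact (congrArg _ this).trans (map_zero _)
  have hs : ∀ᶠ z in 𝓝 c, z ∈ (chartAt (EuclideanSpace ℝ (Fin d)) c).source :=
    chart_source_mem_nhds _ c
  have key := eventually_forall_abs_sub_le_of_homogeneous (l := 𝓝 c)
    (g := fun z w => F.normAt z (chartDerivSymm c z w)) (g₀ := n)
    (Eventually.of_forall fun z t w => by rw [map_smul, map_smul_eq_mul, Real.norm_eq_abs])
    (fun t w => by rw [map_smul_eq_mul, Real.norm_eq_abs])
    n.continuous_of_finiteDimensional
    (fun w => by
      rw [← nhds_prod_eq]
      exact F.continuous_normAt.continuousAt.comp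
        (continuousAt_chartDerivSymm (mem_chart_source _ c) w))
    -- The seminorm at `c` is at least `‖w‖ / K₂`; an error of half that size still leaves a lower
    -- bound.
    (δ := 1 / (2 * K₂)) (by positivity)
  refine ⟨max (K₁ + 1 / (2 * K₂)) (2 * K₂), by positivity, ?_⟩
  filter_upwards [hs, key] with z hz hk v
  have h := hk (chartDeriv c z v)
  rw [chartDerivSymm_chartDeriv hz, abs_le] at h
  have a₁ := h₁ (chartDeriv c z v)
  have a₂ := h₂ (chartDeriv c z v)
  have hv0 : 0 ≤ F.normAt z v := apply_nonneg _ _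
  constructor
  · calc F.normAt z v ≤ (K₁ + 1 / (2 * K₂)) * ‖chartDeriv c z v‖ := by linarith
      _ ≤ _ := by gcongr; exact le_max_left _ _
  · calc ‖chartDeriv c z v‖ ≤ 2 * K₂ * F.normAt z v := by
          have : K₂ * (1 / (2 * K₂) * ‖chartDeriv c z v‖) = ‖chartDeriv c z v‖ / 2 := by
            field_simp
          nlinarith
      _ ≤ _ := by gcongr; exact le_max_right _ _

end FinslerNorm

end TangentCoordinates

/-! ### Charts are locally bi-Lipschitz for the Finsler distance -/

section ChartDistance

open MeasureTheory

variable {d : ℕ} {M : Type*} [MetricSpace M]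
    [ChartedSpace (EuclideanSpace ℝ (Fin d)) M] [IsManifold (𝓡 d) 1 M] (F : FinslerNorm d M)

/-- Chain rule: the trivialized velocity of a path is the velocity of the path read in the chart, so
Finsler lengths can be compared with Euclidean ones. -/
theorem chartDeriv_mfderivWithin {c : M} {γ : ℝ → M} {t : ℝ} (ht : t ∈ Icc (0 : ℝ) 1)
    (hγ : MDifferentiableWithinAt 𝓘(ℝ, ℝ) (𝓡 d) γ (Icc 0 1) t)
    (hc : γ t ∈ (chartAt (EuclideanSpace ℝ (Fin d)) c).source) :
    chartDeriv c (γ t) (mfderivWithin 𝓘(ℝ, ℝ) (𝓡 d) γ (Icc 0 1) t (1 : ℝ)) =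
      derivWithin (extChartAt (𝓡 d) c ∘ γ) (Icc 0 1) t := by
  have h : mfderivWithin 𝓘(ℝ, ℝ) 𝓘(ℝ, EuclideanSpace ℝ (Fin d)) (extChartAt (𝓡 d) c ∘ γ)
      (Icc 0 1) t = (mfderiv (𝓡 d) 𝓘(ℝ, EuclideanSpace ℝ (Fin d)) (extChartAt (𝓡 d) c) (γ t)) ∘L
        (mfderivWithin 𝓘(ℝ, ℝ) (𝓡 d) γ (Icc 0 1) t) := by
    apply mfderiv_comp_mfderivWithin
    · exact mdifferentiableAt_extChartAt hc
    · exact hγ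
    · rw [uniqueMDiffWithinAt_iff_uniqueDiffWithinAt]
      exact uniqueDiffOn_Icc zero_lt_one _ ht
  rw [chartDeriv_eq_mfderiv hc, ← fderivWithin_derivWithin, ← mfderivWithin_eq_fderivWithin, h]
  rfl

/-- The two derivatives can differ only at the endpoints, a null set. -/
theorem lintegral_mfderiv_Icc_eq (γ : ℝ → M) :
    ∫⁻ t in Icc (0 : ℝ) 1, ENNReal.ofReal
        (F.normAt (γ t) (mfderiv 𝓘(ℝ, ℝ) (𝓡 d) γ t (1 : ℝ))) =
      ∫⁻ t in Icc (0 : ℝ) 1, ENNReal.ofReal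
        (F.normAt (γ t) (mfderivWithin 𝓘(ℝ, ℝ) (𝓡 d) γ (Icc 0 1) t (1 : ℝ))) := by
  rw [← restrict_Ioo_eq_restrict_Icc]
  refine setLIntegral_congr_fun measurableSet_Ioo fun t ht => ?_
  rw [mfderivWithin_of_mem_nhds (Icc_mem_nhds ht.1 ht.2)]

/-- In a chart, the Finsler distance is bounded by the Euclidean distance near every point. -/
theorem FinslerNorm.exists_dist_le_norm_chart (hF : ∀ x y : M, edist x y = F.pathEDist x y) (c : M) :
    ∃ K > 0, ∀ᶠ r in 𝓝[>] (0 : ℝ), ∀ p ∈ Metric.ball (extChartAt (𝓡 d) c c) r,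
      ∀ q ∈ Metric.ball (extChartAt (𝓡 d) c c) r,
      dist ((extChartAt (𝓡 d) c).symm p) ((extChartAt (𝓡 d) c).symm q) ≤ K * ‖p - q‖ := by
  obtain ⟨K, hK, h⟩ := F.exists_eventually_normAt_comparable c
  set e := extChartAt (𝓡 d) c with he
  have hgood : ∀ᶠ p in 𝓝 (e c), p ∈ e.target ∧ ∀ v : TangentSpace (𝓡 d) (e.symm p),
      F.normAt (e.symm p) v ≤ K * ‖chartDeriv c (e.symm p) v‖ := by
    have h1 : Tendsto e.symm (𝓝 (e c)) (𝓝 c) := by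
      have := continuousAt_extChartAt_symm (I := 𝓡 d) c
      rwa [ContinuousAt, extChartAt_to_inv] at this
    filter_upwards [extChartAt_target_mem_nhds (I := 𝓡 d) c, h1.eventually h] with p hp hp' using
      ⟨hp, fun v => (hp' v).1⟩
  obtain ⟨R, hR, hball⟩ := Metric.eventually_nhds_iff_ball.1 hgood
  refine ⟨K, hK, ?_⟩
  have hR3 : ∀ᶠ r in 𝓝[>] (0 : ℝ), r < R := mem_nhdsWithin_of_mem_nhds (gt_mem_nhds hR)
  filter_upwards [hR3] with r hr p hp q hq
  -- The competitor is the straight segment in the chart; it stays in the ball by convexity.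
  let η : ℝ → EuclideanSpace ℝ (Fin d) := AffineMap.lineMap p q
  have hηd : ∀ t, HasDerivAt η (q - p) t := fun t => AffineMap.hasDerivAt_lineMap
  have hη : ∀ t ∈ Icc (0 : ℝ) 1, η t ∈ Metric.ball (e c) R := fun t ht =>
    Metric.ball_subset_ball hr.le ((convex_ball (e c) r).segment_subset hp hq (by
      rw [segment_eq_image_lineMap]; exact mem_image_of_mem _ ht))
  have hηs : ContMDiffOn 𝓘(ℝ, ℝ) 𝓘(ℝ, EuclideanSpace ℝ (Fin d)) 1 η (Icc 0 1) := by
    rw [contMDiffOn_iff_contDiffOn]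
    exact (ContinuousAffineMap.lineMap (R := ℝ) p q).contDiff.contDiffOn
  have hγ : ContMDiffOn 𝓘(ℝ, ℝ) (𝓡 d) 1 (e.symm ∘ η) (Icc 0 1) :=
    (contMDiffOn_extChartAt_symm c).comp hηs fun t ht => (hball _ (hη t ht)).1
  have hlen := F.pathEDist_le zero_le_one hγ
  have h0 : (e.symm ∘ η) 0 = e.symm p := by simp [η]
  have h1 : (e.symm ∘ η) 1 = e.symm q := by simp [η]
  rw [h0, h1, ← hF, edist_dist] at hlen
  refine (ENNReal.ofReal_le_ofReal_iff (by positivity)).1 (hlen.trans ?_)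
  calc _ ≤ ∫⁻ _ in Icc (0 : ℝ) 1, ENNReal.ofReal (K * ‖p - q‖) := by
        refine setLIntegral_mono' measurableSet_Icc fun t ht => ?_
        have hb := hball _ (hη t ht)
        refine ENNReal.ofReal_le_ofReal ((hb.2 _).trans_eq ?_)
        have hsrc : (e.symm ∘ η) t ∈ (chartAt (EuclideanSpace ℝ (Fin d)) c).source := by
          rw [← extChartAt_source (𝓡 d)]; exact e.map_target hb.1
        have h2 := chartDeriv_mfderivWithin ht (hγ.mdifferentiableOn one_ne_zero t ht) hsrc
        have h3 : derivWithin (e ∘ e.symm ∘ η) (Icc 0 1) t = q - p := by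
          refine (derivWithin_congr (f := η) (fun s hs => e.right_inv (hball _ (hη s hs)).1)
            (e.right_inv hb.1)).trans ?_
          exact (hηd t).hasDerivWithinAt.derivWithin (uniqueDiffOn_Icc zero_lt_one t ht)
        rw [norm_sub_rev, ← h3, ← h2]
        rfl
    _ = _ := by simp

/-- In a chart, the Euclidean distance is bounded by the Finsler distance near every point. -/
theorem FinslerNorm.exists_norm_chart_le_dist (hF : ∀ x y : M, edist x y = F.pathEDist x y) (c : M) :
    ∃ K > 0, ∀ᶠ r in 𝓝[>] (0 : ℝ), ∀ x ∈ Metric.ball c r, ∀ y ∈ Metric.ball c r,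
      ‖extChartAt (𝓡 d) c x - extChartAt (𝓡 d) c y‖ ≤ K * dist x y := by
  obtain ⟨K, hK, h⟩ := F.exists_eventually_normAt_comparable c
  obtain ⟨R, hR, hball⟩ := Metric.eventually_nhds_iff_ball.1
    (h.and (chart_source_mem_nhds (EuclideanSpace ℝ (Fin d)) c))
  refine ⟨K, hK, ?_⟩
  -- A path of length less than `2 * r` starting in the ball of radius `r` stays in the ball of
  -- radius `3 * r`, where the norms are comparable.
  have hR3 : ∀ᶠ r in 𝓝[>] (0 : ℝ), r < R / 3 :=
    mem_nhdsWithin_of_mem_nhds (gt_mem_nhds (by positivity))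
  filter_upwards [hR3, self_mem_nhdsWithin] with r hr hr0 x hx y hy
  rw [mem_Ioi] at hr0
  rw [Metric.mem_ball] at hx hy
  set e := extChartAt (𝓡 d) c
  have hxy : dist x y < 2 * r := by
    linarith [dist_triangle_right x y c]
  -- it suffices to bound the chart distance by the length of any short path
  suffices H : ∀ ρ : ℝ, dist x y < ρ → ρ < 2 * r → ‖e x - e y‖ ≤ K * ρ by
    have hden : ∀ᶠ ρ in 𝓝[>] (dist x y), ‖e x - e y‖ ≤ K * ρ := by
      have h2 : ∀ᶠ ρ in 𝓝[>] (dist x y), ρ < 2 * r :=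
        mem_nhdsWithin_of_mem_nhds (gt_mem_nhds hxy)
      filter_upwards [h2, self_mem_nhdsWithin] with ρ h2 h3 using H ρ h3 h2
    exact ge_of_tendsto ((tendsto_id.const_mul K).mono_left nhdsWithin_le_nhds) hden
  intro ρ hρ hρr
  have hρ0 : 0 < ρ := dist_nonneg.trans_lt hρ
  have hlt : F.pathEDist x y < ENNReal.ofReal ρ := by
    rw [← hF, edist_dist]
    exact (ENNReal.ofReal_lt_ofReal_iff hρ0).2 hρ
  obtain ⟨γ, h0, h1, hγ, hl⟩ := F.exists_path_of_pathEDist_lt hlt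
  rw [lintegral_mfderiv_Icc_eq] at hl
  -- The initial piece of the path up to time `t` bounds `dist x (γ t)`, so the path cannot leave
  -- the ball.
  have hin : ∀ t ∈ Icc (0 : ℝ) 1, γ t ∈ Metric.ball c R := by
    intro t ht
    have hsub : Icc 0 t ⊆ Icc (0 : ℝ) 1 := Icc_subset_Icc_right ht.2
    have h2 := F.pathEDist_le ht.1 (hγ.mono hsub)
    rw [← hF, h0] at h2
    have h3 : edist x (γ t) < ENNReal.ofReal ρ := by
      refine lt_of_le_of_lt (h2.trans ?_) hl
      rw [← restrict_Ioo_eq_restrict_Icc]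
      refine (setLIntegral_congr_fun measurableSet_Ioo fun s hs => ?_).le.trans
        (lintegral_mono_set (Ioo_subset_Icc_self.trans hsub))
      rw [mfderivWithin_of_mem_nhds (Icc_mem_nhds hs.1 hs.2),
        mfderivWithin_of_mem_nhds (Icc_mem_nhds hs.1 (hs.2.trans_le ht.2))]
    rw [edist_dist, ENNReal.ofReal_lt_ofReal_iff hρ0] at h3
    rw [Metric.mem_ball]
    linarith [dist_triangle_left (γ t) c x]
  have hsmooth : ContDiffOn ℝ 1 (e ∘ γ) (Icc 0 1) := by
    rw [← contMDiffOn_iff_contDiffOn]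
    exact contMDiffOn_extChartAt.comp (t := (chartAt (EuclideanSpace ℝ (Fin d)) c).source) hγ
      fun t ht => (hball _ (hin t ht)).2
  have hmain : ‖(e ∘ γ) 1 - (e ∘ γ) 0‖ₑ ≤ ENNReal.ofReal K * ENNReal.ofReal ρ := by
    refine (enorm_sub_le_lintegral_derivWithin_Icc_of_contDiffOn_Icc hsmooth zero_le_one).trans ?_
    refine le_trans ?_ (mul_le_mul_right hl.le _)
    rw [← lintegral_const_mul' _ _ ENNReal.ofReal_ne_top]
    refine setLIntegral_mono' measurableSet_Icc fun t ht => ?_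
    have hb := hball _ (hin t ht)
    rw [← chartDeriv_mfderivWithin ht (hγ.mdifferentiableOn one_ne_zero t ht) hb.2,
      ← ofReal_norm, ← ENNReal.ofReal_mul hK.le]
    exact ENNReal.ofReal_le_ofReal (hb.1 _).2
  rw [← ENNReal.ofReal_mul hK.le, ← ofReal_norm, ENNReal.ofReal_le_ofReal_iff (by positivity)]
    at hmain
  simp only [Function.comp_apply, h0, h1] at hmain
  rwa [norm_sub_rev]

end ChartDistance

theorem Filter.Tendsto.continuousLinearMap_apply {X V W : Type*} [NormedAddCommGroup V]
    [NormedSpace ℝ V] [NormedAddCommGroup W] [NormedSpace ℝ W] {l : Filter X} {A : X → V →L[ℝ] W}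
    {A₀ : V →L[ℝ] W} {w : X → V} {w₀ : V} (hA : Tendsto A l (𝓝 A₀)) (hw : Tendsto w l (𝓝 w₀)) :
    Tendsto (fun x => A x (w x)) l (𝓝 (A₀ w₀)) :=
  (isBoundedBilinearMap_apply.continuous.tendsto (A₀, w₀)).comp (hA.prodMk_nhds hw)

/-! ### Continuity of projections along a splitting -/

section ObliqueProjection

variable {V : Type*} [NormedAddCommGroup V] [InnerProductSpace ℝ V] [FiniteDimensional ℝ V]

/-- If the two orthogonal projections of `v` agree, their common value lies in both subspaces and
vanishes; then `v` is orthogonal to their sum, which is everything. -/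
theorem isUnit_starProjection_sub {U S : Submodule ℝ V} (h : IsCompl U S) :
    IsUnit (U.starProjection - S.starProjection) := by
  rw [ContinuousLinearMap.isUnit_iff_isUnit_toLinearMap, LinearMap.isUnit_iff_ker_eq_bot,
    LinearMap.ker_eq_bot']
  intro v hv
  have h1 : U.starProjection v = S.starProjection v := sub_eq_zero.1 hv
  have hU : U.starProjection v ∈ U := Submodule.starProjection_apply_mem U v
  have hS : U.starProjection v ∈ S := h1 ▸ Submodule.starProjection_apply_mem S v
  have h0 : U.starProjection v = 0 := by
    have := Submodule.mem_inf.2 ⟨hU, hS⟩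
    rwa [h.inf_eq_bot, Submodule.mem_bot] at this
  have hvU : v ∈ Uᗮ := Submodule.starProjection_apply_eq_zero_iff U |>.1 h0
  have hvS : v ∈ Sᗮ := Submodule.starProjection_apply_eq_zero_iff S |>.1 (h1 ▸ h0)
  have : v ∈ (U ⊔ S)ᗮ := by
    rw [← Submodule.inf_orthogonal]
    exact ⟨hvU, hvS⟩
  rwa [h.sup_eq_top, Submodule.top_orthogonal_eq_bot, Submodule.mem_bot] at this

/-- The projection onto `U` along `S`, in terms of the orthogonal projections onto `U` and `S`. -/
theorem eq_inverse_starProjection_sub_mul {U S : Submodule ℝ V} (h : IsCompl U S) {R : V →L[ℝ] V}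
    (hU : ∀ v ∈ U, R v = v) (hS : ∀ v ∈ S, R v = 0) :
    R = Ring.inverse (U.starProjection - S.starProjection) * (1 - S.starProjection) := by
  have key : (U.starProjection - S.starProjection) * R = 1 - S.starProjection := by
    ext v
    obtain ⟨u, s, hu, hs, rfl⟩ := Submodule.codisjoint_iff_exists_add_eq.1 h.codisjoint v
    have h1 : R (u + s) = u := by rw [map_add, hU u hu, hS s hs, add_zero]
    change (U.starProjection - S.starProjection) (R (u + s)) = (u + s) - S.starProjection (u + s)
    rw [h1, map_add, Submodule.starProjection_eq_self_iff.2 hs]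
    change U.starProjection u - S.starProjection u = _
    rw [Submodule.starProjection_eq_self_iff.2 hu]
    abel
  rw [← key, Ring.inverse_mul_cancel_left _ _ (isUnit_starProjection_sub h)]

/-- Continuity of subspaces is given through orthogonal projections. The formula of
`eq_inverse_starProjection_sub_mul` carries it over to oblique projections, because inversion is
continuous at units. -/
theorem Filter.Tendsto.oblique_projection {X : Type*} {l : Filter X} {U S : X → Submodule ℝ V}
    {U₀ S₀ : Submodule ℝ V} {R : X → V →L[ℝ] V} {R₀ : V →L[ℝ] V}
    (hU : Tendsto (fun x => (U x).starProjection) l (𝓝 U₀.starProjection))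
    (hS : Tendsto (fun x => (S x).starProjection) l (𝓝 S₀.starProjection))
    (h : ∀ᶠ x in l, IsCompl (U x) (S x) ∧ (∀ v ∈ U x, R x v = v) ∧ ∀ v ∈ S x, R x v = 0)
    (h₀ : IsCompl U₀ S₀) (hU₀ : ∀ v ∈ U₀, R₀ v = v) (hS₀ : ∀ v ∈ S₀, R₀ v = 0) :
    Tendsto R l (𝓝 R₀) := by
  have hlim : Tendsto (fun x => Ring.inverse ((U x).starProjection - (S x).starProjection) *
      (1 - (S x).starProjection)) l (𝓝 R₀) := by
    rw [eq_inverse_starProjection_sub_mul h₀ hU₀ hS₀]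
    obtain ⟨w, hw⟩ := isUnit_starProjection_sub h₀
    have h1 := NormedRing.inverse_continuousAt w
    rw [hw] at h1
    exact (h1.tendsto.comp (hU.sub hS)).mul (tendsto_const_nhds.sub hS)
  refine hlim.congr' ?_
  filter_upwards [h] with x hx
  exact (eq_inverse_starProjection_sub_mul hx.1 hx.2.1 hx.2.2).symm

end ObliqueProjection

/-! ### Continuity of the projections of a splitting on the manifold -/

section Splitting

variable {d : ℕ} {M : Type*} [TopologicalSpace M]
    [ChartedSpace (EuclideanSpace ℝ (Fin d)) M] [IsManifold (𝓡 d) 1 M]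

/-- The projections associated to a continuous splitting depend continuously on the point. -/
theorem ContinuousSubspaceFieldOn.tendsto_projection {U S : ∀ x : M, Submodule ℝ (TangentSpace (𝓡 d) x)}
    {Λ : Set M} (hU : ContinuousSubspaceFieldOn U Λ) (hS : ContinuousSubspaceFieldOn S Λ)
    (h : ∀ x ∈ Λ, IsCompl (U x) (S x))
    {R : ∀ x : M, TangentSpace (𝓡 d) x →ₗ[ℝ] TangentSpace (𝓡 d) x}
    (hRU : ∀ x ∈ Λ, ∀ v ∈ U x, R x v = v) (hRS : ∀ x ∈ Λ, ∀ v ∈ S x, R x v = 0)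
    {c : M} (hc : c ∈ Λ) (w : EuclideanSpace ℝ (Fin d)) :
    Tendsto (fun p : M × EuclideanSpace ℝ (Fin d) =>
      (⟨p.1, R p.1 (chartDerivSymm c p.1 p.2)⟩ : TangentBundle (𝓡 d) M)) (𝓝[Λ] c ×ˢ 𝓝 w)
      (𝓝 ⟨c, R c (chartDerivSymm c c w)⟩) := by
  obtain ⟨R', hR'⟩ : ∃ R' : M → EuclideanSpace ℝ (Fin d) →L[ℝ] EuclideanSpace ℝ (Fin d),
      ∀ z w, R' z w = chartDeriv c z (R z (chartDerivSymm c z w)) :=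
    ⟨fun z => LinearMap.toContinuousLinearMap
      ((chartDeriv c z).toLinearMap ∘ₗ R z ∘ₗ (chartDerivSymm c z).toLinearMap), fun z w => rfl⟩
  have hsrc : ∀ᶠ z in 𝓝[Λ] c, z ∈ (chartAt (EuclideanSpace ℝ (Fin d)) c).source ∧ z ∈ Λ := by
    filter_upwards [mem_nhdsWithin_of_mem_nhds (chart_source_mem_nhds (EuclideanSpace ℝ (Fin d)) c),
      self_mem_nhdsWithin] with z h1 h2 using ⟨h1, h2⟩
  have hgood : ∀ z, z ∈ (chartAt (EuclideanSpace ℝ (Fin d)) c).source → z ∈ Λ →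
      IsCompl ((U z).map (chartDeriv c z).toLinearMap) ((S z).map (chartDeriv c z).toLinearMap) ∧
      (∀ v ∈ (U z).map (chartDeriv c z).toLinearMap, R' z v = v) ∧
      ∀ v ∈ (S z).map (chartDeriv c z).toLinearMap, R' z v = 0 := by
    intro z hz hzΛ
    refine ⟨?_, ?_, ?_⟩
    · let ee : TangentSpace (𝓡 d) z ≃ₗ[ℝ] EuclideanSpace ℝ (Fin d) :=
        LinearEquiv.ofLinearMap (chartDeriv c z).toLinearMap (chartDerivSymm c z).toLinearMap
          (LinearMap.ext fun v => chartDeriv_chartDerivSymm hz v)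
          (LinearMap.ext fun v => chartDerivSymm_chartDeriv hz v)
      exact (h z hzΛ).map (Submodule.orderIsoMapComap ee)
    · rintro _ ⟨v, hv, rfl⟩
      change R' z (chartDeriv c z v) = chartDeriv c z v
      rw [hR', chartDerivSymm_chartDeriv hz, hRU z hzΛ v hv]
    · rintro _ ⟨v, hv, rfl⟩
      change R' z (chartDeriv c z v) = 0
      rw [hR', chartDerivSymm_chartDeriv hz, hRS z hzΛ v hv]
      exact map_zero _
  have h₀ := hgood c (mem_chart_source _ c) hc
  have hlim : Tendsto R' (𝓝[Λ] c) (𝓝 (R' c)) :=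
    Filter.Tendsto.oblique_projection (hU c hc) (hS c hc)
      (hsrc.mono fun z hz => hgood z hz.1 hz.2) h₀.1 h₀.2.1 h₀.2.2
  have hlim2 : Tendsto (fun p : M × EuclideanSpace ℝ (Fin d) => (p.1, R' p.1 p.2))
      (𝓝[Λ] c ×ˢ 𝓝 w) (𝓝 (c, R' c w)) := by
    rw [nhds_prod_eq]
    refine Tendsto.prodMk (tendsto_fst.mono_right nhdsWithin_le_nhds) ?_
    exact Filter.Tendsto.continuousLinearMap_apply (hlim.comp tendsto_fst) tendsto_snd
  have h3 := (continuousAt_chartDerivSymm (mem_chart_source _ c) (R' c w)).tendsto.comp hlim2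
  have h4 : ∀ z ∈ (chartAt (EuclideanSpace ℝ (Fin d)) c).source, ∀ w,
      chartDerivSymm c z (R' z w) = R z (chartDerivSymm c z w) := fun z hz w => by
    rw [hR', chartDerivSymm_chartDeriv hz]
  simp only [Function.comp_def] at h3
  rw [h4 c (mem_chart_source _ c)] at h3
  refine h3.congr' ?_
  filter_upwards [tendsto_fst.eventually hsrc] with p hp
  rw [h4 _ hp.1]

theorem ContinuousSubspaceFieldOn.tendsto_comp_projection
    {U S : ∀ x : M, Submodule ℝ (TangentSpace (𝓡 d) x)}
    {Λ : Set M} (hU : ContinuousSubspaceFieldOn U Λ) (hS : ContinuousSubspaceFieldOn S Λ)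
    (h : ∀ x ∈ Λ, IsCompl (U x) (S x))
    {R : ∀ x : M, TangentSpace (𝓡 d) x →ₗ[ℝ] TangentSpace (𝓡 d) x}
    (hRU : ∀ x ∈ Λ, ∀ v ∈ U x, R x v = v) (hRS : ∀ x ∈ Λ, ∀ v ∈ S x, R x v = 0)
    {n : ∀ x : M, Seminorm ℝ (TangentSpace (𝓡 d) x)}
    (hn : Continuous fun p : TangentBundle (𝓡 d) M => n p.1 p.2)
    {c : M} (hc : c ∈ Λ) (w : EuclideanSpace ℝ (Fin d)) :
    Tendsto (fun p : M × EuclideanSpace ℝ (Fin d) =>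
      (n p.1).comp (R p.1) (chartDerivSymm c p.1 p.2)) (𝓝[Λ] c ×ˢ 𝓝 w)
      (𝓝 ((n c).comp (R c) (chartDerivSymm c c w))) :=
  (hn.tendsto ⟨c, R c (chartDerivSymm c c w)⟩).comp (hU.tendsto_projection hS h hRU hRS hc w)

end Splitting

theorem mfderiv_iterate_succ {d : ℕ} {M : Type*} [TopologicalSpace M]
    [ChartedSpace (EuclideanSpace ℝ (Fin d)) M] {f : M → M} (hf : ContMDiff (𝓡 d) (𝓡 d) 1 f) (k : ℕ) (x : M) (v : TangentSpace (𝓡 d) x) :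
    mfderiv (𝓡 d) (𝓡 d) (f^[k + 1]) x v =
      mfderiv (𝓡 d) (𝓡 d) (f^[k]) (f x) (mfderiv (𝓡 d) (𝓡 d) f x v) := by
  have h := mfderiv_comp (I := 𝓡 d) (I' := 𝓡 d) (I'' := 𝓡 d) x
    (((hf.iterate k).mdifferentiable one_ne_zero) (f x)) ((hf.mdifferentiable one_ne_zero) x)
  exact congrArg (fun A => A v) h

/-! ### Norms adapted to the dynamics -/

section OrbitNorm

variable {d : ℕ} {M : Type*} [TopologicalSpace M]
    [ChartedSpace (EuclideanSpace ℝ (Fin d)) M] [IsManifold (𝓡 d) 1 M] (F : FinslerNorm d M)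

/-- The seminorm `∑_{k < m} e^{-k s} ‖T f^k v‖` on the tangent space at `x`. -/
def FinslerNorm.orbitNorm (f : M → M) (s : ℝ) (m : ℕ) (x : M) :
    Seminorm ℝ (TangentSpace (𝓡 d) x) :=
  ∑ k ∈ Finset.range m, (Real.exp (-(k * s))).toNNReal •
    (F.normAt (f^[k] x)).comp (mfderiv (𝓡 d) (𝓡 d) (f^[k]) x).toLinearMap

theorem FinslerNorm.orbitNorm_apply (f : M → M) (s : ℝ) (m : ℕ) (x : M)
    (v : TangentSpace (𝓡 d) x) :
    F.orbitNorm f s m x v = ∑ k ∈ Finset.range m,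
      Real.exp (-(k * s)) * F.normAt (f^[k] x) (mfderiv (𝓡 d) (𝓡 d) (f^[k]) x v) := by
  rw [FinslerNorm.orbitNorm]
  have hsum : ∀ (p : ℕ → Seminorm ℝ (TangentSpace (𝓡 d) x)) (t : Finset ℕ),
      (∑ k ∈ t, p k) v = ∑ k ∈ t, p k v := fun p t => by
    induction t using Finset.induction_on with
    | empty => rfl
    | insert k t hk ih => rw [Finset.sum_insert hk, Finset.sum_insert hk, ← ih]; rfl
  rw [hsum]
  refine Finset.sum_congr rfl fun k _ => ?_
  rw [smul_apply, NNReal.smul_def, Real.coe_toNNReal _ (Real.exp_pos _).le]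
  rfl

variable {f : M → M}

theorem FinslerNorm.continuous_orbitNorm (hf : ContMDiff (𝓡 d) (𝓡 d) 1 f) (s : ℝ) (m : ℕ) :
    Continuous fun p : TangentBundle (𝓡 d) M => F.orbitNorm f s m p.1 p.2 := by
  simp only [F.orbitNorm_apply]
  refine continuous_finsetSum _ fun k _ => continuous_const.mul ?_
  exact F.continuous_normAt.comp ((hf.iterate k).continuous_tangentMap le_rfl)

/-- The tangent map shifts the sum by one index: the term of index `0` is lost and the term of index
`m` gained, up to the factor `e^s`. One-step contraction or expansion thus reduces to comparing
these two terms. -/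
theorem FinslerNorm.orbitNorm_map (hf : ContMDiff (𝓡 d) (𝓡 d) 1 f) (s : ℝ) (m : ℕ) (x : M) (v : TangentSpace (𝓡 d) x) :
    F.orbitNorm f s m (f x) (mfderiv (𝓡 d) (𝓡 d) f x v) = Real.exp s * (F.orbitNorm f s m x v -
      F.normAt x v + Real.exp (-(m * s)) *
        F.normAt (f^[m] x) (mfderiv (𝓡 d) (𝓡 d) (f^[m]) x v)) := by
  have h0 : F.normAt x v = Real.exp (-((0 : ℕ) * s)) *
      F.normAt (f^[0] x) (mfderiv (𝓡 d) (𝓡 d) (f^[0]) x v) := by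
    have : mfderiv (𝓡 d) (𝓡 d) (f^[0]) x v = v := by
      rw [Function.iterate_zero, mfderiv_id]; rfl
    rw [this]
    simp
    rfl
  rw [F.orbitNorm_apply, F.orbitNorm_apply]
  set g : ℕ → ℝ := fun k => Real.exp (-(k * s)) *
    F.normAt (f^[k] x) (mfderiv (𝓡 d) (𝓡 d) (f^[k]) x v) with hg
  have h1 : ∑ k ∈ Finset.range m, Real.exp (-(k * s)) * F.normAt (f^[k] (f x))
      (mfderiv (𝓡 d) (𝓡 d) (f^[k]) (f x) (mfderiv (𝓡 d) (𝓡 d) f x v)) =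
      ∑ k ∈ Finset.range m, Real.exp s * g (k + 1) := by
    refine Finset.sum_congr rfl fun k _ => ?_
    rw [hg]
    simp only
    rw [mfderiv_iterate_succ hf, ← mul_assoc, ← Real.exp_add]
    congr 2
    push_cast
    ring
  rw [h1, ← Finset.mul_sum, h0]
  congr 1
  have h2 := Finset.sum_range_succ g m
  rw [Finset.sum_range_succ'] at h2
  change _ = _ - g 0 + g m
  linarith

theorem FinslerNorm.orbitNorm_map_le (hf : ContMDiff (𝓡 d) (𝓡 d) 1 f) {Λ : Set M} (hΛ : MapsTo f Λ Λ) {B : ℝ}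
    (hB : ∀ x ∈ Λ, ∀ v : TangentSpace (𝓡 d) x,
      F.normAt (f x) (mfderiv (𝓡 d) (𝓡 d) f x v) ≤ B * F.normAt x v)
    (s : ℝ) (m : ℕ) {x : M} (hx : x ∈ Λ) (v : TangentSpace (𝓡 d) x) :
    F.orbitNorm f s m (f x) (mfderiv (𝓡 d) (𝓡 d) f x v) ≤ B * F.orbitNorm f s m x v := by
  rw [F.orbitNorm_apply, F.orbitNorm_apply, Finset.mul_sum]
  refine Finset.sum_le_sum fun k _ => ?_
  have h1 : F.normAt (f^[k] (f x)) (mfderiv (𝓡 d) (𝓡 d) (f^[k]) (f x)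
      (mfderiv (𝓡 d) (𝓡 d) f x v)) ≤ B * F.normAt (f^[k] x) (mfderiv (𝓡 d) (𝓡 d) (f^[k]) x v) := by
    rw [← mfderiv_iterate_succ hf]
    have h2 := hB (f^[k] x) (hΛ.iterate k hx) (mfderiv (𝓡 d) (𝓡 d) (f^[k]) x v)
    have h3 := mfderiv_comp (I := 𝓡 d) (I' := 𝓡 d) (I'' := 𝓡 d) x
      ((hf.mdifferentiable one_ne_zero) (f^[k] x)) (((hf.iterate k).mdifferentiable one_ne_zero) x)
    rw [← Function.iterate_succ'] at h3
    have h4 : mfderiv (𝓡 d) (𝓡 d) (f^[k + 1]) x v = mfderiv (𝓡 d) (𝓡 d) f (f^[k] x)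
      (mfderiv (𝓡 d) (𝓡 d) (f^[k]) x v) := congrArg (fun A => A v) h3
    rw [h4, ← Function.iterate_succ_apply, Function.iterate_succ_apply']
    exact h2
  calc _ ≤ Real.exp (-(k * s)) *
        (B * F.normAt (f^[k] x) (mfderiv (𝓡 d) (𝓡 d) (f^[k]) x v)) := by gcongr
    _ = _ := by ring

theorem FinslerNorm.normAt_le_orbitNorm (s : ℝ) {m : ℕ} (hm : m ≠ 0) (x : M)
    (v : TangentSpace (𝓡 d) x) : F.normAt x v ≤ F.orbitNorm f s m x v := by
  rw [F.orbitNorm_apply]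
  have := Finset.single_le_sum (s := Finset.range m) (f := fun k : ℕ => Real.exp (-(k * s)) *
    F.normAt (f^[k] x) (mfderiv (𝓡 d) (𝓡 d) (f^[k]) x v))
    (fun k _ => mul_nonneg (Real.exp_pos _).le (apply_nonneg _ _))
    (Finset.mem_range.2 (Nat.pos_of_ne_zero hm))
  refine le_trans (le_of_eq ?_) this
  have : mfderiv (𝓡 d) (𝓡 d) (f^[0]) x v = v := by
    rw [Function.iterate_zero, mfderiv_id]; rfl
  rw [this]
  simp
  rfl

/-- The tangent map of a `C^1` map is bounded over a compact set. -/
theorem FinslerNorm.exists_normAt_mfderiv_le (hf : ContMDiff (𝓡 d) (𝓡 d) 1 f) {Λ : Set M} (hΛ : IsCompact Λ) :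
    ∃ B : ℝ, 1 ≤ B ∧ ∀ x ∈ Λ, ∀ v : TangentSpace (𝓡 d) x,
      F.normAt (f x) (mfderiv (𝓡 d) (𝓡 d) f x v) ≤ B * F.normAt x v := by
  -- The bound passes to subsets and unions, so it is enough to find one near each point, where it
  -- follows from the bound at that point and joint continuity.
  refine hΛ.induction_on (p := fun Λ => ∃ B : ℝ, 1 ≤ B ∧ ∀ x ∈ Λ, ∀ v : TangentSpace (𝓡 d) x,
      F.normAt (f x) (mfderiv (𝓡 d) (𝓡 d) f x v) ≤ B * F.normAt x v) ⟨1, le_rfl, by simp⟩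
    (fun s t hst ⟨B, hB, h⟩ => ⟨B, hB, fun x hx => h x (hst hx)⟩) ?_ ?_
  · rintro s t ⟨B, hB, h⟩ ⟨B', hB', h'⟩
    refine ⟨max B B', hB.trans (le_max_left _ _), ?_⟩
    rintro x (hx | hx) v
    · exact (h x hx v).trans (by gcongr; exact le_max_left _ _)
    · exact (h' x hx v).trans (by gcongr; exact le_max_right _ _)
  · intro c _
    let n : Seminorm ℝ (EuclideanSpace ℝ (Fin d)) := (F.normAt (f c)).comp
      ((mfderiv (𝓡 d) (𝓡 d) f c).toLinearMap ∘ₗ (chartDerivSymm c c).toLinearMap)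
    obtain ⟨K₁, hK₁, h₁⟩ := n.exists_le_mul_norm
    obtain ⟨K, hK, h₂⟩ := F.exists_eventually_normAt_comparable c
    have key := eventually_forall_abs_sub_le_of_homogeneous (l := 𝓝 c)
      (g := fun z w => F.normAt (f z) (mfderiv (𝓡 d) (𝓡 d) f z (chartDerivSymm c z w))) (g₀ := n)
      (Eventually.of_forall fun z t w => by
        rw [map_smul, map_smul, map_smul_eq_mul, Real.norm_eq_abs])
      (fun t w => by rw [map_smul_eq_mul, Real.norm_eq_abs])
      n.continuous_of_finiteDimensional
      (fun w => by
        rw [← nhds_prod_eq]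
        exact (F.continuous_normAt.comp
          (hf.continuous_tangentMap le_rfl)).continuousAt.comp
          (continuousAt_chartDerivSymm (mem_chart_source _ c) w))
      one_pos
    refine ⟨_, mem_nhdsWithin_of_mem_nhds
      (key.and (h₂.and (chart_source_mem_nhds (EuclideanSpace ℝ (Fin d)) c))),
      max 1 ((K₁ + 1) * K), le_max_left _ _, ?_⟩
    rintro z ⟨hz, hz₂, hz₃⟩ v
    have a₁ := hz (chartDeriv c z v)
    have a₂ := h₁ (chartDeriv c z v)
    have a₃ := (hz₂ v).2
    rw [chartDerivSymm_chartDeriv hz₃, abs_le] at a₁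
    calc _ ≤ (K₁ + 1) * ‖chartDeriv c z v‖ := by linarith
      _ ≤ (K₁ + 1) * (K * F.normAt z v) := by gcongr
      _ ≤ _ := by
        rw [← mul_assoc]
        gcongr
        exact le_max_right _ _

end OrbitNorm

/-! ### Hyperbolicity in one iterate -/

section AdaptedSplitting

variable {d : ℕ} {M : Type*} [TopologicalSpace M]
    [ChartedSpace (EuclideanSpace ℝ (Fin d)) M] [IsManifold (𝓡 d) 1 M]

/-- A splitting of the tangent spaces over `Λ`, given by the projections on the unstable spaces
along the stable ones, together with seminorms `nu`, `ns` measuring the unstable and stable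
components, for which the expansion and the contraction are visible after one iterate. -/
structure AdaptedSplitting (d : ℕ) {M : Type*} [TopologicalSpace M]
    [ChartedSpace (EuclideanSpace ℝ (Fin d)) M] [IsManifold (𝓡 d) 1 M] (f : M → M) (Λ : Set M) where
  /-- The projection on the unstable space along the stable space. -/
  proj : ∀ x : M, TangentSpace (𝓡 d) x →ₗ[ℝ] TangentSpace (𝓡 d) x
  /-- The size of the unstable component. -/
  nu : ∀ x : M, Seminorm ℝ (TangentSpace (𝓡 d) x)
  /-- The size of the stable component. -/
  ns : ∀ x : M, Seminorm ℝ (TangentSpace (𝓡 d) x)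
  /-- The contraction rate. -/
  a : ℝ
  /-- The expansion rate. -/
  b : ℝ
  /-- A bound of the tangent map in the unstable direction. -/
  B : ℝ
  /-- The unstable dimension. -/
  dimU : ℕ
  a_pos : 0 < a
  a_lt_one : a < 1
  one_lt_b : 1 < b
  one_le_B : 1 ≤ B
  finrank_range : ∀ x ∈ Λ, Module.finrank ℝ (LinearMap.range (proj x)) = dimU
  proj_proj : ∀ x ∈ Λ, ∀ v, proj x (proj x v) = proj x v
  nu_proj : ∀ x ∈ Λ, ∀ v, nu x (proj x v) = nu x v
  ns_proj : ∀ x ∈ Λ, ∀ v, ns x (proj x v) = 0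
  nu_sub_proj : ∀ x ∈ Λ, ∀ v, nu x (v - proj x v) = 0
  ns_sub_proj : ∀ x ∈ Λ, ∀ v, ns x (v - proj x v) = ns x v
  eq_zero : ∀ x ∈ Λ, ∀ v, nu x v = 0 → ns x v = 0 → v = 0
  ns_map_le : ∀ x ∈ Λ, ∀ v, ns (f x) (mfderiv (𝓡 d) (𝓡 d) f x v) ≤ a * ns x v
  le_nu_map : ∀ x ∈ Λ, ∀ v, b * nu x v ≤ nu (f x) (mfderiv (𝓡 d) (𝓡 d) f x v)
  nu_map_le : ∀ x ∈ Λ, ∀ v, nu (f x) (mfderiv (𝓡 d) (𝓡 d) f x v) ≤ B * nu x v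
  tendsto_nu : ∀ c ∈ Λ, ∀ w, Tendsto (fun p : M × EuclideanSpace ℝ (Fin d) =>
    nu p.1 (chartDerivSymm c p.1 p.2)) (𝓝[Λ] c ×ˢ 𝓝 w) (𝓝 (nu c (chartDerivSymm c c w)))
  tendsto_ns : ∀ c ∈ Λ, ∀ w, Tendsto (fun p : M × EuclideanSpace ℝ (Fin d) =>
    ns p.1 (chartDerivSymm c p.1 p.2)) (𝓝[Λ] c ×ˢ 𝓝 w) (𝓝 (ns c (chartDerivSymm c c w)))

/-- Giving up half of the weaker exponent leaves a factor `e^{-m r}` to spare, which absorbs `C`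
once `m * r ≥ log C`. -/
theorem exists_pos_rate_and_time {lams lamu C : ℝ} (hs : lams < 0) (hu : 0 < lamu) (hC : 1 ≤ C) :
    ∃ (r : ℝ) (m : ℕ), 0 < r ∧ m ≠ 0 ∧ Real.exp (m * r) * (C * Real.exp (m * lams)) ≤ 1 ∧
      1 ≤ Real.exp (-(m * r)) * (C⁻¹ * Real.exp (m * lamu)) := by
  set r := min (-lams) lamu / 2 with hr
  have hmin : 0 < min (-lams) lamu := lt_min (by linarith) hu
  have hr0 : 0 < r := by positivity
  have h1 : r + lams ≤ -r := by linarith [min_le_left (-lams) lamu]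
  have h2 : r ≤ -r + lamu := by linarith [min_le_right (-lams) lamu]
  obtain ⟨m, hm⟩ := exists_nat_gt (Real.log C / r)
  have hlog : 0 ≤ Real.log C := Real.log_nonneg hC
  have hm0 : (0 : ℝ) < m := lt_of_le_of_lt (by positivity) hm
  have hm' : Real.log C ≤ m * r := by
    rw [div_lt_iff₀ hr0] at hm; exact hm.le
  have hC0 : 0 < C := by linarith
  refine ⟨r, m, hr0, by exact_mod_cast hm0.ne', ?_, ?_⟩
  · rw [← Real.exp_log hC0, ← Real.exp_add, ← Real.exp_add, Real.exp_le_one_iff]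
    nlinarith
  · rw [← Real.exp_log hC0, ← Real.exp_neg, ← Real.exp_add, ← Real.exp_add, Real.one_le_exp_iff]
    nlinarith

/-- The unstable part is measured with weights `e^{-k r}` and the stable part with weights `e^{k
r}`. By the choice of `m`, the term exchanged in `orbitNorm_map` has the favourable sign in both
cases. -/
theorem IsHyperbolicSet.exists_adaptedSplitting {F : FinslerNorm d M} {f : M → M}
    (hf : ContMDiff (𝓡 d) (𝓡 d) 1 f) {Λ : Set M} (hΛc : IsCompact Λ) (h : IsHyperbolicSet F f Λ) :
    Nonempty (AdaptedSplitting d f Λ) := by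
  obtain ⟨hfΛ, du, ds, Eu, Es, lams, lamu, C, -, -, hs, hu, hC, hsplit, hEu, hEs, hinv, hhyp⟩ := h
  have hmaps : MapsTo f Λ Λ := fun x hx => hfΛ ▸ mem_image_of_mem f hx
  obtain ⟨r, m, hr, hm, hm₁, hm₂⟩ := exists_pos_rate_and_time hs hu hC
  obtain ⟨B, hB1, hB⟩ := F.exists_normAt_mfderiv_le hf hΛc
  have hP : ∀ x : M, ∃ P : TangentSpace (𝓡 d) x →ₗ[ℝ] TangentSpace (𝓡 d) x,
      x ∈ Λ → (∀ v ∈ Eu x, P v = v) ∧ (∀ v ∈ Es x, P v = 0) ∧ (∀ v, P v ∈ Eu x) ∧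
        ∀ v, v - P v ∈ Es x := by
    intro x
    by_cases hx : x ∈ Λ
    · have hc := (hsplit x hx).1
      refine ⟨(Eu x).projection (Es x) hc, fun _ =>
        ⟨fun v hv => Submodule.projection_apply_of_mem_left hc hv,
          fun v hv => (Submodule.projection_apply_eq_zero_iff hc).2 hv,
          fun v => Submodule.projection_apply_mem hc v, fun v => ?_⟩⟩
      rw [← Submodule.projection_apply_eq_zero_iff hc, map_sub,
        Submodule.projection_apply_of_mem_left hc (Submodule.projection_apply_mem hc v), sub_self]
    · exact ⟨0, fun h => absurd h hx⟩
  choose P hP using hP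
  -- Invariance of both fields makes the projections commute with the tangent map; for the stable
  -- field, inclusion is enough.
  have hPm : ∀ x ∈ Λ, ∀ v, P (f x) (mfderiv (𝓡 d) (𝓡 d) f x v) =
      mfderiv (𝓡 d) (𝓡 d) f x (P x v) := by
    intro x hx v
    obtain ⟨h1, h2, h3, h4⟩ := hP x hx
    obtain ⟨h1', h2', -, -⟩ := hP (f x) (hmaps hx)
    have e1 : mfderiv (𝓡 d) (𝓡 d) f x (P x v) ∈ Eu (f x) := by
      rw [← (hinv x hx).1]
      exact Submodule.mem_map_of_mem (h3 v)
    have e2 : mfderiv (𝓡 d) (𝓡 d) f x (v - P x v) ∈ Es (f x) :=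
      (hinv x hx).2 (Submodule.mem_map_of_mem (h4 v))
    have e3 := h2' _ e2
    rw [map_sub, map_sub, sub_eq_zero] at e3
    rw [e3, h1' _ e1]
  have hpp : ∀ x ∈ Λ, ∀ v, P x (P x v) = P x v := fun x hx v =>
    (hP x hx).1 _ ((hP x hx).2.2.1 v)
  refine ⟨{
    proj := P
    nu := fun x => (F.orbitNorm f r m x).comp (P x)
    ns := fun x => (F.orbitNorm f (-r) m x).comp (LinearMap.id - P x)
    a := Real.exp (-r)
    b := Real.exp r
    B := B
    dimU := du
    a_pos := Real.exp_pos _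
    a_lt_one := by rw [Real.exp_lt_one_iff]; linarith
    one_lt_b := by rwa [Real.one_lt_exp_iff]
    one_le_B := hB1
    finrank_range := ?_
    proj_proj := hpp
    nu_proj := fun x hx v => congrArg (F.orbitNorm f r m x) (hpp x hx v)
    ns_proj := ?_
    nu_sub_proj := ?_
    ns_sub_proj := ?_
    eq_zero := ?_
    ns_map_le := ?_
    le_nu_map := ?_
    nu_map_le := ?_
    tendsto_nu := ?_
    tendsto_ns := ?_ }⟩
  · intro x hx
    have : LinearMap.range (P x) = Eu x := by
      ext v
      constructor
      · rintro ⟨w, rfl⟩; exact (hP x hx).2.2.1 w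
      · intro hv; exact ⟨v, (hP x hx).1 v hv⟩
    rw [this]
    exact (hsplit x hx).2.1
  · intro x hx v
    change F.orbitNorm f (-r) m x (P x v - P x (P x v)) = 0
    rw [hpp x hx, sub_self, map_zero]
  · intro x hx v
    change F.orbitNorm f r m x (P x (v - P x v)) = 0
    rw [map_sub, hpp x hx, sub_self, map_zero]
  · intro x hx v
    change F.orbitNorm f (-r) m x ((v - P x v) - P x (v - P x v)) =
      F.orbitNorm f (-r) m x (v - P x v)
    rw [map_sub (P x), hpp x hx, sub_self, sub_zero]
  · intro x hx v h1 h2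
    change F.orbitNorm f r m x (P x v) = 0 at h1
    change F.orbitNorm f (-r) m x (v - P x v) = 0 at h2
    have e1 := F.eq_zero_of_normAt_eq_zero x (P x v)
      (le_antisymm (h1 ▸ F.normAt_le_orbitNorm (f := f) r hm x _) (apply_nonneg _ _))
    have e2 := F.eq_zero_of_normAt_eq_zero x (v - P x v)
      (le_antisymm (h2 ▸ F.normAt_le_orbitNorm (f := f) (-r) hm x _) (apply_nonneg _ _))
    rwa [e1, sub_zero] at e2
  · intro x hx v
    change F.orbitNorm f (-r) m (f x) (mfderiv (𝓡 d) (𝓡 d) f x v -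
      P (f x) (mfderiv (𝓡 d) (𝓡 d) f x v)) ≤ Real.exp (-r) * F.orbitNorm f (-r) m x (v - P x v)
    rw [hPm x hx, ← map_sub, F.orbitNorm_map hf]
    gcongr
    have h1 := (hhyp x hx m).1 _ ((hP x hx).2.2.2 v)
    have h2 : Real.exp (-(m * -r)) * F.normAt (f^[m] x) (mfderiv (𝓡 d) (𝓡 d) (f^[m]) x (v - P x v))
        ≤ F.normAt x (v - P x v) := by
      calc _ ≤ Real.exp (m * r) * (C * Real.exp (m * lams) * F.normAt x (v - P x v)) := by
            rw [mul_neg, neg_neg]; gcongr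
        _ = (Real.exp (m * r) * (C * Real.exp (m * lams))) * F.normAt x (v - P x v) := by ring
        _ ≤ 1 * F.normAt x (v - P x v) := by gcongr
        _ = _ := one_mul _
    linarith
  · intro x hx v
    change Real.exp r * F.orbitNorm f r m x (P x v) ≤ F.orbitNorm f r m (f x)
      (P (f x) (mfderiv (𝓡 d) (𝓡 d) f x v))
    rw [hPm x hx, F.orbitNorm_map hf]
    gcongr
    have h1 := (hhyp x hx m).2 _ ((hP x hx).2.2.1 v)
    have h2 : F.normAt x (P x v) ≤
        Real.exp (-(m * r)) * F.normAt (f^[m] x) (mfderiv (𝓡 d) (𝓡 d) (f^[m]) x (P x v)) := by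
      calc F.normAt x (P x v) = 1 * F.normAt x (P x v) := (one_mul _).symm
        _ ≤ (Real.exp (-(m * r)) * (C⁻¹ * Real.exp (m * lamu))) * F.normAt x (P x v) := by gcongr
        _ = Real.exp (-(m * r)) * (C⁻¹ * Real.exp (m * lamu) * F.normAt x (P x v)) := by ring
        _ ≤ _ := by gcongr
    linarith
  · intro x hx v
    change F.orbitNorm f r m (f x) (P (f x) (mfderiv (𝓡 d) (𝓡 d) f x v)) ≤
      B * F.orbitNorm f r m x (P x v)
    rw [hPm x hx]
    exact F.orbitNorm_map_le hf hmaps hB r m hx _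
  · intro c hc w
    exact hEu.tendsto_comp_projection hEs (fun x hx => (hsplit x hx).1) (fun x hx => (hP x hx).1)
      (fun x hx => (hP x hx).2.1) (F.continuous_orbitNorm hf r m) hc w
  · intro c hc w
    -- The complementary projection is the oblique projection for the two fields exchanged.
    exact hEs.tendsto_comp_projection hEu (fun x hx => (hsplit x hx).1.symm)
      (R := fun x => LinearMap.id - P x)
      (fun x hx v hv => (congrArg (v - ·) ((hP x hx).2.1 v hv)).trans (sub_zero v))
      (fun x hx v hv => (congrArg (v - ·) ((hP x hx).1 v hv)).trans (sub_self v))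
      (F.continuous_orbitNorm hf (-r) m) hc w

end AdaptedSplitting

/-! ### Cross form of a nearly linear hyperbolic map -/

/-- A projection `proj` of `V` together with seminorms `nu`, `ns` which measure the components of a
vector in the range and in the kernel of the projection. -/
structure SplitNorm (V : Type*) [AddCommGroup V] [Module ℝ V] where
  /-- The projection. -/
  proj : V →ₗ[ℝ] V
  /-- The size of the component in the range of the projection. -/
  nu : Seminorm ℝ V
  /-- The size of the component in the kernel of the projection. -/
  ns : Seminorm ℝ V
  proj_proj : ∀ v, proj (proj v) = proj v
  nu_proj : ∀ v, nu (proj v) = nu v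
  ns_proj : ∀ v, ns (proj v) = 0
  nu_sub_proj : ∀ v, nu (v - proj v) = 0
  ns_sub_proj : ∀ v, ns (v - proj v) = ns v
  eq_zero : ∀ v, nu v = 0 → ns v = 0 → v = 0

namespace SplitNorm

section

variable {V : Type*} [AddCommGroup V] [Module ℝ V] (X X' : SplitNorm V)

/-- The sum of the sizes of both components. -/
def n : Seminorm ℝ V := X.nu + X.ns

theorem n_apply (v : V) : X.n v = X.nu v + X.ns v := rfl

theorem nu_le_n (v : V) : X.nu v ≤ X.n v := by
  rw [n_apply]; linarith [apply_nonneg X.ns v]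

theorem ns_le_n (v : V) : X.ns v ≤ X.n v := by
  rw [n_apply]; linarith [apply_nonneg X.nu v]

theorem eq_zero_of_n_eq_zero (v : V) (h : X.n v = 0) : v = 0 :=
  X.eq_zero v (le_antisymm (h ▸ X.nu_le_n v) (apply_nonneg _ _))
    (le_antisymm (h ▸ X.ns_le_n v) (apply_nonneg _ _))

/-- The relation `rel h h'` is implied by an equation in cross form: the unstable component of `h`
and the stable component of `h'` are Lipschitz functions of the other components. -/
def HasCrossForm (ρ α β κ : ℝ) (rel : V → V → Prop) : Prop :=
  ∃ (G : V → V) (H : V → V → V),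
    (∀ h h', X.n h ≤ ρ → X'.n h' ≤ ρ → h' - X'.proj h' = G h → X.proj h = H h' h → rel h h') ∧
    (∀ h, X'.proj (G h) = 0) ∧ (∀ h' h, X.proj (H h' h) = H h' h) ∧
    (∀ h k, X.n h ≤ ρ → X.n k ≤ ρ →
      X'.ns (G h - G k) ≤ α * X.ns (h - k) + β * X.n (h - k)) ∧
    (∀ h' h k' k, X.n h ≤ ρ → X.n k ≤ ρ →
      X.nu (H h' h - H k' k) ≤ α * X'.nu (h' - k') + β * X.n (h - k)) ∧
    X'.ns (G 0) ≤ κ ∧ X.nu (H 0 0) ≤ κ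

variable {X X'} in
/-- The right inverse of the unstable part of a linear map which expands the unstable direction. -/
theorem exists_unstable_inverse [FiniteDimensional ℝ V]
    (hdim : Module.finrank ℝ (LinearMap.range X.proj) = Module.finrank ℝ (LinearMap.range X'.proj))
    {A : V →ₗ[ℝ] V} {b : ℝ} (hb : 0 < b) (hA : ∀ w, b * X.nu (X.proj w) ≤ X'.nu (A (X.proj w))) :
    ∃ L : V →ₗ[ℝ] V, (∀ v, X.proj (L v) = L v) ∧ (∀ v, X'.proj (A (L v)) = X'.proj v) ∧
      ∀ v, b * X.nu (L v) ≤ X'.nu v := by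
  let D : LinearMap.range X.proj →ₗ[ℝ] LinearMap.range X'.proj :=
    X'.proj.rangeRestrict ∘ₗ A ∘ₗ (LinearMap.range X.proj).subtype
  have hfix : ∀ v : LinearMap.range X.proj, X.proj v = v := by
    rintro ⟨_, w, rfl⟩
    exact X.proj_proj w
  have hD : ∀ v, (D v : V) = X'.proj (A v) := fun v => rfl
  -- Expansion forces injectivity on the unstable space; equality of the dimensions turns this into
  -- bijectivity.
  have hinj : Function.Injective D := by
    rw [injective_iff_map_eq_zero]
    intro v hv
    have h1 : X'.nu (A v) = 0 := by
      rw [← X'.nu_proj, ← hD, hv]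
      exact map_zero X'.nu
    have h2 := hA v
    rw [hfix, h1] at h2
    have h3 : X.nu v = 0 := le_antisymm (by
      by_contra h; push Not at h; nlinarith) (apply_nonneg _ _)
    have h4 : X.ns v = 0 := by rw [← hfix]; exact X.ns_proj _
    exact Subtype.ext (X.eq_zero _ h3 h4)
  let e := D.linearEquivOfInjective hinj hdim
  have he : ∀ v, D (e.symm v) = v := fun v => e.apply_symm_apply v
  refine ⟨(LinearMap.range X.proj).subtype ∘ₗ e.symm.toLinearMap ∘ₗ X'.proj.rangeRestrict,
    fun v => hfix _, fun v => ?_, fun v => ?_⟩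
  · change X'.proj (A (e.symm (X'.proj.rangeRestrict v) : V)) = _
    rw [← hD, he]
    rfl
  · change b * X.nu (e.symm (X'.proj.rangeRestrict v) : V) ≤ _
    have h2 := hA (e.symm (X'.proj.rangeRestrict v) : V)
    rw [hfix, ← X'.nu_proj, ← hD, he] at h2
    refine h2.trans_eq ?_
    exact X'.nu_proj v

variable {X X'} in
/-- A map which is close to a linear map compatible with the splittings has a cross form. -/
theorem hasCrossForm_of_linear_approx [FiniteDimensional ℝ V]
    (hdim : Module.finrank ℝ (LinearMap.range X.proj) = Module.finrank ℝ (LinearMap.range X'.proj))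
    {A : V →ₗ[ℝ] V} {a b B δ α : ℝ} (hδ : 0 ≤ δ) (hb : 1 ≤ b - δ) (hα : (b - δ)⁻¹ ≤ α) (haα : a ≤ α)
    (h₁ : ∀ w, X'.ns (A w) ≤ a * X.ns w + δ * X.n w)
    (h₂ : ∀ w, b * X.nu w - δ * X.n w ≤ X'.nu (A w))
    (h₃ : ∀ w, X'.nu (A w) ≤ B * X.nu w + δ * X.n w)
    {ρ : ℝ} {F : V → V}
    (hF : ∀ h k, X.n h ≤ ρ → X.n k ≤ ρ → X'.n (F h - F k - A (h - k)) ≤ δ * X.n (h - k))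
    {rel : V → V → Prop} (hrel : ∀ h, X.n h ≤ ρ → X'.n (F h) ≤ ρ → rel h (F h)) :
    X.HasCrossForm X' ρ α (2 * δ) (X'.n (F 0)) rel := by
  have hb0 : 0 < b - δ := by linarith
  have hnP : ∀ w, X.n (X.proj w) = X.nu (X.proj w) := fun w => by
    rw [n_apply, X.ns_proj, add_zero]
  have hnQ : ∀ w, X.n (w - X.proj w) = X.ns w := fun w => by
    rw [n_apply, X.nu_sub_proj, X.ns_sub_proj, zero_add]
  obtain ⟨L, hL₁, hL₂, hL₃⟩ := exists_unstable_inverse (A := A) hdim hb0 fun w => by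
    have := h₂ (X.proj w)
    rw [hnP] at this
    linarith
  have hLle : ∀ v t, X'.nu v ≤ t → X.nu (L v) ≤ (b - δ)⁻¹ * t := fun v t ht => by
    rw [inv_mul_eq_div, le_div_iff₀' hb0]
    exact (hL₃ v).trans ht
  have hinv1 : (b - δ)⁻¹ ≤ 1 := inv_le_one_of_one_le₀ hb
  -- `G` is the stable part of `F`. `H` comes from adding the unstable action `A (X.proj h)` to the
  -- defect `h' - F h` and applying the inverse `L`: its fixed equation says exactly that `h'` and
  -- `F h` have the same unstable part.
  refine ⟨fun h => F h - X'.proj (F h),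
    fun h' h => L (h' - F h + A (X.proj h)), ?_, ?_, ?_, ?_, ?_, ?_, ?_⟩
  · intro h h' hh hh' hs hu
    have e1 : X'.proj (A (X.proj h)) = X'.proj (h' - F h + A (X.proj h)) := by
      rw [hu, hL₂, ← hu]
    rw [map_add, map_sub, right_eq_add, sub_eq_zero] at e1
    simp only at hs
    rw [e1, sub_left_inj] at hs
    subst hs
    exact hrel h hh hh'
  · intro h
    rw [map_sub, X'.proj_proj, sub_self]
  · exact fun h' h => hL₁ _
  · intro h k hh hk
    have e1 : F h - X'.proj (F h) - (F k - X'.proj (F k)) =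
        (F h - F k) - X'.proj (F h - F k) := by rw [map_sub]; abel
    have e2 : F h - F k = A (h - k) + (F h - F k - A (h - k)) := by abel
    rw [e1, X'.ns_sub_proj, e2]
    have e3 := map_add_le_add X'.ns (A (h - k)) (F h - F k - A (h - k))
    have e4 := h₁ (h - k)
    have e5 := (X'.ns_le_n _).trans (hF h k hh hk)
    have e6 : a * X.ns (h - k) ≤ α * X.ns (h - k) := by gcongr
    linarith
  · intro h' h k' k hh hk
    -- The unstable part of `A (h - k)` cancels, leaving the difference of the targets, the
    -- nonlinear error, and the image of the stable part.
    have e1 : L (h' - F h + A (X.proj h)) - L (k' - F k + A (X.proj k)) =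
        L ((h' - k') - (F h - F k - A (h - k)) - A ((h - k) - X.proj (h - k))) := by
      rw [← map_sub]
      congr 1
      simp only [map_sub]
      abel
    rw [e1]
    have e2 := map_sub_le_add X'.nu ((h' - k') - (F h - F k - A (h - k)))
      (A ((h - k) - X.proj (h - k)))
    have e3 := map_sub_le_add X'.nu (h' - k') (F h - F k - A (h - k))
    have e4 := (X'.nu_le_n _).trans (hF h k hh hk)
    -- A stable vector has an image of unstable size at most `δ` times its own; together with the
    -- nonlinear error this gives `2 * δ`.
    have e5 := h₃ ((h - k) - X.proj (h - k))
    rw [X.nu_sub_proj, hnQ, mul_zero, zero_add] at e5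
    have e6 : δ * X.ns (h - k) ≤ δ * X.n (h - k) := by gcongr; exact X.ns_le_n _
    refine (hLle _ (X'.nu (h' - k') + 2 * δ * X.n (h - k)) (by linarith)).trans ?_
    rw [mul_add]
    have : 0 ≤ 2 * δ * X.n (h - k) := mul_nonneg (by linarith) (apply_nonneg _ _)
    exact add_le_add (mul_le_mul_of_nonneg_right hα (apply_nonneg _ _))
      (mul_le_of_le_one_left this hinv1)
  · rw [X'.ns_sub_proj]
    exact X'.ns_le_n _
  · simp only [map_zero, add_zero, zero_sub]
    refine (hLle _ (X'.n (F 0)) ?_).trans ?_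
    · rw [map_neg_eq_map]; exact X'.nu_le_n _
    · have : 0 ≤ X'.n (F 0) := apply_nonneg _ _
      nlinarith

end

end SplitNorm

/-! ### Fixed points and cyclic systems in cross form -/

/-- A map which contracts a norm on a nonempty compact set has a fixed point. -/
theorem Seminorm.exists_fixedPoint {W : Type*} [NormedAddCommGroup W] [NormedSpace ℝ W]
    [FiniteDimensional ℝ W] (n : Seminorm ℝ W) (hn : ∀ v, n v = 0 → v = 0) {S : Set W}
    (hS : IsCompact S) (hne : S.Nonempty) {Φ : W → W} (hΦ : MapsTo Φ S S) {θ : ℝ} (hθ : θ < 1)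
    (hlip : ∀ v ∈ S, ∀ w ∈ S, n (Φ v - Φ w) ≤ θ * n (v - w)) : ∃ v ∈ S, Φ v = v := by
  -- The displacement attains its minimum on `S`; applying `Φ` once more would decrease it unless it
  -- is zero.
  have hcont : ContinuousOn (fun v => n (Φ v - v)) S := by
    intro w hw
    have h0 : Tendsto (fun v => (θ + 1) * n (v - w)) (𝓝[S] w) (𝓝 0) := by
      have : Continuous fun v => (θ + 1) * n (v - w) :=
        continuous_const.mul (n.continuous_of_finiteDimensional.comp (continuous_id.sub continuous_const))
      have h := this.tendsto w
      simp only [sub_self, map_zero, mul_zero] at h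
      exact h.mono_left nhdsWithin_le_nhds
    rw [ContinuousWithinAt, tendsto_iff_dist_tendsto_zero]
    refine squeeze_zero' (Eventually.of_forall fun _ => dist_nonneg) ?_ h0
    filter_upwards [self_mem_nhdsWithin] with v hv
    have h1 := abs_sub_map_le_sub n (Φ v - v) (Φ w - w)
    have h2 : Φ v - v - (Φ w - w) = (Φ v - Φ w) - (v - w) := by abel
    rw [h2] at h1
    have h3 := map_sub_le_add n (Φ v - Φ w) (v - w)
    have h4 := hlip v hv w hw
    rw [Real.dist_eq]
    linarith
  obtain ⟨v, hv, hmin⟩ := hS.exists_isMinOn hne hcont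
  refine ⟨v, hv, ?_⟩
  have h1 : n (Φ v - v) ≤ n (Φ (Φ v) - Φ v) := hmin (hΦ hv)
  have h2 := hlip (Φ v) (hΦ hv) v hv
  have h3 : 0 ≤ n (Φ v - v) := apply_nonneg _ _
  exact sub_eq_zero.1 (hn _ (by nlinarith))

namespace SplitNorm

variable {V : Type*} [NormedAddCommGroup V] [NormedSpace ℝ V] [FiniteDimensional ℝ V]

/-- A cyclic system of equations in cross form has a solution in every box which is mapped to
itself. -/
theorem exists_cyclic_solution {ι : Type*} [Fintype ι] (σ : Equiv.Perm ι) (X : ι → SplitNorm V)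
    {ρ α β : ℝ} (hα : 0 ≤ α) (hβ : 0 ≤ β) (hαβ : α + 2 * β < 1) {G : ι → V → V} {H : ι → V → V → V}
    (hG : ∀ i h, (X (σ i)).proj (G i h) = 0) (hH : ∀ i h' h, (X i).proj (H i h' h) = H i h' h)
    (hGlip : ∀ i h k, (X i).n h ≤ ρ → (X i).n k ≤ ρ →
      (X (σ i)).ns (G i h - G i k) ≤ α * (X i).ns (h - k) + β * (X i).n (h - k))
    (hHlip : ∀ i h' h k' k, (X i).n h ≤ ρ → (X i).n k ≤ ρ →
      (X i).nu (H i h' h - H i k' k) ≤ α * (X (σ i)).nu (h' - k') + β * (X i).n (h - k))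
    {R : ι → ℝ} (hR : ∀ i, 0 ≤ R i) (hRρ : ∀ i, 2 * R i ≤ ρ)
    (hGR : ∀ i h, (X i).nu h ≤ R i → (X i).ns h ≤ R i → (X (σ i)).ns (G i h) ≤ R (σ i))
    (hHR : ∀ i h' h, (X i).nu h ≤ R i → (X i).ns h ≤ R i → (X (σ i)).nu h' ≤ R (σ i) →
      (X i).nu (H i h' h) ≤ R i) :
    ∃ v : ι → V, (∀ i, (X i).nu (v i) ≤ R i ∧ (X i).ns (v i) ≤ R i) ∧
      ∀ i, v (σ i) - (X (σ i)).proj (v (σ i)) = G i (v i) ∧ (X i).proj (v i) = H i (v (σ i)) (v i) := by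
  -- The norm on the product is the supremum of all unstable and stable sizes. Each `n` is a sum of
  -- two of them, hence the rate `α + 2 * β`.
  let sn : Seminorm ℝ (ι → V) := Finset.univ.sup fun i =>
    ((X i).nu ⊔ (X i).ns).comp (LinearMap.proj i : (ι → V) →ₗ[ℝ] V)
  have hle : ∀ v i, max ((X i).nu (v i)) ((X i).ns (v i)) ≤ sn v := fun v i =>
    Seminorm.le_finset_sup_apply (p := fun i => ((X i).nu ⊔ (X i).ns).comp
      (LinearMap.proj i : (ι → V) →ₗ[ℝ] V)) (Finset.mem_univ i)
  have hsn : ∀ v c, 0 ≤ c → (∀ i, (X i).nu (v i) ≤ c ∧ (X i).ns (v i) ≤ c) → sn v ≤ c :=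
    fun v c hc h => Seminorm.finset_sup_apply_le hc fun i _ => max_le (h i).1 (h i).2
  let S : Set (ι → V) := {v | ∀ i, (X i).nu (v i) ≤ R i ∧ (X i).ns (v i) ≤ R i}
  have hSn : ∀ v ∈ S, ∀ i, (X i).n (v i) ≤ ρ := fun v hv i => by
    rw [n_apply]; linarith [(hv i).1, (hv i).2, hRρ i]
  have hS0 : (0 : ι → V) ∈ S := fun i => by simp [hR i]
  have hScl : IsClosed S := by
    simp only [S, ofPred_forall, ofPred_and]
    refine isClosed_iInter fun i => IsClosed.inter ?_ ?_
    · exact isClosed_le ((X i).nu.continuous_of_finiteDimensional.comp (continuous_apply i))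
        continuous_const
    · exact isClosed_le ((X i).ns.continuous_of_finiteDimensional.comp (continuous_apply i))
        continuous_const
  have hScpt : IsCompact S := by
    refine Metric.isCompact_of_isClosed_isBounded hScl ?_
    choose K hK hnorm using fun i => (X i).n.exists_norm_le_mul (X i).eq_zero_of_n_eq_zero
    refine (Metric.isBounded_closedBall (x := (0 : ι → V)) (r := ∑ i, K i * |ρ|)).subset ?_
    intro v hv
    rw [mem_closedBall_zero_iff, pi_norm_le_iff_of_nonneg
      (Finset.sum_nonneg fun i _ => mul_nonneg (hK i).le (abs_nonneg _))]
    intro i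
    calc ‖v i‖ ≤ K i * (X i).n (v i) := hnorm i _
      _ ≤ K i * |ρ| := by
        have := (hSn v hv i).trans (le_abs_self ρ)
        have := (hK i).le
        gcongr
      _ ≤ _ := Finset.single_le_sum (f := fun i => K i * |ρ|)
        (fun i _ => mul_nonneg (hK i).le (abs_nonneg _)) (Finset.mem_univ i)
  -- The unstable part at `i` is dictated by the link leaving `i`, the stable part by the link
  -- arriving at `i`. A fixed point solves all links at once.
  let Φ : (ι → V) → ι → V := fun v i => H i (v (σ i)) (v i) + G (σ.symm i) (v (σ.symm i))
  have hPG : ∀ i h, (X i).proj (G (σ.symm i) h) = 0 := fun i h => by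
    have := hG (σ.symm i) h
    rwa [σ.apply_symm_apply] at this
  have hPΦ : ∀ v i, (X i).proj (Φ v i) = H i (v (σ i)) (v i) := fun v i => by
    rw [map_add, hPG, hH, add_zero]
  have hQΦ : ∀ v i, Φ v i - (X i).proj (Φ v i) = G (σ.symm i) (v (σ.symm i)) := fun v i => by
    rw [hPΦ, add_sub_cancel_left]
  have hmaps : MapsTo Φ S S := by
    intro v hv i
    constructor
    · rw [← (X i).nu_proj, hPΦ]
      exact hHR i _ _ (hv i).1 (hv i).2 (hv (σ i)).1
    · rw [← (X i).ns_sub_proj, hQΦ]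
      have := hGR (σ.symm i) _ (hv (σ.symm i)).1 (hv (σ.symm i)).2
      rwa [σ.apply_symm_apply] at this
  have hlip : ∀ v ∈ S, ∀ w ∈ S, sn (Φ v - Φ w) ≤ (α + 2 * β) * sn (v - w) := by
    intro v hv w hw
    have hs0 : 0 ≤ sn (v - w) := apply_nonneg _ _
    have hu : ∀ i, (X i).nu (v i - w i) ≤ sn (v - w) := fun i =>
      (le_max_left _ _).trans (hle (v - w) i)
    have hs : ∀ i, (X i).ns (v i - w i) ≤ sn (v - w) := fun i =>
      (le_max_right _ _).trans (hle (v - w) i)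
    have hn2 : ∀ i, (X i).n (v i - w i) ≤ 2 * sn (v - w) := fun i => by
      rw [n_apply]; linarith [hu i, hs i]
    refine hsn _ _ (by positivity) fun i => ⟨?_, ?_⟩
    · rw [← (X i).nu_proj, Pi.sub_apply, map_sub, hPΦ, hPΦ]
      refine (hHlip i _ _ _ _ (hSn v hv i) (hSn w hw i)).trans ?_
      calc _ ≤ α * sn (v - w) + β * (2 * sn (v - w)) := by gcongr; exacts [hu _, hn2 i]
        _ = _ := by ring
    · have e1 : (X i).ns ((Φ v - Φ w) i) = (X i).ns (G (σ.symm i) (v (σ.symm i)) -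
          G (σ.symm i) (w (σ.symm i))) := by
        rw [← (X i).ns_sub_proj, ← hQΦ, ← hQΦ, Pi.sub_apply, map_sub (X i).proj]
        congr 1
        abel
      have e2 := hGlip (σ.symm i) _ _ (hSn v hv _) (hSn w hw _)
      rw [σ.apply_symm_apply] at e2
      rw [e1]
      refine e2.trans ?_
      calc _ ≤ α * sn (v - w) + β * (2 * sn (v - w)) := by gcongr; exacts [hs _, hn2 _]
        _ = _ := by ring
  have hdef : ∀ v, sn v = 0 → v = 0 := fun v hv => funext fun i => (X i).eq_zero _
    (le_antisymm (((le_max_left _ _).trans (hle v i)).trans_eq hv) (apply_nonneg _ _))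
    (le_antisymm (((le_max_right _ _).trans (hle v i)).trans_eq hv) (apply_nonneg _ _))
  obtain ⟨v, hv, hfix⟩ := sn.exists_fixedPoint hdef hScpt ⟨0, hS0⟩ hmaps hαβ hlip
  refine ⟨v, hv, fun i => ⟨?_, ?_⟩⟩
  · have := hQΦ v (σ i)
    rwa [hfix, σ.symm_apply_apply] at this
  · have := hPΦ v i
    rwa [hfix] at this

end SplitNorm

/-! ### Shadowing in hyperbolic charts -/

/-- Local parametrizations of a neighbourhood of `Λ` in which a map `f` has a cross form with
uniform constants. -/
structure HyperbolicCharts (V : Type*) [NormedAddCommGroup V] [NormedSpace ℝ V] {M : Type*}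
    [MetricSpace M] (f : M → M) (Λ : Set M) where
  /-- The size of the neighbourhood of `Λ`. -/
  ε : ℝ
  /-- The size of the parametrizations. -/
  ρ : ℝ
  /-- The Lipschitz constant of the parametrizations. -/
  L : ℝ
  /-- The contraction rate. -/
  α : ℝ
  /-- The size of the interaction between both directions. -/
  β : ℝ
  ε_pos : 0 < ε
  ρ_pos : 0 < ρ
  one_le_L : 1 ≤ L
  α_nonneg : 0 ≤ α
  β_nonneg : 0 ≤ β
  rate_lt_one : α + 2 * β < 1
  /-- The splitting at each point. -/
  X : M → SplitNorm V
  /-- The parametrization around each point. -/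
  Ψ : M → V → M
  dist_le : ∀ x ∈ Metric.thickening ε Λ, ∀ h, (X x).n h ≤ ρ → dist x (Ψ x h) ≤ L * (X x).n h
  hasCrossForm : ∀ x ∈ Metric.thickening ε Λ, ∀ x' ∈ Metric.thickening ε Λ, dist (f x) x' ≤ ε →
    (X x).HasCrossForm (X x') ρ α β (L * dist (f x) x') (fun h h' => f (Ψ x h) = Ψ x' h')

namespace SplitNorm

variable {V : Type*} [AddCommGroup V] [Module ℝ V] {X X' : SplitNorm V} {ρ α β κ r r' : ℝ}
  {G : V → V} {H : V → V → V}

theorem ns_le_of_lipschitz (hρ : 0 ≤ ρ)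
    (hG : ∀ h k, X.n h ≤ ρ → X.n k ≤ ρ →
      X'.ns (G h - G k) ≤ α * X.ns (h - k) + β * X.n (h - k))
    (h0 : X'.ns (G 0) ≤ κ) {h : V} (hh : X.n h ≤ ρ) :
    X'.ns (G h) ≤ α * X.ns h + β * X.n h + κ := by
  have h1 := hG h 0 hh (by rwa [map_zero])
  rw [sub_zero] at h1
  have h2 := map_add_le_add X'.ns (G h - G 0) (G 0)
  rw [sub_add_cancel] at h2
  linarith

theorem nu_le_of_lipschitz (hρ : 0 ≤ ρ)
    (hH : ∀ h' h k' k, X.n h ≤ ρ → X.n k ≤ ρ →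
      X.nu (H h' h - H k' k) ≤ α * X'.nu (h' - k') + β * X.n (h - k))
    (h0 : X.nu (H 0 0) ≤ κ) {h' h : V} (hh : X.n h ≤ ρ) :
    X.nu (H h' h) ≤ α * X'.nu h' + β * X.n h + κ := by
  have h1 := hH h' h 0 0 hh (by rwa [map_zero])
  rw [sub_zero, sub_zero] at h1
  have h2 := map_add_le_add X.nu (H h' h - H 0 0) (H 0 0)
  rw [sub_add_cancel] at h2
  linarith

end SplitNorm

namespace HyperbolicCharts

variable {V : Type*} [NormedAddCommGroup V] [NormedSpace ℝ V] [FiniteDimensional ℝ V] {M : Type*}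
    [MetricSpace M] {f : M → M} {Λ : Set M} (D : HyperbolicCharts V f Λ)

/-- The radii `R i` define the box in which the system is solved; `hs` and `hu` say that the stable
and unstable equations preserve it. Leaving the radii free permits the exponential estimates later.
-/
theorem exists_shadowing {n : ℕ} {x : ℕ → M} (hx : ∀ i ≤ n, x i ∈ Metric.thickening D.ε Λ)
    (hjump : ∀ i < n, dist (f (x i)) (x (i + 1)) ≤ D.ε) {R : ℕ → ℝ} (hR : ∀ i ≤ n, 0 ≤ R i)
    (hRρ : ∀ i ≤ n, 2 * R i ≤ D.ρ)
    (hs : ∀ i < n, (D.α + 2 * D.β) * R i + D.L * dist (f (x i)) (x (i + 1)) ≤ R (i + 1))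
    (hu : ∀ i < n, D.α * R (i + 1) + 2 * D.β * R i + D.L * dist (f (x i)) (x (i + 1)) ≤ R i) :
    ∃ y, ∀ i ≤ n, dist (x i) (f^[i] y) ≤ 2 * D.L * R i := by
  have hα := D.α_nonneg
  have hβ := D.β_nonneg
  have hn : ∀ i : Fin (n + 1), (i : ℕ) ≤ n := fun i => Nat.lt_succ_iff.1 i.2
  have hbox : ∀ i : Fin (n + 1), ∀ h, (D.X (x i)).nu h ≤ R i → (D.X (x i)).ns h ≤ R i →
      (D.X (x i)).n h ≤ 2 * R i := fun i h h1 h2 => by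
    rw [SplitNorm.n_apply]; linarith
  have hchoice : ∀ i : Fin (n + 1), ∃ (G : V → V) (H : V → V → V),
      (∀ h, (D.X (x (finRotate _ i : Fin (n + 1)))).proj (G h) = 0) ∧
      (∀ h' h, (D.X (x i)).proj (H h' h) = H h' h) ∧
      (∀ h k, (D.X (x i)).n h ≤ D.ρ → (D.X (x i)).n k ≤ D.ρ →
        (D.X (x (finRotate _ i : Fin (n + 1)))).ns (G h - G k) ≤
          D.α * (D.X (x i)).ns (h - k) + D.β * (D.X (x i)).n (h - k)) ∧
      (∀ h' h k' k, (D.X (x i)).n h ≤ D.ρ → (D.X (x i)).n k ≤ D.ρ →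
        (D.X (x i)).nu (H h' h - H k' k) ≤
          D.α * (D.X (x (finRotate _ i : Fin (n + 1)))).nu (h' - k') +
            D.β * (D.X (x i)).n (h - k)) ∧
      (∀ h, (D.X (x i)).nu h ≤ R i → (D.X (x i)).ns h ≤ R i →
        (D.X (x (finRotate _ i : Fin (n + 1)))).ns (G h) ≤ R (finRotate _ i : Fin (n + 1))) ∧
      (∀ h' h, (D.X (x i)).nu h ≤ R i → (D.X (x i)).ns h ≤ R i →
        (D.X (x (finRotate _ i : Fin (n + 1)))).nu h' ≤ R (finRotate _ i : Fin (n + 1)) →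
        (D.X (x i)).nu (H h' h) ≤ R i) ∧
      ((i : ℕ) < n → ∀ h h', (D.X (x i)).n h ≤ D.ρ → (D.X (x (i + 1))).n h' ≤ D.ρ →
        h' - (D.X (x (i + 1))).proj h' = G h → (D.X (x i)).proj h = H h' h →
        f (D.Ψ (x i) h) = D.Ψ (x (i + 1)) h') := by
    intro i
    rcases (hn i).lt_or_eq with hi | hi
    · have hrot : ((finRotate _ i : Fin (n + 1)) : ℕ) = i + 1 :=
        coe_finRotate_of_ne_last fun h => by rw [h, Fin.val_last] at hi; exact lt_irrefl _ hi
      rw [hrot]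
      obtain ⟨G, H, h1, h2, h3, h4, h5, h6, h7⟩ :=
        D.hasCrossForm (x i) (hx i (hn i)) (x (i + 1)) (hx _ hi) (hjump i hi)
      refine ⟨G, H, h2, h3, h4, h5, fun h a₁ a₂ => ?_, fun h' h a₁ a₂ a₃ => ?_, fun _ => h1⟩
      · have b₁ := hbox i h a₁ a₂
        refine (SplitNorm.ns_le_of_lipschitz D.ρ_pos.le h4 h6
          (b₁.trans (hRρ i (hn i)))).trans (le_trans ?_ (hs i hi))
        calc _ ≤ D.α * R i + D.β * (2 * R i) + D.L * dist (f (x i)) (x (i + 1)) := by gcongr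
          _ = _ := by ring
      · have b₁ := hbox i h a₁ a₂
        refine (SplitNorm.nu_le_of_lipschitz D.ρ_pos.le h5 h7
          (b₁.trans (hRρ i (hn i)))).trans (le_trans ?_ (hu i hi))
        calc _ ≤ D.α * R (i + 1) + D.β * (2 * R i) + D.L * dist (f (x i)) (x (i + 1)) := by gcongr
          _ = _ := by ring
    -- The closing link from `n` back to `0` imposes no dynamics: it prescribes zero stable part at
    -- the start and zero unstable part at the end.
    · refine ⟨fun _ => 0, fun _ _ => 0, fun _ => map_zero _, fun _ _ => map_zero _, ?_, ?_, ?_, ?_,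
        fun h => absurd hi h.ne⟩
      · intro h k _ _
        rw [sub_zero, map_zero]
        positivity
      · intro h' h k' k _ _
        rw [sub_zero, map_zero]
        positivity
      · intro h _ _
        rw [map_zero]
        exact hR _ (hn _)
      · intro h' h _ _ _
        rw [map_zero]
        exact hR _ (hn _)
  choose G H c₁ c₂ c₃ c₄ c₅ c₆ c₇ using hchoice
  obtain ⟨v, hv, hsol⟩ := SplitNorm.exists_cyclic_solution (finRotate (n + 1))
    (fun i => D.X (x i)) hα hβ D.rate_lt_one c₁ c₂ c₃ c₄ (R := fun i => R i)
    (fun i => hR i (hn i)) (fun i => hRρ i (hn i)) c₅ c₆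
  have hnv : ∀ i : Fin (n + 1), (D.X (x i)).n (v i) ≤ 2 * R i := fun i => hbox i _ (hv i).1 (hv i).2
  refine ⟨D.Ψ (x 0) (v 0), fun i hi => ?_⟩
  have horb : ∀ i (hi : i ≤ n), f^[i] (D.Ψ (x 0) (v 0)) =
      D.Ψ (x i) (v ⟨i, Nat.lt_succ_iff.2 hi⟩) := by
    intro i
    induction i with
    | zero => intro _; rfl
    | succ i ih =>
      intro hi
      rw [Function.iterate_succ_apply', ih (Nat.le_of_succ_le hi)]
      have hlt : i < n + 1 := by omega
      have hrot : finRotate (n + 1) ⟨i, hlt⟩ = ⟨i + 1, Nat.lt_succ_iff.2 hi⟩ :=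
        finRotate_of_lt (Nat.lt_of_succ_le hi)
      have e := hsol ⟨i, hlt⟩
      simp only [hrot] at e
      exact c₇ ⟨i, hlt⟩ hi _ _ ((hnv _).trans (hRρ _ (hn _))) ((hnv ⟨i + 1, _⟩).trans (hRρ _ hi))
        e.1 e.2
  rw [horb i hi]
  have h1 := hnv ⟨i, Nat.lt_succ_iff.2 hi⟩
  refine (D.dist_le _ (hx i hi) _ (h1.trans (hRρ i hi))).trans ?_
  have := D.one_le_L
  calc D.L * _ ≤ D.L * (2 * R i) := by gcongr
    _ = _ := by ring

/-- Here every link of the cycle is genuine and the radii are constant, equal to the fixed point of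
`R ↦ (α + 2 * β) * R + L * κ`. The pointwise bound comes from this box, the bound on the sum from
adding up the equations. -/
theorem exists_periodic_shadowing {n : ℕ} (hn1 : 1 ≤ n) {x : ℕ → M}
    (hx : ∀ i ≤ n, x i ∈ Metric.thickening D.ε Λ)
    (hjump : ∀ i < n, dist (f (x i)) (x (i + 1)) ≤ D.ε) (hper : x n = x 0) {κ : ℝ} (hκ : 0 ≤ κ)
    (hκjump : ∀ i < n, dist (f (x i)) (x (i + 1)) ≤ κ)
    (hκρ : 2 * (D.L * κ / (1 - (D.α + 2 * D.β))) ≤ D.ρ) :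
    ∃ p, f^[n] p = p ∧
      (∀ i < n, dist (x i) (f^[i] p) ≤ 2 * D.L ^ 2 / (1 - (D.α + 2 * D.β)) * κ) ∧
      ∑ i ∈ Finset.range n, dist (x i) (f^[i] p) ≤
        2 * D.L ^ 2 / (1 - (D.α + 2 * D.β)) *
          ∑ i ∈ Finset.range n, dist (f (x i)) (x (i + 1)) := by
  have hα := D.α_nonneg
  have hβ := D.β_nonneg
  have hL : 0 < D.L := one_pos.trans_le D.one_le_L
  have hθ : 0 < 1 - (D.α + 2 * D.β) := sub_pos.2 D.rate_lt_one
  obtain ⟨m, rfl⟩ : ∃ m, n = m + 1 := ⟨n - 1, by omega⟩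
  set R : ℝ := D.L * κ / (1 - (D.α + 2 * D.β)) with hRdef
  have hR : 0 ≤ R := by positivity
  have hReq : (D.α + 2 * D.β) * R + D.L * κ = R := by
    rw [hRdef]; field_simp; ring
  have hrot : ∀ i : Fin (m + 1), x (finRotate _ i : Fin (m + 1)) = x (i + 1) := by
    intro i
    by_cases hi : i = Fin.last m
    · subst hi
      rw [finRotate_last, Fin.val_last, hper]
      rfl
    · rw [coe_finRotate_of_ne_last hi]
  have hbox : ∀ i : Fin (m + 1), ∀ h, (D.X (x i)).nu h ≤ R → (D.X (x i)).ns h ≤ R →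
      (D.X (x i)).n h ≤ 2 * R := fun i h h1 h2 => by
    rw [SplitNorm.n_apply]; linarith
  have hcf : ∀ i : Fin (m + 1), _ := fun i => D.hasCrossForm (x i) (hx i i.2.le)
    (x (finRotate _ i : Fin (m + 1))) (hx _ (Fin.is_lt _).le) (by rw [hrot]; exact hjump i i.2)
  choose G H c₁ c₂ c₃ c₄ c₅ c₆ c₇ using hcf
  have hdκ : ∀ i : Fin (m + 1), D.L * dist (f (x i)) (x (finRotate _ i : Fin (m + 1))) ≤ D.L * κ :=
    fun i => by rw [hrot]; gcongr; exact hκjump i i.2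
  obtain ⟨v, hv, hsol⟩ := SplitNorm.exists_cyclic_solution (finRotate (m + 1))
    (fun i => D.X (x i)) hα hβ D.rate_lt_one c₂ c₃ c₄ c₅ (R := fun _ => R)
    (fun _ => hR) (fun _ => hκρ)
    (fun i h a₁ a₂ => by
      have b₁ := hbox i h a₁ a₂
      refine (SplitNorm.ns_le_of_lipschitz D.ρ_pos.le (c₄ i) (c₆ i)
        (b₁.trans hκρ)).trans (le_trans ?_ hReq.le)
      calc _ ≤ D.α * R + D.β * (2 * R) + D.L * κ := by exact add_le_add (by gcongr) (hdκ i)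
        _ = _ := by ring)
    (fun i h' h a₁ a₂ a₃ => by
      have b₁ := hbox i h a₁ a₂
      refine (SplitNorm.nu_le_of_lipschitz D.ρ_pos.le (c₅ i) (c₇ i)
        (b₁.trans hκρ)).trans (le_trans ?_ hReq.le)
      calc _ ≤ D.α * R + D.β * (2 * R) + D.L * κ := by exact add_le_add (by gcongr) (hdκ i)
        _ = _ := by ring)
  have hnv : ∀ i : Fin (m + 1), (D.X (x i)).n (v i) ≤ 2 * R := fun i => hbox i _ (hv i).1 (hv i).2
  have hnρ : ∀ i : Fin (m + 1), (D.X (x i)).n (v i) ≤ D.ρ := fun i => (hnv i).trans hκρ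
  have hstep : ∀ i : Fin (m + 1), f (D.Ψ (x i) (v i)) =
      D.Ψ (x (finRotate _ i : Fin (m + 1))) (v (finRotate _ i)) := fun i =>
    c₁ i _ _ (hnρ i) (hnρ _) (hsol i).1 (hsol i).2
  have horb : ∀ i (hi : i < m + 1), f^[i] (D.Ψ (x 0) (v 0)) = D.Ψ (x i) (v ⟨i, hi⟩) := by
    intro i
    induction i with
    | zero => intro _; rfl
    | succ i ih =>
      intro hi
      rw [Function.iterate_succ_apply', ih (Nat.lt_of_succ_lt hi)]
      have hr : finRotate (m + 1) ⟨i, Nat.lt_of_succ_lt hi⟩ = ⟨i + 1, hi⟩ :=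
        finRotate_of_lt (Nat.lt_of_succ_lt_succ hi)
      have e := hstep ⟨i, Nat.lt_of_succ_lt hi⟩
      rwa [hr] at e
  have hdist : ∀ i : Fin (m + 1), dist (x i) (f^[i] (D.Ψ (x 0) (v 0))) ≤
      D.L * (D.X (x i)).n (v i) := fun i => by
    rw [horb i i.2]
    exact D.dist_le _ (hx i i.2.le) _ (hnρ i)
  refine ⟨D.Ψ (x 0) (v 0), ?_, fun i hi => ?_, ?_⟩
  · rw [Function.iterate_succ_apply', horb m (Nat.lt_succ_self m)]
    have e := hstep (Fin.last m)
    rw [finRotate_last] at e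
    exact e
  · refine (hdist ⟨i, hi⟩).trans ?_
    calc D.L * _ ≤ D.L * (2 * R) := by gcongr; exact hnv ⟨i, hi⟩
      _ = _ := by rw [hRdef]; field_simp
  · set σ := finRotate (m + 1)
    have hs : ∀ i : Fin (m + 1), (D.X (x (σ i : Fin (m + 1)))).ns (v (σ i)) ≤
        D.α * (D.X (x i)).ns (v i) + D.β * (D.X (x i)).n (v i) +
          D.L * dist (f (x i)) (x (i + 1)) := fun i => by
      rw [← SplitNorm.ns_sub_proj, (hsol i).1, ← hrot i]
      exact SplitNorm.ns_le_of_lipschitz D.ρ_pos.le (c₄ i) (c₆ i) (hnρ i)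
    have hu : ∀ i : Fin (m + 1), (D.X (x i)).nu (v i) ≤
        D.α * (D.X (x (σ i : Fin (m + 1)))).nu (v (σ i)) + D.β * (D.X (x i)).n (v i) +
          D.L * dist (f (x i)) (x (i + 1)) := fun i => by
      rw [← SplitNorm.nu_proj, (hsol i).2, ← hrot i]
      exact SplitNorm.nu_le_of_lipschitz D.ρ_pos.le (c₅ i) (c₇ i) (hnρ i)
    have hs' := Finset.sum_le_sum fun (i : Fin (m + 1)) (_ : i ∈ Finset.univ) => hs i
    have hu' := Finset.sum_le_sum fun (i : Fin (m + 1)) (_ : i ∈ Finset.univ) => hu i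
    simp only [Finset.sum_add_distrib, ← Finset.mul_sum] at hs' hu'
    -- Around a cycle the shifted sums equal the unshifted ones, so the contracted terms can be
    -- absorbed on the left.
    rw [Equiv.sum_comp σ fun i => (D.X (x i)).ns (v i)] at hs'
    rw [Equiv.sum_comp σ fun i => (D.X (x i)).nu (v i)] at hu'
    have hN : ∑ i : Fin (m + 1), (D.X (x i)).n (v i) = ∑ i : Fin (m + 1), (D.X (x i)).nu (v i) +
        ∑ i : Fin (m + 1), (D.X (x i)).ns (v i) := by
      rw [← Finset.sum_add_distrib]
      rfl
    rw [Finset.sum_range, Finset.sum_range]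
    set J := ∑ i : Fin (m + 1), dist (f (x i)) (x (i + 1))
    have hN' : (1 - (D.α + 2 * D.β)) * ∑ i : Fin (m + 1), (D.X (x i)).n (v i) ≤ 2 * (D.L * J) := by
      rw [hN] at hs' hu' ⊢
      linarith
    calc _ ≤ ∑ i : Fin (m + 1), D.L * (D.X (x i)).n (v i) := Finset.sum_le_sum fun i _ => hdist i
      _ = D.L * ∑ i : Fin (m + 1), (D.X (x i)).n (v i) := by rw [Finset.mul_sum]
      _ ≤ D.L * (2 * (D.L * J) / (1 - (D.α + 2 * D.β))) := by
        gcongr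
        rwa [le_div_iff₀' hθ]
      _ = _ := by field_simp

end HyperbolicCharts

/-! ### Exponentially weighted sums -/

theorem sum_Icc_one_eq_sum_range (g : ℕ → ℝ) (n : ℕ) :
    ∑ k ∈ Finset.Icc 1 n, g k = ∑ k ∈ Finset.range n, g (k + 1) := by
  rw [Finset.range_eq_Ico, Finset.sum_Ico_add' g 0 n 1]
  rfl

/-- The sum is split at `i` into two pieces, each bounded by the geometric series of ratio
`e^{-lam}`. -/
theorem sum_range_exp_neg_abs_le {lam : ℝ} (hlam : 0 < lam) (i : ℕ) (N : ℕ) :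
    ∑ k ∈ Finset.range N, Real.exp (-lam * |(k : ℝ) - i|) ≤ 2 / (1 - Real.exp (-lam)) := by
  set q := Real.exp (-lam) with hq
  have hq0 : 0 < q := Real.exp_pos _
  have hq1 : q < 1 := by rw [hq, Real.exp_lt_one_iff]; linarith
  have hpow : ∀ j : ℕ, Real.exp (-lam * j) = q ^ j := fun j => by
    rw [hq, ← Real.exp_nat_mul, mul_comm]
  have hgeom : ∀ m : ℕ, ∑ j ∈ Finset.range m, q ^ j ≤ 1 / (1 - q) := fun m => by
    rw [one_div, ← tsum_geometric_of_lt_one hq0.le hq1]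
    exact (summable_geometric_of_lt_one hq0.le hq1).sum_le_tsum _ fun j _ => by positivity
  calc _ ≤ ∑ k ∈ Finset.range (i + N), Real.exp (-lam * |(k : ℝ) - i|) :=
        Finset.sum_le_sum_of_subset_of_nonneg (Finset.range_mono (by omega))
          fun _ _ _ => (Real.exp_pos _).le
    _ = ∑ k ∈ Finset.range i, Real.exp (-lam * |(k : ℝ) - i|) +
        ∑ j ∈ Finset.range N, Real.exp (-lam * |((i + j : ℕ) : ℝ) - i|) :=
        Finset.sum_range_add _ _ _
    -- The exact exponent on the left piece is `i - k`; lowering it by one allows the sum to be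
    -- reflected into `∑ q ^ k`.
    _ ≤ ∑ k ∈ Finset.range i, q ^ (i - 1 - k) + ∑ j ∈ Finset.range N, q ^ j := by
        gcongr with k hk j hj
        · rw [Finset.mem_range] at hk
          rw [← hpow]
          have h1 : ((i - 1 - k : ℕ) : ℝ) = i - 1 - k := by
            rw [Nat.cast_sub (by omega), Nat.cast_sub (by omega), Nat.cast_one]
          have h2 : |(k : ℝ) - i| = i - k := by
            rw [abs_sub_comm, abs_of_pos (sub_pos.2 (by exact_mod_cast hk))]
          rw [h1, h2, Real.exp_le_exp]
          nlinarith
        · rw [← hpow]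
          push_cast
          rw [add_sub_cancel_left, abs_of_nonneg (Nat.cast_nonneg j)]
    _ = ∑ k ∈ Finset.range i, q ^ k + ∑ j ∈ Finset.range N, q ^ j := by
        rw [Finset.sum_range_reflect (fun j => q ^ j) i]
    _ ≤ 1 / (1 - q) + 1 / (1 - q) := add_le_add (hgeom _) (hgeom _)
    _ = _ := by ring

theorem sum_Icc_one_exp_neg_abs_le {lam : ℝ} (hlam : 0 < lam) (i : ℕ) (n : ℕ) :
    ∑ k ∈ Finset.Icc 1 n, Real.exp (-lam * |(k : ℝ) - i|) ≤ 2 / (1 - Real.exp (-lam)) :=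
  (Finset.sum_le_sum_of_subset_of_nonneg
    (fun k hk => by rw [Finset.mem_Icc] at hk; rw [Finset.mem_range]; omega)
    fun _ _ _ => (Real.exp_pos _).le).trans (sum_range_exp_neg_abs_le hlam i (n + 1))

theorem sum_Icc_zero_exp_neg_abs_le {lam : ℝ} (hlam : 0 < lam) (k : ℕ) (n : ℕ) :
    ∑ i ∈ Finset.Icc 0 n, Real.exp (-lam * |(k : ℝ) - (i : ℕ)|) ≤ 2 / (1 - Real.exp (-lam)) := by
  simp only [abs_sub_comm (k : ℝ)]
  exact (Finset.sum_le_sum_of_subset_of_nonneg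
    (fun i hi => by rw [Finset.mem_Icc] at hi; rw [Finset.mem_range]; omega)
    fun _ _ _ => (Real.exp_pos _).le).trans (sum_range_exp_neg_abs_le hlam k (n + 1))

theorem le_iSup_fin {n : ℕ} (g : ℕ → ℝ) {i : ℕ} (hi : i < n) : g i ≤ ⨆ k : Fin n, g k :=
  le_ciSup (f := fun k : Fin n => g k) (Finite.bddAbove_range _) ⟨i, hi⟩

/-! ### Shadowing and periodic shadowing with uniform constants -/

namespace HyperbolicCharts

variable {V : Type*} [NormedAddCommGroup V] [NormedSpace ℝ V] [FiniteDimensional ℝ V] {M : Type*}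
    [MetricSpace M] {f : M → M} {Λ : Set M}

/-- The radii are `K₁ * s i`, where `s i` is the sum of the jumps weighted by `e^{-lam |k - i|}`;
neighbouring radii differ at most by the factor `E = e^lam`. The weighted estimate is then
immediate, and the other two follow from the geometric series. Every smaller `ε` and larger `K` is
allowed, so that constants from different arguments can be merged. -/
theorem exists_isShadowingConstants (D : HyperbolicCharts V f Λ) : ∃ lam > 0, ∃ ε₀ > 0, ∃ K₀, ∀ ε, 0 < ε → ε ≤ ε₀ →
    ∀ K, K₀ ≤ K → IsShadowingConstants f Λ ε K lam := by
  have hα := D.α_nonneg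
  have hβ := D.β_nonneg
  have hL1 := D.one_le_L
  have hL : 0 < D.L := one_pos.trans_le hL1
  set θ := D.α + 2 * D.β with hθdef
  have hθ0 : 0 ≤ θ := by positivity
  have hθ1 : θ < 1 := D.rate_lt_one
  have hθ : 0 < 1 - θ := by linarith
  -- Chosen so that `E > 1` while `θ * E < 1`: the loss from comparing neighbouring radii does not
  -- destroy the contraction.
  set E : ℝ := 2 / (1 + θ) with hE
  have hE1 : 1 < E := by rw [hE, lt_div_iff₀ (by linarith)]; linarith
  set lam := Real.log E with hlamdef
  have hlam : 0 < lam := Real.log_pos hE1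
  have hexp : Real.exp lam = E := Real.exp_log (by linarith)
  set c := 2 / (1 - Real.exp (-lam)) with hc
  have hq1 : Real.exp (-lam) < 1 := by rw [Real.exp_lt_one_iff]; linarith
  have hq0 := Real.exp_pos (-lam)
  have hc1 : 1 ≤ c := by rw [hc, le_div_iff₀ (by linarith)]; linarith
  -- This is the value for which `hkey₂` is an equality.
  set K₁ := 2 * D.L / (1 - θ) with hK₁
  have hK₁0 : 0 < K₁ := by positivity
  have hkey₁ : θ * E * K₁ + D.L ≤ K₁ := by
    rw [hE, hK₁, ← sub_nonneg]
    have : 2 * D.L / (1 - θ) - (θ * (2 / (1 + θ)) * (2 * D.L / (1 - θ)) + D.L) =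
        D.L * (1 - θ) ^ 2 / ((1 - θ) * (1 + θ)) := by
      field_simp
      ring
    rw [this]
    positivity
  have hkey₂ : θ * E * K₁ + D.L * E ≤ K₁ := by
    rw [hE, hK₁]
    apply le_of_eq
    field_simp
    ring
  refine ⟨lam, hlam, min D.ε (D.ρ / (2 * K₁ * c)),
    lt_min D.ε_pos (div_pos D.ρ_pos (by positivity)), max 1 (2 * D.L * K₁ * c), ?_⟩
  intro ε hε hεle K hK
  have hK1 : 1 ≤ K := (le_max_left _ _).trans hK
  have hKc : 2 * D.L * K₁ * c ≤ K := (le_max_right _ _).trans hK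
  refine ⟨hε, hK1, hlam, fun n hn x hx => ?_⟩
  set g : ℕ → ℝ := fun k => dist (f (x k)) (x (k + 1)) with hg
  set s : ℕ → ℝ := fun i => ∑ k ∈ Finset.Icc 1 n, dist (f (x (k - 1))) (x k) *
    Real.exp (-lam * |(k : ℝ) - i|) with hs
  have hs0 : ∀ i, 0 ≤ s i := fun i => Finset.sum_nonneg fun k _ => by positivity
  have hterm : ∀ i k : ℕ, 1 ≤ k → k ≤ n →
      dist (f (x (k - 1))) (x k) * Real.exp (-lam * |(k : ℝ) - i|) ≤ s i := fun i k h1 h2 =>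
    Finset.single_le_sum (f := fun k : ℕ => dist (f (x (k - 1))) (x k) *
      Real.exp (-lam * |(k : ℝ) - i|)) (fun k _ => by positivity) (Finset.mem_Icc.2 ⟨h1, h2⟩)
  have hcomp : ∀ i j : ℕ, |(i : ℝ) - j| ≤ 1 → s i ≤ E * s j := by
    intro i j hij
    rw [hs]
    simp only [Finset.mul_sum]
    refine Finset.sum_le_sum fun k _ => ?_
    have h1 : Real.exp (-lam * |(k : ℝ) - i|) ≤ E * Real.exp (-lam * |(k : ℝ) - j|) := by
      rw [← hexp, ← Real.exp_add, Real.exp_le_exp]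
      have := abs_sub_le (k : ℝ) i j
      nlinarith
    calc _ ≤ dist (f (x (k - 1))) (x k) * (E * Real.exp (-lam * |(k : ℝ) - j|)) := by gcongr
      _ = _ := by ring
  have hsup : ∀ i, s i ≤ c * ⨆ k : Fin n, g k := by
    intro i
    have hnn : 0 ≤ ⨆ k : Fin n, g k := Real.iSup_nonneg fun k => dist_nonneg
    calc s i ≤ ∑ k ∈ Finset.Icc 1 n, (⨆ k : Fin n, g k) * Real.exp (-lam * |(k : ℝ) - i|) := by
          refine Finset.sum_le_sum fun k hk => ?_
          rw [Finset.mem_Icc] at hk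
          have h1 := le_iSup_fin g (show k - 1 < n by omega)
          rw [hg] at h1
          simp only [Nat.sub_add_cancel hk.1] at h1
          gcongr
      _ = (∑ k ∈ Finset.Icc 1 n, Real.exp (-lam * |(k : ℝ) - i|)) * ⨆ k : Fin n, g k := by
          rw [← Finset.mul_sum, mul_comm]
      _ ≤ _ := by gcongr; exact sum_Icc_one_exp_neg_abs_le hlam i n
  have hsupε : (⨆ k : Fin n, g k) ≤ ε := Real.iSup_le (fun k => hx.2 k k.2) hε.le
  have hgs : ∀ i < n, g i ≤ s (i + 1) ∧ g i ≤ E * s i := by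
    intro i hi
    have h1 := hterm (i + 1) (i + 1) (by omega) hi
    simp only [sub_self, abs_zero, mul_zero, Real.exp_zero, mul_one, Nat.add_sub_cancel] at h1
    exact ⟨h1, h1.trans (hcomp (i + 1) i (by push_cast; simp))⟩
  obtain ⟨y, hy⟩ := D.exists_shadowing (n := n) (x := x)
    (fun i hi => Metric.thickening_mono (hεle.trans (min_le_left _ _)) _ (hx.1 i hi))
    (fun i hi => (hx.2 i hi).trans (hεle.trans (min_le_left _ _)))
    (R := fun i => K₁ * s i) (fun i _ => mul_nonneg hK₁0.le (hs0 i))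
    (fun i _ => by
      have h1 : ε ≤ D.ρ / (2 * K₁ * c) := hεle.trans (min_le_right _ _)
      rw [le_div_iff₀ (by positivity)] at h1
      have h2 : s i ≤ c * ε := (hsup i).trans (by gcongr)
      calc 2 * (K₁ * s i) ≤ 2 * (K₁ * (c * ε)) := by gcongr
        _ = ε * (2 * K₁ * c) := by ring
        _ ≤ _ := h1)
    (fun i hi => by
      have h1 := hcomp i (i + 1) (by push_cast; simp)
      have h2 := (hgs i hi).1
      calc _ ≤ θ * (K₁ * (E * s (i + 1))) + D.L * s (i + 1) := by gcongr
        _ = (θ * E * K₁ + D.L) * s (i + 1) := by ring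
        _ ≤ _ := by gcongr)
    (fun i hi => by
      have h1 := hcomp (i + 1) i (by push_cast; simp)
      have h2 := (hgs i hi).2
      have h3 : s i ≤ E * s i := le_mul_of_one_le_left (hs0 i) hE1.le
      calc _ ≤ D.α * (K₁ * (E * s i)) + 2 * D.β * (K₁ * (E * s i)) + D.L * (E * s i) := by gcongr
        _ = (θ * E * K₁ + D.L * E) * s i := by rw [hθdef]; ring
        _ ≤ _ := by gcongr)
  have hy' : ∀ i ≤ n, dist (x i) (f^[i] y) ≤ 2 * D.L * K₁ * s i := fun i hi =>
    (hy i hi).trans_eq (by ring)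
  have hKle : 2 * D.L * K₁ ≤ K := (le_mul_of_one_le_right (by positivity) hc1).trans hKc
  refine ⟨y, fun i hi => ?_, fun i hi => ?_, ?_⟩
  · have hnn : 0 ≤ ⨆ k : Fin n, g k := Real.iSup_nonneg fun k => dist_nonneg
    calc _ ≤ 2 * D.L * K₁ * (c * ⨆ k : Fin n, g k) := (hy' i hi).trans (by gcongr; exact hsup i)
      _ = 2 * D.L * K₁ * c * ⨆ k : Fin n, g k := by ring
      _ ≤ _ := by gcongr
  · exact (hy' i hi).trans (by gcongr)
  · have h1 : ∑ i ∈ Finset.Icc 0 n, s i ≤ c * ∑ k ∈ Finset.Icc 1 n, dist (f (x (k - 1))) (x k) := by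
      rw [hs, Finset.sum_comm, Finset.mul_sum]
      refine Finset.sum_le_sum fun k _ => ?_
      rw [← Finset.mul_sum, mul_comm]
      gcongr
      exact sum_Icc_zero_exp_neg_abs_le hlam k n
    have hnn : 0 ≤ ∑ k ∈ Finset.Icc 1 n, dist (f (x (k - 1))) (x k) :=
      Finset.sum_nonneg fun _ _ => dist_nonneg
    calc _ ≤ ∑ i ∈ Finset.Icc 0 n, 2 * D.L * K₁ * s i :=
          Finset.sum_le_sum fun i hi => hy' i (Finset.mem_Icc.1 hi).2
      _ ≤ 2 * D.L * K₁ * (c * ∑ k ∈ Finset.Icc 1 n, dist (f (x (k - 1))) (x k)) := by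
          rw [← Finset.mul_sum]; gcongr
      _ = 2 * D.L * K₁ * c * ∑ k ∈ Finset.Icc 1 n, dist (f (x (k - 1))) (x k) := by ring
      _ ≤ _ := by gcongr

/-- The whole shadowing orbit stays in the isolating neighbourhood; being periodic, it also supplies
backward orbits there, so local maximality applies. -/
theorem exists_isPeriodicShadowing (D : HyperbolicCharts V f Λ) (hΛ : IsCompact Λ) (hmax : IsLocallyMaximal f Λ) :
    ∃ ε₀ > 0, ∃ K₀, ∀ ε, 0 < ε → ε ≤ ε₀ → ∀ K, K₀ ≤ K → IsPeriodicShadowing f Λ ε K := by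
  obtain ⟨U, hU, hΛU, -, hUΛ⟩ := hmax
  obtain ⟨r, hr, hrU⟩ := hΛ.exists_thickening_subset_open hU hΛU
  have hL : 0 < D.L := one_pos.trans_le D.one_le_L
  have hθ : 0 < 1 - (D.α + 2 * D.β) := sub_pos.2 D.rate_lt_one
  set θ := D.α + 2 * D.β
  set K₀ := 2 * D.L ^ 2 / (1 - θ) with hK₀
  have hK₀0 : 0 < K₀ := by positivity
  -- The second bound keeps the box inside the charts. The third holds because the orbit is within
  -- `K₀ * ε` of the pseudo orbit, itself within `ε` of `Λ`.
  refine ⟨min D.ε (min (D.ρ * (1 - θ) / (2 * D.L)) (r / (1 + K₀))), lt_min D.ε_pos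
    (lt_min (div_pos (mul_pos D.ρ_pos hθ) (by positivity)) (by positivity)), K₀, ?_⟩
  intro ε hε hεle K hK n hn x hx hper
  have hε1 : ε ≤ D.ε := hεle.trans (min_le_left _ _)
  have hε2 : ε ≤ D.ρ * (1 - θ) / (2 * D.L) :=
    (hεle.trans (min_le_right _ _)).trans (min_le_left _ _)
  have hε3 : ε ≤ r / (1 + K₀) := (hεle.trans (min_le_right _ _)).trans (min_le_right _ _)
  rw [le_div_iff₀ (by positivity)] at hε2 hε3
  set g : ℕ → ℝ := fun k => dist (f (x k)) (x (k + 1)) with hg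
  have hnn : 0 ≤ ⨆ k : Fin n, g k := Real.iSup_nonneg fun k => dist_nonneg
  have hsupε : (⨆ k : Fin n, g k) ≤ ε := Real.iSup_le (fun k => hx.2 k k.2) hε.le
  obtain ⟨p, hp, hpd, hps⟩ := D.exists_periodic_shadowing hn (x := x)
    (fun i hi => Metric.thickening_mono hε1 _ (hx.1 i hi)) (fun i hi => (hx.2 i hi).trans hε1)
    hper hnn (fun i hi => le_iSup_fin g hi) (by
      rw [mul_div_assoc', div_le_iff₀ hθ]
      calc 2 * (D.L * ⨆ k : Fin n, g k) ≤ 2 * (D.L * ε) := by gcongr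
        _ = ε * (2 * D.L) := by ring
        _ ≤ _ := hε2)
  have hpU : ∀ i, f^[i] p ∈ U := by
    intro i
    have h1 : f^[i % n] p = f^[i] p := Function.IsPeriodicPt.iterate_mod_apply hp i
    rw [← h1]
    have hlt : i % n < n := Nat.mod_lt _ hn
    apply hrU
    obtain ⟨z, hz, hxz⟩ := Metric.mem_thickening_iff.1 (hx.1 _ hlt.le)
    refine Metric.mem_thickening_iff.2 ⟨z, hz, ?_⟩
    have h2 : dist (x (i % n)) (f^[i % n] p) ≤ K₀ * ε := (hpd _ hlt).trans (by gcongr)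
    have h3 := dist_triangle_left (f^[i % n] p) z (x (i % n))
    nlinarith
  refine ⟨p, ?_, hp, ?_, fun i hi => ?_⟩
  · rw [← hUΛ]
    refine ⟨mem_iInter.2 fun m => ?_, mem_iInter.2 fun m => subset_closure (hpU m)⟩
    -- A preimage of `p` under `f^[m]` is found further along the orbit, as `n * m` is a multiple of
    -- the period.
    refine ⟨f^[n * m - m] p, subset_closure (hpU _), ?_⟩
    rw [← Function.iterate_add_apply, Nat.add_sub_cancel' (Nat.le_mul_of_pos_left m hn)]
    exact (Function.IsPeriodicPt.mul_const hp m)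
  · have e1 : ∑ i ∈ Finset.Icc 1 n, dist (x i) (f^[i] p) =
        ∑ i ∈ Finset.range n, dist (x i) (f^[i] p) := by
      rw [sum_Icc_one_eq_sum_range (fun i => dist (x i) (f^[i] p))]
      -- By periodicity the terms of index `0` and `n` coincide.
      have h1 := Finset.sum_range_succ (fun i => dist (x i) (f^[i] p)) n
      rw [Finset.sum_range_succ', hp, hper] at h1
      exact add_right_cancel h1
    rw [e1, sum_Icc_one_eq_sum_range (fun k => dist (f (x (k - 1))) (x k))]
    exact hps.trans (mul_le_mul_of_nonneg_right hK (Finset.sum_nonneg fun k _ => dist_nonneg))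
  · exact (hpd i hi).trans (by gcongr)

end HyperbolicCharts

/-! ### Ergodic minimizing value -/

section ErgodicMinimizingValue

variable {M : Type*} {f : M → M} {Λ : Set M} {φ : M → ℝ}

theorem birkhoffSum_mul_of_isPeriodicPt {p : M} {n : ℕ} (hp : f^[n] p = p) (k : ℕ) :
    birkhoffSum f φ (k * n) p = k * birkhoffSum f φ n p := by
  induction k with
  | zero => simp
  | succ k ih =>
    have h1 : f^[k * n] p = p := Function.IsPeriodicPt.const_mul hp k
    rw [add_mul, one_mul, birkhoffSum_add, ih, h1]
    push_cast
    ring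

/-- The ergodic minimizing value of a bounded function exists, and bounds its averages over
periodic orbits from below. -/
theorem exists_tendsto_ergodicMinimizing (hne : Λ.Nonempty) (hmaps : MapsTo f Λ Λ) {B : ℝ}
    (hB : ∀ x ∈ Λ, |φ x| ≤ B) :
    ∃ m : ℝ, Tendsto (fun n : ℕ => (1 / (n : ℝ)) * ⨅ x : Λ, birkhoffSum f φ n (x : M)) atTop (𝓝 m) ∧
      (∀ p ∈ Λ, ∀ n : ℕ, f^[n] p = p → n * m ≤ birkhoffSum f φ n p) ∧
      ∀ t, (∀ x ∈ Λ, φ x ≤ t) → m ≤ t := by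
  have := hne.to_subtype
  have habs : ∀ n, ∀ x ∈ Λ, |birkhoffSum f φ n x| ≤ n * B := by
    intro n x hx
    rw [birkhoffSum]
    refine (Finset.abs_sum_le_sum_abs _ _).trans ?_
    calc _ ≤ ∑ _k ∈ Finset.range n, B := Finset.sum_le_sum fun k _ => hB _ (hmaps.iterate k hx)
      _ = _ := by simp
  have hbdd : ∀ n, BddBelow (range fun x : Λ => birkhoffSum f φ n (x : M)) := fun n =>
    ⟨-(n * B), by rintro _ ⟨x, rfl⟩; exact (abs_le.1 (habs n x x.2)).1⟩
  set a : ℕ → ℝ := fun n => ⨅ x : Λ, birkhoffSum f φ n (x : M) with ha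
  have hle : ∀ n, ∀ x ∈ Λ, a n ≤ birkhoffSum f φ n x := fun n x hx => ciInf_le (hbdd n) ⟨x, hx⟩
  -- Infima of Birkhoff sums are superadditive, so Fekete's lemma gives the limit.
  have hsub : Subadditive fun n => -a n := by
    intro m n
    have h1 : a m + a n ≤ a (m + n) := le_ciInf fun x => by
      rw [birkhoffSum_add]
      exact add_le_add (hle m x x.2) (hle n _ (hmaps.iterate m x.2))
    simp only
    linarith
  obtain ⟨x₀, hx₀⟩ := hne
  have hB0 : 0 ≤ B := (abs_nonneg _).trans (hB x₀ hx₀)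
  have hlim := hsub.tendsto_lim ⟨-B, by
    rintro _ ⟨n, rfl⟩
    rcases Nat.eq_zero_or_pos n with rfl | hn
    · simp [hB0]
    · have hn' : (0 : ℝ) < n := by exact_mod_cast hn
      simp only
      rw [le_div_iff₀ hn']
      have h1 := hle n x₀ hx₀
      have h2 := (abs_le.1 (habs n x₀ hx₀)).2
      linarith⟩
  have hlim' : Tendsto (fun n : ℕ => (1 / (n : ℝ)) * a n) atTop (𝓝 (-hsub.lim)) := by
    refine hlim.neg.congr fun n => ?_
    ring
  refine ⟨-hsub.lim, hlim', fun p hp n hper => ?_, fun t ht => ?_⟩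
  · rcases Nat.eq_zero_or_pos n with rfl | hn
    · simp
    · have hn' : (0 : ℝ) < n := by exact_mod_cast hn
      rw [← le_div_iff₀' hn']
      -- Along multiples of the period, the infimum is at most `k` times the sum over one period.
      have h1 : Tendsto (fun k : ℕ => k * n) atTop atTop := tendsto_id.atTop_mul_const' hn
      refine le_of_tendsto (hlim'.comp h1) ?_
      filter_upwards [eventually_gt_atTop 0] with k hk
      have hk' : (0 : ℝ) < k := by exact_mod_cast hk
      have h2 := hle (k * n) p hp
      rw [birkhoffSum_mul_of_isPeriodicPt hper] at h2
      simp only [Function.comp_apply]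
      rw [one_div, inv_mul_eq_div, div_le_iff₀ (by positivity)]
      push_cast
      calc _ ≤ _ := h2
        _ = _ := by field_simp
  · refine le_of_tendsto hlim' ?_
    filter_upwards [eventually_gt_atTop 0] with n hn
    have hn' : (0 : ℝ) < n := by exact_mod_cast hn
    rw [one_div, inv_mul_eq_div, div_le_iff₀' hn']
    refine (hle n x₀ hx₀).trans ?_
    rw [birkhoffSum]
    calc _ ≤ ∑ _k ∈ Finset.range n, t := Finset.sum_le_sum fun k _ => ht _ (hmaps.iterate k hx₀)
      _ = _ := by simp

end ErgodicMinimizingValue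

/-! ### Action of chains with jumps -/

section Chains

variable {M : Type*} [MetricSpace M]

/-- The action of the chain `(x_0, …, x_n)`, for the cost `ψ` and the price `C` of the jumps. -/
def chainAction (f : M → M) (ψ : M → ℝ) (C : ℝ) (x : ℕ → M) (n : ℕ) : ℝ :=
  ∑ i ∈ Finset.range n, (ψ (x i) + C * dist (f (x i)) (x (i + 1)))

variable {f : M → M} {ψ : M → ℝ} {C : ℝ} {Ω : Set M}

theorem chainAction_add (x : ℕ → M) (m n : ℕ) : chainAction f ψ C x (m + n) =
    chainAction f ψ C x m + chainAction f ψ C (fun i => x (m + i)) n :=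
  Finset.sum_range_add _ _ _

theorem chainAction_succ (x : ℕ → M) (n : ℕ) : chainAction f ψ C x (n + 1) =
    chainAction f ψ C x n + (ψ (x n) + C * dist (f (x n)) (x (n + 1))) :=
  Finset.sum_range_succ _ _

theorem chainAction_mono {C' : ℝ} (h : C ≤ C') (x : ℕ → M) (n : ℕ) :
    chainAction f ψ C x n ≤ chainAction f ψ C' x n :=
  Finset.sum_le_sum fun _ _ => by gcongr

/-- If closed chains with jumps at most `ε` have nonnegative action, then almost closed chains have
an action which is bounded from below. -/
theorem neg_le_chainAction_of_dist_le {ε : ℝ} (hε : 0 ≤ ε) (hC : 0 ≤ C)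
    (hclosed : ∀ n : ℕ, 1 ≤ n → ∀ x : ℕ → M, (∀ i ≤ n, x i ∈ Ω) →
      (∀ i < n, dist (f (x i)) (x (i + 1)) ≤ ε) → x n = x 0 → 0 ≤ chainAction f ψ C x n)
    {n : ℕ} {x : ℕ → M} (hx : ∀ i ≤ n, x i ∈ Ω)
    (hjump : ∀ i < n, dist (f (x i)) (x (i + 1)) ≤ ε / 2) (hd : dist (x n) (x 0) ≤ ε / 2) :
    -(C * (ε / 2)) ≤ chainAction f ψ C x n := by
  rcases n with _ | n
  · simp only [chainAction, Finset.range_zero, Finset.sum_empty, Left.neg_nonpos_iff]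
    positivity
  -- Replacing the last point by `x 0` closes the chain; the last jump grows by at most `ε / 2` and
  -- remains admissible.
  · let x' : ℕ → M := fun i => if i = n + 1 then x 0 else x i
    have hx' : ∀ i < n + 1, x' i = x i := fun i hi => if_neg hi.ne
    have hx'n : x' (n + 1) = x 0 := if_pos rfl
    have hlast : dist (f (x n)) (x 0) ≤ dist (f (x n)) (x (n + 1)) + ε / 2 :=
      (dist_triangle _ _ _).trans (by gcongr)
    have h0 := hclosed (n + 1) (by omega) x'
      (fun i hi => by
        rcases hi.lt_or_eq with h | h
        · rw [hx' i h]; exact hx i hi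
        · rw [h, hx'n]; exact hx 0 (by omega))
      (fun i hi => by
        rw [hx' i hi]
        rcases (Nat.succ_le_of_lt hi).lt_or_eq with h | h
        · rw [hx' _ h]
          have := hjump i hi
          linarith
        · obtain rfl : i = n := Nat.succ_injective h
          rw [hx'n]
          linarith [hjump i hi])
      (by rw [hx'n, hx' 0 (by omega)])
    rw [chainAction_succ, hx' n (by omega), hx'n] at h0
    have h1 : chainAction f ψ C x' n = chainAction f ψ C x n :=
      Finset.sum_congr rfl fun i hi => by
        rw [Finset.mem_range] at hi
        rw [hx' i (by omega), hx' (i + 1) (by omega)]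
    rw [h1] at h0
    rw [chainAction_succ]
    nlinarith

/-- Chains with small jumps in a totally bounded set have an action which is bounded from below. -/
theorem neg_le_chainAction_of_cells {ι : Type*} [DecidableEq ι] (cell : M → ι) {r D : ℝ} (hD : 0 ≤ D)
    (hr : 0 ≤ r) (hψ : ∀ x ∈ Ω, -D ≤ ψ x) (hC : 0 ≤ C)
    (hclosed : ∀ n : ℕ, ∀ x : ℕ → M, (∀ i ≤ n, x i ∈ Ω) →
      (∀ i < n, dist (f (x i)) (x (i + 1)) ≤ r) → cell (x n) = cell (x 0) →
      -(C * r) ≤ chainAction f ψ C x n) (T : Finset ι) :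
    ∀ n : ℕ, ∀ x : ℕ → M, (∀ i ≤ n, x i ∈ Ω ∧ cell (x i) ∈ T) →
      (∀ i < n, dist (f (x i)) (x (i + 1)) ≤ r) →
      -(T.card * (C * r + D)) ≤ chainAction f ψ C x n := by
  induction hT : T.card generalizing T with
  | zero =>
    intro n x hx _
    have := (hx 0 (Nat.zero_le _)).2
    rw [Finset.card_eq_zero.1 hT] at this
    simp at this
  | succ t ih =>
    intro n x hx hjump
    have hCr : 0 ≤ C * r := by positivity
    set P : ℕ → Prop := fun j => cell (x j) = cell (x 0)
    -- Cut at the last visit `j` to the cell of `x 0`. The piece before is almost closed and costs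
    -- at least `-(C * r)`, the step leaving `x j` at least `-D`, and the rest avoids this cell, so
    -- one cell fewer remains.
    obtain ⟨j, hjn, hPj, hmax⟩ : ∃ j, j ≤ n ∧ P j ∧ ∀ k, j < k → k ≤ n → ¬P k := by
      classical
      exact ⟨Nat.findGreatest P n, Nat.findGreatest_le n,
        Nat.findGreatest_spec (P := P) (Nat.zero_le n) rfl,
        fun k h1 h2 => Nat.findGreatest_is_greatest h1 h2⟩
    have h1 := hclosed j x (fun i hi => (hx i (hi.trans hjn)).1)
      (fun i hi => hjump i (hi.trans_le hjn)) hPj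
    have ht0 : (0 : ℝ) ≤ t := Nat.cast_nonneg t
    rcases hjn.lt_or_eq with hlt | heq
    · obtain ⟨m, rfl⟩ : ∃ m, n = j + 1 + m := ⟨n - (j + 1), by omega⟩
      rw [chainAction_add, chainAction_succ]
      have h2 := hψ (x j) (hx j hjn).1
      have h3 : 0 ≤ C * dist (f (x j)) (x (j + 1)) := by positivity
      have h4 := ih (T.erase (cell (x 0)))
        (by rw [Finset.card_erase_of_mem (hx 0 (Nat.zero_le _)).2, hT]; rfl) m
        (fun i => x (j + 1 + i))
        (fun i hi => ⟨(hx _ (by omega)).1, Finset.mem_erase.2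
          ⟨hmax _ (show j < j + 1 + i by omega) (by omega),
            (hx _ (by omega)).2⟩⟩)
        (fun i hi => hjump (j + 1 + i) (by omega))
      push_cast
      linarith
    · rw [← heq]
      push_cast
      nlinarith

/-- If the jumps are expensive enough, then all chains have an action which is bounded from
below. -/
theorem neg_le_chainAction {C₁ r D B : ℝ} (hC₁ : C₁ ≤ C) (hC0 : 0 ≤ C)
    (hψ : ∀ x ∈ Ω, -D ≤ ψ x)
    (hsmall : ∀ n : ℕ, ∀ x : ℕ → M, (∀ i ≤ n, x i ∈ Ω) →
      (∀ i < n, dist (f (x i)) (x (i + 1)) ≤ r) → -B ≤ chainAction f ψ C₁ x n)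
    (hC : B + D ≤ C * r) (n : ℕ) : ∀ x : ℕ → M, (∀ i ≤ n, x i ∈ Ω) → -B ≤ chainAction f ψ C x n := by
  induction n using Nat.strong_induction_on with
  | _ n ih =>
    intro x hx
    by_cases hs : ∀ i < n, dist (f (x i)) (x (i + 1)) ≤ r
    · exact (hsmall n x hx hs).trans (chainAction_mono hC₁ x n)
    · push Not at hs
      -- Cut at the first large jump. Its price, at least `C * r`, compensates the lower bound `-B`
      -- of the piece before it and the cost `-D` at `x i`, so the bound does not deteriorate.
      obtain ⟨i, ⟨hin, hir⟩, hmin⟩ : ∃ i, (i < n ∧ r < dist (f (x i)) (x (i + 1))) ∧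
          ∀ k < i, ¬(k < n ∧ r < dist (f (x k)) (x (k + 1))) := by
        classical
        exact ⟨Nat.find hs, Nat.find_spec hs, fun k hk => Nat.find_min hs hk⟩
      obtain ⟨m, rfl⟩ : ∃ m, n = i + 1 + m := ⟨n - (i + 1), by omega⟩
      have h1 := (hsmall i x (fun k hk => hx k (by omega)) fun k hk => by
        have := hmin k hk
        push Not at this
        exact this (by omega)).trans (chainAction_mono hC₁ x i)
      have h2 := ih m (by omega) (fun k => x (i + 1 + k)) fun k hk => hx _ (by omega)
      have h3 := hψ (x i) (hx i (by omega))
      have h4 : C * r ≤ C * dist (f (x i)) (x (i + 1)) := by gcongr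
      rw [chainAction_add, chainAction_succ]
      linarith

/-- A cost for which the action of chains is bounded from below has a sub-action, given by the
infimum of the action over the chains which end at a given point. -/
theorem exists_subaction_of_le_chainAction (hΩ : Ω.Nonempty) (hC : 0 ≤ C) {B D : ℝ}
    (hψ : ∀ x ∈ Ω, -D ≤ ψ x)
    (hB : ∀ n : ℕ, ∀ x : ℕ → M, (∀ i ≤ n, x i ∈ Ω) → -B ≤ chainAction f ψ C x n) :
    ∃ u : M → ℝ, (∀ y z, u y ≤ u z + C * dist y z) ∧ ∀ x ∈ Ω, u (f x) - u x ≤ ψ x := by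
  let c := {c : ℕ × (ℕ → M) // ∀ i ≤ c.1, c.2 i ∈ Ω}
  obtain ⟨w, hw⟩ := hΩ
  have : Nonempty c := ⟨⟨(0, fun _ => w), fun _ _ => hw⟩⟩
  -- The target `y` need not lie in `Ω`: it enters only through the price of the final jump, which
  -- makes the infimum `C`-Lipschitz on all of `M`.
  let val : M → c → ℝ := fun y c => chainAction f ψ C c.1.2 c.1.1 +
    (ψ (c.1.2 c.1.1) + C * dist (f (c.1.2 c.1.1)) y)
  have hbdd : ∀ y, BddBelow (range (val y)) := by
    refine fun y => ⟨-B + -D, ?_⟩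
    rintro _ ⟨⟨⟨n, x⟩, hx⟩, rfl⟩
    have h1 := hB n x hx
    have h2 := hψ (x n) (hx n le_rfl)
    have h3 : 0 ≤ C * dist (f (x n)) y := by positivity
    simp only [val]
    linarith
  refine ⟨fun y => ⨅ c, val y c, fun y z => ?_, fun x hx => ?_⟩
  · rw [← sub_le_iff_le_add]
    refine le_ciInf fun c => ?_
    rw [sub_le_iff_le_add]
    refine (ciInf_le (hbdd y) c).trans ?_
    have h1 := dist_triangle_right (f (c.1.2 c.1.1)) y z
    have h2 : C * dist (f (c.1.2 c.1.1)) y ≤ C * (dist (f (c.1.2 c.1.1)) z + dist y z) := by gcongr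
    simp only [val]
    linarith
  · rw [sub_le_comm]
    refine le_ciInf ?_
    rintro ⟨⟨n, z⟩, hz⟩
    -- Append `x` to the chain. The final jump from `f x` to `f x` is free, so only `ψ x` is added.
    let z' : ℕ → M := fun i => if i ≤ n then z i else x
    have hz' : ∀ i ≤ n, z' i = z i := fun i hi => if_pos hi
    have hz'n : z' (n + 1) = x := if_neg (by omega)
    have h1 := ciInf_le (hbdd (f x)) ⟨(n + 1, z'), fun i hi => by
      by_cases h : i ≤ n
      · simp only [hz' i h]; exact hz i h
      · have : i = n + 1 := by simp only at hi; omega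
        simp only [this, hz'n]; exact hx⟩
    have h2 : chainAction f ψ C z' n = chainAction f ψ C z n :=
      Finset.sum_congr rfl fun i hi => by
        rw [Finset.mem_range] at hi
        rw [hz' i hi.le, hz' (i + 1) hi]
    simp only [val, chainAction_succ, h2, hz'n, hz' n le_rfl, dist_self, mul_zero, add_zero] at h1 ⊢
    linarith

end Chains

/-! ### From periodic shadowing to sub-actions -/

section Subaction

variable {M : Type*} [MetricSpace M] {f : M → M} {Λ : Set M} {φ : M → ℝ}

theorem abs_sub_le_lipConst_mul_dist (hφ : ∃ L, LipschitzWith L φ) (x y : M) :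
    |φ y - φ x| ≤ lipConst φ * dist x y := by
  obtain ⟨L, hL⟩ := hφ
  rcases eq_or_ne x y with rfl | hxy
  · simp
  · rw [← div_le_iff₀ (dist_pos.2 hxy)]
    refine le_csSup ⟨L, ?_⟩ ⟨x, y, hxy, rfl⟩
    rintro _ ⟨x, y, hxy, rfl⟩
    rw [div_le_iff₀ (dist_pos.2 hxy), dist_comm, ← Real.dist_eq]
    exact hL.dist_le_mul y x

theorem lipConst_nonneg (φ : M → ℝ) : 0 ≤ lipConst φ := by
  refine Real.sSup_nonneg ?_
  rintro _ ⟨x, y, -, rfl⟩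
  positivity

theorem lipConst_le {L : ℝ} (hL : 0 ≤ L) (h : ∀ x y, |φ y - φ x| ≤ L * dist x y) :
    lipConst φ ≤ L := by
  refine Real.sSup_le ?_ hL
  rintro _ ⟨x, y, hxy, rfl⟩
  rw [div_le_iff₀ (dist_pos.2 hxy)]
  exact h x y

/-- Closed chains with small jumps have nonnegative action, if periodic orbits do. -/
theorem IsPeriodicShadowing.chainAction_nonneg {ε K L C m : ℝ} (h : IsPeriodicShadowing f Λ ε K)
    (hL : 0 ≤ L) (hφ : ∀ x y, |φ y - φ x| ≤ L * dist x y)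
    (hm : ∀ p ∈ Λ, ∀ n : ℕ, f^[n] p = p → n * m ≤ birkhoffSum f φ n p) (hC : K * L ≤ C)
    {n : ℕ} (hn : 1 ≤ n) {x : ℕ → M} (hx : ∀ i ≤ n, x i ∈ Metric.thickening ε Λ)
    (hjump : ∀ i < n, dist (f (x i)) (x (i + 1)) ≤ ε) (hper : x n = x 0) :
    0 ≤ chainAction f (fun y => φ y - m) C x n := by
  obtain ⟨p, hp, hpn, hsum, -⟩ := h n hn x ⟨hx, hjump⟩ hper
  rw [sum_Icc_one_eq_sum_range, sum_Icc_one_eq_sum_range] at hsum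
  simp only [Nat.add_sub_cancel] at hsum
  have h1 : ∑ i ∈ Finset.range n, dist (x i) (f^[i] p) =
      ∑ i ∈ Finset.range n, dist (x (i + 1)) (f^[i + 1] p) := by
    have h2 := Finset.sum_range_succ (fun i => dist (x i) (f^[i] p)) n
    rw [Finset.sum_range_succ', hpn, hper] at h2
    simpa using h2.symm
  rw [← h1] at hsum
  -- Moving to the periodic orbit costs at most `L` times the total shadowing distance, which the
  -- price `C ≥ K * L` of the jumps covers.
  have h2 : ∑ i ∈ Finset.range n, (φ (f^[i] p) - L * dist (x i) (f^[i] p)) ≤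
      ∑ i ∈ Finset.range n, φ (x i) := Finset.sum_le_sum fun i _ => by
    have := (abs_le.1 (hφ (x i) (f^[i] p))).2
    linarith
  rw [Finset.sum_sub_distrib, ← Finset.mul_sum] at h2
  have h3 := hm p hp n hpn
  rw [birkhoffSum] at h3
  have h4 : 0 ≤ ∑ i ∈ Finset.range n, dist (f (x i)) (x (i + 1)) :=
    Finset.sum_nonneg fun _ _ => dist_nonneg
  have h5 := mul_le_mul_of_nonneg_left hsum hL
  have h6 := mul_le_mul_of_nonneg_right hC h4
  simp only [chainAction, Finset.sum_add_distrib, Finset.sum_sub_distrib, ← Finset.mul_sum,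
    Finset.sum_const, Finset.card_range, nsmul_eq_mul]
  nlinarith

/-- If `Λ` has the periodic shadowing property, then every Lipschitz function has a sub-action whose
Lipschitz constant is controlled by the Lipschitz constant of the function. -/
theorem IsPeriodicShadowing.exists_subaction {ε K : ℝ} (h : IsPeriodicShadowing f Λ ε K)
    (hε : 0 < ε) (hK : 0 ≤ K) (hne : Λ.Nonempty) (hmaps : MapsTo f Λ Λ)
    (hc : IsCompact (closure (Metric.thickening ε Λ))) :
    ∃ K₁ : ℝ, 0 ≤ K₁ ∧ ∀ φ : M → ℝ, (∃ L, LipschitzWith L φ) →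
      Tendsto (fun n : ℕ => (1 / (n : ℝ)) * ⨅ x : Λ, birkhoffSum f φ n (x : M)) atTop
        (𝓝 (ergodicMinimizingValue f Λ φ)) ∧
      ∀ C, K₁ ≤ C → ∃ u : M → ℝ, (∀ x y, |u y - u x| ≤ C * lipConst φ * dist x y) ∧
        ∀ x ∈ Metric.thickening ε Λ, φ x - ergodicMinimizingValue f Λ φ ≥ u (f x) - u x := by
  classical
  set Ω := Metric.thickening ε Λ
  obtain ⟨w, hw⟩ := hne
  have hΛΩ : Λ ⊆ Ω := Metric.self_subset_thickening hε Λ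
  -- With radius `ε / 4`, two points of one cell are less than `ε / 2` apart, and closing a chain
  -- with jumps at most `ε / 2` gives jumps at most `ε`.
  obtain ⟨t, -, htfin, htcov⟩ := Metric.finite_approx_of_totallyBounded
    (hc.totallyBounded.subset subset_closure) (ε / 4) (by positivity)
  obtain ⟨D, hD⟩ := Metric.isBounded_iff.1 (hc.isBounded.subset subset_closure)
  have hD0 : 0 ≤ D := dist_nonneg.trans (hD (hΛΩ hw) (hΛΩ hw))
  have hcell : ∀ x : M, ∃ c : M, x ∈ Ω → c ∈ htfin.toFinset ∧ dist x c < ε / 4 := fun x => by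
    by_cases hx : x ∈ Ω
    · obtain ⟨c, hc, hxc⟩ := mem_iUnion₂.1 (htcov hx)
      exact ⟨c, fun _ => ⟨htfin.mem_toFinset.2 hc, hxc⟩⟩
    · exact ⟨x, fun h => absurd h hx⟩
  choose cell hcell using hcell
  set N : ℝ := (htfin.toFinset.card : ℝ)
  have hN : 0 ≤ N := Nat.cast_nonneg _
  -- Multiplied by `L * (ε / 2)`, the second term is the bound on chains with small jumps plus the
  -- oscillation `L * D`. All costs are proportional to `L`, so the constant does not depend on `φ`.
  refine ⟨K + 2 / ε * (N * (K * (ε / 2) + D) + D), by positivity, fun φ hφ => ?_⟩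
  set L := lipConst φ
  have hL : 0 ≤ L := lipConst_nonneg φ
  have hφL : ∀ x y, |φ y - φ x| ≤ L * dist x y := abs_sub_le_lipConst_mul_dist hφ
  have hosc : ∀ x ∈ Ω, ∀ y ∈ Ω, |φ y - φ x| ≤ L * D := fun x hx y hy =>
    (hφL x y).trans (by gcongr; exact hD hx hy)
  obtain ⟨m, hm, hmper, hmle⟩ := exists_tendsto_ergodicMinimizing (φ := φ) ⟨w, hw⟩ hmaps
    (B := |φ w| + L * D) fun x hx => by
      have h1 := hosc w (hΛΩ hw) x (hΛΩ hx)
      have h2 := abs_add_le (φ x - φ w) (φ w)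
      rw [sub_add_cancel] at h2
      linarith
  have hm' : ergodicMinimizingValue f Λ φ = m := hm.limUnder_eq
  rw [hm']
  refine ⟨hm, fun C hC => ?_⟩
  -- On `Λ` the function is at most `φ x + L * D`, hence so is `m`.
  have hψ : ∀ x ∈ Ω, -(L * D) ≤ φ x - m := fun x hx => by
    have := hmle (φ x + L * D) fun y hy => by
      have := (abs_le.1 (hosc x hx y (hΛΩ hy))).2
      linarith
    linarith
  have hC₁ : K ≤ C := le_trans (le_add_of_nonneg_right (by positivity)) hC
  have hsmall := neg_le_chainAction_of_cells (f := f) (ψ := fun y => φ y - m) (C := K * L) (Ω := Ω)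
    cell (r := ε / 2) (D := L * D) (by positivity) (by positivity) hψ (by positivity)
    (fun n x hx hjump hxn => neg_le_chainAction_of_dist_le hε.le (by positivity)
      (fun n hn x hx hjump hper => h.chainAction_nonneg hL hφL hmper le_rfl hn hx hjump hper)
      hx hjump (by
        have h1 := (hcell _ (hx n le_rfl)).2
        have h2 := (hcell _ (hx 0 (Nat.zero_le n))).2
        rw [hxn] at h1
        have := dist_triangle_right (x n) (x 0) (cell (x 0))
        linarith)) htfin.toFinset
  have hbig : N * (K * L * (ε / 2) + L * D) + L * D ≤ C * L * (ε / 2) := by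
    have h1 := mul_le_mul_of_nonneg_right hC (show 0 ≤ L * (ε / 2) by positivity)
    have h2 : (K + 2 / ε * (N * (K * (ε / 2) + D) + D)) * (L * (ε / 2)) =
        K * L * (ε / 2) + (N * (K * L * (ε / 2) + L * D) + L * D) := by
      field_simp
    have h3 : 0 ≤ K * L * (ε / 2) := by positivity
    linarith
  have hC0 : 0 ≤ C * L := mul_nonneg (hK.trans hC₁) hL
  obtain ⟨u, hu, hsub⟩ := exists_subaction_of_le_chainAction (f := f) (ψ := fun y => φ y - m)
    (C := C * L) ⟨w, hΛΩ hw⟩ hC0 hψ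
    (neg_le_chainAction (mul_le_mul_of_nonneg_right hC₁ hL) hC0 hψ
      (fun n x hx => hsmall n x fun i hi => ⟨hx i hi, (hcell _ (hx i hi)).1⟩) hbig)
  refine ⟨u, fun x y => ?_, hsub⟩
  have h1 := hu x y
  have h2 := hu y x
  rw [dist_comm] at h2
  rw [abs_le]
  constructor <;> linarith

end Subaction

/-! ### Freezing the splitting at chart centres -/

theorem SplitNorm.HasCrossForm.mono {V : Type*} [AddCommGroup V] [Module ℝ V] {X X' : SplitNorm V}
    {ρ α β κ κ' : ℝ} {rel : V → V → Prop} (h : X.HasCrossForm X' ρ α β κ rel) (hκ : κ ≤ κ') :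
    X.HasCrossForm X' ρ α β κ' rel := by
  obtain ⟨G, H, h₁, h₂, h₃, h₄, h₅, h₆, h₇⟩ := h
  exact ⟨G, H, h₁, h₂, h₃, h₄, h₅, h₆.trans hκ, h₇.trans hκ⟩

/-- The linear map `T` is compatible with the splittings `X` and `X'`. -/
def SplitNorm.IsCompatible {V : Type*} [AddCommGroup V] [Module ℝ V] (X X' : SplitNorm V)
    (a b B δ : ℝ) (T : V →ₗ[ℝ] V) : Prop :=
  (∀ w, X'.ns (T w) ≤ a * X.ns w + δ * X.n w) ∧
  (∀ w, b * X.nu w - δ * X.n w ≤ X'.nu (T w)) ∧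
  ∀ w, X'.nu (T w) ≤ B * X.nu w + δ * X.n w

section AdaptedNorms

variable {d : ℕ} {M : Type*} [TopologicalSpace M]
    [ChartedSpace (EuclideanSpace ℝ (Fin d)) M] [IsManifold (𝓡 d) 1 M] {f : M → M} {Λ : Set M}

namespace AdaptedSplitting

variable (A : AdaptedSplitting d f Λ)

/-- The adapted splitting and norm at a point, the tangent space being identified with `ℝ^d` by the
preferred chart. -/
def splitNorm (c : Λ) : SplitNorm (EuclideanSpace ℝ (Fin d)) where
  proj := A.proj c
  nu := A.nu c
  ns := A.ns c
  proj_proj := A.proj_proj c c.2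
  nu_proj := A.nu_proj c c.2
  ns_proj := A.ns_proj c c.2
  nu_sub_proj := A.nu_sub_proj c c.2
  ns_sub_proj := A.ns_sub_proj c c.2
  eq_zero := A.eq_zero c c.2

/-- In the chart at `c`, the adapted norm at `z` is close to the one at `c`. -/
def IsCloseAt (δ : ℝ) (c : Λ) (z : M) : Prop :=
  ∀ v : TangentSpace (𝓡 d) z,
    |A.nu z v - (A.splitNorm c).nu (chartDeriv (c : M) z v)| ≤
      δ * (A.splitNorm c).n (chartDeriv (c : M) z v) ∧
    |A.ns z v - (A.splitNorm c).ns (chartDeriv (c : M) z v)| ≤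
      δ * (A.splitNorm c).n (chartDeriv (c : M) z v)

theorem eventually_isCloseAt {δ : ℝ} (hδ : 0 < δ) (c : Λ) :
    ∀ᶠ z in 𝓝[Λ] (c : M), A.IsCloseAt δ c z := by
  obtain ⟨K, hK, hle⟩ := (A.splitNorm c).n.exists_norm_le_mul (A.splitNorm c).eq_zero_of_n_eq_zero
  have hu := eventually_forall_abs_sub_le_of_homogeneous (l := 𝓝[Λ] (c : M))
    (g := fun z w => A.nu z (chartDerivSymm (c : M) z w)) (g₀ := (A.splitNorm c).nu)
    (Eventually.of_forall fun z t w => by rw [map_smul, map_smul_eq_mul, Real.norm_eq_abs])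
    (fun t w => by rw [map_smul_eq_mul, Real.norm_eq_abs])
    (A.splitNorm c).nu.continuous_of_finiteDimensional
    (fun w => by
      have := A.tendsto_nu c c.2 w
      rwa [chartDerivSymm_self] at this) (δ := δ / K) (by positivity)
  have hs := eventually_forall_abs_sub_le_of_homogeneous (l := 𝓝[Λ] (c : M))
    (g := fun z w => A.ns z (chartDerivSymm (c : M) z w)) (g₀ := (A.splitNorm c).ns)
    (Eventually.of_forall fun z t w => by rw [map_smul, map_smul_eq_mul, Real.norm_eq_abs])
    (fun t w => by rw [map_smul_eq_mul, Real.norm_eq_abs])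
    (A.splitNorm c).ns.continuous_of_finiteDimensional
    (fun w => by
      have := A.tendsto_ns c c.2 w
      rwa [chartDerivSymm_self] at this) (δ := δ / K) (by positivity)
  have hsrc : ∀ᶠ z in 𝓝[Λ] (c : M), z ∈ (chartAt (EuclideanSpace ℝ (Fin d)) (c : M)).source :=
    mem_nhdsWithin_of_mem_nhds (chart_source_mem_nhds _ _)
  filter_upwards [hu, hs, hsrc] with z hu hs hz v
  have h1 := hu (chartDeriv (c : M) z v)
  have h2 := hs (chartDeriv (c : M) z v)
  rw [chartDerivSymm_chartDeriv hz] at h1 h2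
  have h3 : δ / K * ‖chartDeriv (c : M) z v‖ ≤ δ * (A.splitNorm c).n (chartDeriv (c : M) z v) := by
    rw [div_mul_eq_mul_div, div_le_iff₀ hK, mul_assoc]
    gcongr
    rw [mul_comm]
    exact hle _
  exact ⟨h1.trans h3, h2.trans h3⟩

/-- The exact one-step inequalities hold for the splittings at `z` and `f z`; replacing these by the
splittings at `c` and `c'` costs an error proportional to `δ`. -/
theorem isCompatible {c c' : Λ} {z : M} (hz : z ∈ Λ)
    (hzc : z ∈ (chartAt (EuclideanSpace ℝ (Fin d)) (c : M)).source) {δ δ' : ℝ} (hδ0 : 0 ≤ δ)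
    (hδ : δ ≤ 1 / 4) (hδ' : (4 * A.B + A.b) * δ ≤ δ') (h : A.IsCloseAt δ c z)
    (h' : A.IsCloseAt δ c' (f z)) {T : EuclideanSpace ℝ (Fin d) →ₗ[ℝ] EuclideanSpace ℝ (Fin d)}
    (hT : ∀ v : TangentSpace (𝓡 d) z,
      T (chartDeriv (c : M) z v) = chartDeriv (c' : M) (f z) (mfderiv (𝓡 d) (𝓡 d) f z v)) :
    (A.splitNorm c).IsCompatible (A.splitNorm c') A.a A.b A.B δ' T := by
  have ha := A.a_pos
  have ha1 := A.a_lt_one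
  have hb := A.one_lt_b
  have hB := A.one_le_B
  have key : ∀ w, (A.splitNorm c').ns (T w) ≤ A.a * (A.splitNorm c).ns w + δ' * (A.splitNorm c).n w ∧
      A.b * (A.splitNorm c).nu w - δ' * (A.splitNorm c).n w ≤ (A.splitNorm c').nu (T w) ∧
      (A.splitNorm c').nu (T w) ≤ A.B * (A.splitNorm c).nu w + δ' * (A.splitNorm c).n w := by
    intro w
    obtain ⟨v, rfl⟩ : ∃ v, chartDeriv (c : M) z v = w :=
      ⟨chartDerivSymm (c : M) z w, chartDeriv_chartDerivSymm hzc w⟩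
    rw [hT]
    obtain ⟨h1, h2⟩ := h v
    obtain ⟨h3, h4⟩ := h' (mfderiv (𝓡 d) (𝓡 d) f z v)
    have h5 := A.ns_map_le z hz v
    have h6 := A.le_nu_map z hz v
    have h7 := A.nu_map_le z hz v
    have p1 : 0 ≤ A.nu z v := apply_nonneg _ _
    have p2 : 0 ≤ A.ns z v := apply_nonneg _ _
    have p3 : 0 ≤ (A.splitNorm c).nu (chartDeriv (c : M) z v) := apply_nonneg _ _
    have p4 : 0 ≤ (A.splitNorm c).ns (chartDeriv (c : M) z v) := apply_nonneg _ _
    have p5 : 0 ≤ (A.splitNorm c').nu (chartDeriv (c' : M) (f z) (mfderiv (𝓡 d) (𝓡 d) f z v)) :=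
      apply_nonneg _ _
    have p6 : 0 ≤ (A.splitNorm c').ns (chartDeriv (c' : M) (f z) (mfderiv (𝓡 d) (𝓡 d) f z v)) :=
      apply_nonneg _ _
    rw [SplitNorm.n_apply] at h1 h2 h3 h4 ⊢
    generalize A.nu z v = u at *
    generalize A.ns z v = s at *
    generalize (A.splitNorm c).nu (chartDeriv (c : M) z v) = U at *
    generalize (A.splitNorm c).ns (chartDeriv (c : M) z v) = S at *
    generalize A.nu (f z) (mfderiv (𝓡 d) (𝓡 d) f z v) = u' at *
    generalize A.ns (f z) (mfderiv (𝓡 d) (𝓡 d) f z v) = s' at *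
    generalize (A.splitNorm c').nu (chartDeriv (c' : M) (f z) (mfderiv (𝓡 d) (𝓡 d) f z v)) = U' at *
    generalize (A.splitNorm c').ns (chartDeriv (c' : M) (f z) (mfderiv (𝓡 d) (𝓡 d) f z v)) = S' at *
    generalize A.a = a at *
    generalize A.b = b at *
    generalize A.B = B at *
    rw [abs_le] at h1 h2 h3 h4
    have hn : 0 ≤ U + S := by positivity
    have e1 : δ * (U' + S') ≤ 1 / 4 * (U' + S') := by gcongr
    have e2 : δ * (U + S) ≤ 1 / 4 * (U + S) := by gcongr
    have e3 : s' ≤ B * s := h5.trans (by gcongr; linarith)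
    have e4 : B * (u + s) ≤ B * (3 / 2 * (U + S)) := by gcongr; linarith
    -- With `δ ≤ 1 / 4`, the frozen norm of the image is at most twice its true norm, and the true
    -- norm of `v` at most `3 / 2` of its frozen one.
    have e5 : U' + S' ≤ 3 * B * (U + S) := by nlinarith
    have e6 : δ * (U' + S') ≤ δ * (3 * B * (U + S)) := by gcongr
    have e7 : (4 * B + b) * δ * (U + S) ≤ δ' * (U + S) := by gcongr
    have q : 0 ≤ δ * (U + S) := by positivity
    refine ⟨?_, ?_, ?_⟩
    · have e8 : a * s ≤ a * (S + δ * (U + S)) := by gcongr; linarith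
      have e9 : a * (δ * (U + S)) ≤ B * (δ * (U + S)) := by gcongr; linarith
      have e10 : 0 ≤ b * (δ * (U + S)) := by positivity
      nlinarith
    · have e8 : b * (U - δ * (U + S)) ≤ b * u := by gcongr; linarith
      have e9 : 0 ≤ B * (δ * (U + S)) := by positivity
      nlinarith
    · have e8 : B * u ≤ B * (U + δ * (U + S)) := by gcongr; linarith
      have e10 : 0 ≤ b * (δ * (U + S)) := by positivity
      nlinarith
  exact ⟨fun w => (key w).1, fun w => (key w).2.1, fun w => (key w).2.2⟩

end AdaptedSplitting

end AdaptedNorms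

/-! ### Charts and the derivative of the map -/

section Charts

variable {d : ℕ} {M : Type*}

/-- The derivative of a `C^1` map, read in charts. -/
theorem exists_hasStrictFDerivAt_chart [TopologicalSpace M]
    [ChartedSpace (EuclideanSpace ℝ (Fin d)) M] [IsManifold (𝓡 d) 1 M] {f : M → M}
    (hf : ContMDiff (𝓡 d) (𝓡 d) 1 f) {c c' z : M}
    (hz : z ∈ (chartAt (EuclideanSpace ℝ (Fin d)) c).source)
    (hz' : f z ∈ (chartAt (EuclideanSpace ℝ (Fin d)) c').source) :
    ∃ T : EuclideanSpace ℝ (Fin d) →L[ℝ] EuclideanSpace ℝ (Fin d),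
      HasStrictFDerivAt (extChartAt (𝓡 d) c' ∘ f ∘ (extChartAt (𝓡 d) c).symm) T
        (extChartAt (𝓡 d) c z) ∧
      ∀ v : TangentSpace (𝓡 d) z,
        T (chartDeriv c z v) = chartDeriv c' (f z) (mfderiv (𝓡 d) (𝓡 d) f z v) := by
  have h1 := ((contMDiffAt_iff_of_mem_source hz hz').1 (hf z)).2
  rw [modelWithCornersSelf_coe, range_id, contDiffWithinAt_univ] at h1
  have h2 := h1.hasStrictFDerivAt one_ne_zero
  refine ⟨_, h2, fun v => ?_⟩
  have hsrc : z ∈ (extChartAt (𝓡 d) c).source := by rwa [extChartAt_source]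
  have m1 : MDifferentiableAt (𝓡 d) 𝓘(ℝ, EuclideanSpace ℝ (Fin d)) (extChartAt (𝓡 d) c) z :=
    mdifferentiableAt_extChartAt hz
  have m1' : MDifferentiableAt (𝓡 d) 𝓘(ℝ, EuclideanSpace ℝ (Fin d)) (extChartAt (𝓡 d) c') (f z) :=
    mdifferentiableAt_extChartAt hz'
  have m2 : MDifferentiableAt (𝓡 d) (𝓡 d) f z := (hf z).mdifferentiableAt one_ne_zero
  have m3 := h2.hasFDerivAt.hasMFDerivAt.comp z m1.hasMFDerivAt
  have m4 := m1'.hasMFDerivAt.comp z m2.hasMFDerivAt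
  have heq : (extChartAt (𝓡 d) c' ∘ f ∘ (extChartAt (𝓡 d) c).symm) ∘ extChartAt (𝓡 d) c =ᶠ[𝓝 z]
      extChartAt (𝓡 d) c' ∘ f := by
    filter_upwards [extChartAt_source_mem_nhds' (I := 𝓡 d) hsrc] with y hy
    simp only [Function.comp_apply, (extChartAt (𝓡 d) c).left_inv hy]
  have := hasMFDerivAt_unique (m3.congr_of_eventuallyEq heq.symm) m4
  rw [chartDeriv_eq_mfderiv hz, chartDeriv_eq_mfderiv hz']
  exact DFunLike.congr_fun this v

variable [MetricSpace M] [ChartedSpace (EuclideanSpace ℝ (Fin d)) M] [IsManifold (𝓡 d) 1 M]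

/-- Near `c`, the preferred chart at `c` is bi-Lipschitz. -/
theorem FinslerNorm.exists_chart_bounds {F : FinslerNorm d M}
    (hF : ∀ x y : M, edist x y = F.pathEDist x y)
    {n : Seminorm ℝ (EuclideanSpace ℝ (Fin d))} (hn : ∀ v, n v = 0 → v = 0) (c : M) :
    ∃ L ≥ 1, ∀ᶠ r in 𝓝[>] (0 : ℝ),
      (∀ x ∈ Metric.ball c r, x ∈ (chartAt (EuclideanSpace ℝ (Fin d)) c).source) ∧
      (∀ x ∈ Metric.ball c r, ∀ y ∈ Metric.ball c r,
        n (extChartAt (𝓡 d) c x - extChartAt (𝓡 d) c y) ≤ L * dist x y) ∧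
      ∀ x ∈ Metric.ball c r, ∀ h, n h ≤ r →
        dist x ((extChartAt (𝓡 d) c).symm (extChartAt (𝓡 d) c x + h)) ≤ L * n h := by
  obtain ⟨K₁, hK₁, h₁⟩ := n.exists_le_mul_norm
  obtain ⟨K₂, hK₂, h₂⟩ := n.exists_norm_le_mul hn
  obtain ⟨K₃, hK₃, h₃⟩ := F.exists_dist_le_norm_chart hF c
  obtain ⟨K₄, hK₄, h₄⟩ := F.exists_norm_chart_le_dist hF c
  obtain ⟨s, h₃, hs⟩ := (h₃.and self_mem_nhdsWithin).exists
  obtain ⟨t, ht, hball⟩ := Metric.eventually_nhds_iff_ball.1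
    ((Filter.Eventually.and (chart_source_mem_nhds (EuclideanSpace ℝ (Fin d)) c))
      ((continuousAt_extChartAt (I := 𝓡 d) c).eventually
        (Metric.ball_mem_nhds _ (half_pos hs))))
  have hrt : ∀ᶠ r in 𝓝[>] (0 : ℝ), r < min t (s / (2 * K₂)) :=
    mem_nhdsWithin_of_mem_nhds (gt_mem_nhds (by positivity))
  refine ⟨max 1 (max (K₁ * K₄) (K₃ * K₂)), le_max_left _ _, ?_⟩
  filter_upwards [h₄, hrt] with r h₄ hr
  have hrt : r < t := hr.trans_le (min_le_left _ _)
  have hsub : Metric.ball c r ⊆ Metric.ball c t := Metric.ball_subset_ball hrt.le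
  refine ⟨fun x hx => (hball x (hsub hx)).1, fun x hx y hy => ?_, fun x hx h hh => ?_⟩
  · calc _ ≤ K₁ * (K₄ * dist x y) := (h₁ _).trans (by gcongr; exact h₄ x hx y hy)
      _ = K₁ * K₄ * dist x y := by ring
      _ ≤ _ := by gcongr; exact (le_max_left _ _).trans (le_max_right _ _)
  · obtain ⟨hx1, hx2⟩ := hball x (hsub hx)
    have hhs : ‖h‖ < s / 2 := by
      have h5 := h₂ h
      have h6 : K₂ * n h ≤ K₂ * r := by gcongr
      have h7 := hr.trans_le (min_le_right _ _)
      rw [lt_div_iff₀ (by positivity)] at h7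
      linarith
    have h8 := h₃ (extChartAt (𝓡 d) c x) (Metric.ball_subset_ball (by linarith) hx2)
      (extChartAt (𝓡 d) c x + h) (by
        rw [Metric.mem_ball]
        calc _ ≤ dist (extChartAt (𝓡 d) c x + h) (extChartAt (𝓡 d) c x) +
              dist (extChartAt (𝓡 d) c x) (extChartAt (𝓡 d) c c) := dist_triangle _ _ _
          _ < s / 2 + s / 2 := by rw [dist_self_add_left]; gcongr
          _ = s := add_halves s)
    rw [(extChartAt (𝓡 d) c).left_inv (by rwa [extChartAt_source]), sub_add_cancel_left, norm_neg]
      at h8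
    calc _ ≤ K₃ * ‖h‖ := h8
      _ ≤ K₃ * (K₂ * n h) := by gcongr; exact h₂ h
      _ = K₃ * K₂ * n h := by ring
      _ ≤ _ := by gcongr; exact (le_max_right _ _).trans (le_max_right _ _)

end Charts

/-! ### Construction of hyperbolic charts -/

section ChartMaps

variable {d : ℕ} {M : Type*} [MetricSpace M] [ChartedSpace (EuclideanSpace ℝ (Fin d)) M]
  {f : M → M} {Λ : Set M}

/-- Read in the charts at `c` and `c'`, the map `f` is close to a linear map compatible with the
splittings `X` and `X'` on the ball of radius `r` around `x`. -/
def IsApproxCompatible (f : M → M) (X X' : SplitNorm (EuclideanSpace ℝ (Fin d))) (c c' : M)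
    (a b B δ r : ℝ) (x : M) : Prop :=
  ∃ T : EuclideanSpace ℝ (Fin d) →ₗ[ℝ] EuclideanSpace ℝ (Fin d), X.IsCompatible X' a b B δ T ∧
    (∀ h, X.n h ≤ r → f ((extChartAt (𝓡 d) c).symm (extChartAt (𝓡 d) c x + h)) ∈
      (extChartAt (𝓡 d) c').source) ∧
    ∀ h k, X.n h ≤ r → X.n k ≤ r →
      X'.n (extChartAt (𝓡 d) c' (f ((extChartAt (𝓡 d) c).symm (extChartAt (𝓡 d) c x + h))) -
        extChartAt (𝓡 d) c' (f ((extChartAt (𝓡 d) c).symm (extChartAt (𝓡 d) c x + k))) -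
        T (h - k)) ≤ δ * X.n (h - k)

theorem IsApproxCompatible.mono {X X' : SplitNorm (EuclideanSpace ℝ (Fin d))} {c c' x : M}
    {a b B δ r r' : ℝ} (h : IsApproxCompatible f X X' c c' a b B δ r x) (hr : r' ≤ r) :
    IsApproxCompatible f X X' c c' a b B δ r' x := by
  obtain ⟨T, h₁, h₂, h₃⟩ := h
  exact ⟨T, h₁, fun h hh => h₂ h (hh.trans hr), fun h k hh hk => h₃ h k (hh.trans hr) (hk.trans hr)⟩

/-- A map whose derivative in charts is compatible with the splittings at a point is close to a
compatible linear map near this point. -/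
theorem exists_isApproxCompatible (hf : Continuous f) {X X' : SplitNorm (EuclideanSpace ℝ (Fin d))}
    {c c' z : M} {a b B δ : ℝ} (hδ : 0 < δ)
    (hz : z ∈ (extChartAt (𝓡 d) c).source) (hz' : f z ∈ (extChartAt (𝓡 d) c').source)
    {T : EuclideanSpace ℝ (Fin d) →L[ℝ] EuclideanSpace ℝ (Fin d)}
    (hT : HasStrictFDerivAt (extChartAt (𝓡 d) c' ∘ f ∘ (extChartAt (𝓡 d) c).symm) T
      (extChartAt (𝓡 d) c z)) (hcomp : X.IsCompatible X' a b B δ T.toLinearMap) :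
    ∀ᶠ r in 𝓝[>] (0 : ℝ), ∀ x ∈ Metric.ball z r, IsApproxCompatible f X X' c c' a b B δ r x := by
  obtain ⟨K₁, hK₁, h₁⟩ := X'.n.exists_le_mul_norm
  obtain ⟨K₂, hK₂, h₂⟩ := X.n.exists_norm_le_mul X.eq_zero_of_n_eq_zero
  have hcont : ContinuousAt (f ∘ (extChartAt (𝓡 d) c).symm) (extChartAt (𝓡 d) c z) :=
    hf.continuousAt.comp (continuousAt_extChartAt_symm' hz)
  have e1 : ∀ᶠ p in 𝓝 (extChartAt (𝓡 d) c z), f ((extChartAt (𝓡 d) c).symm p) ∈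
      (extChartAt (𝓡 d) c').source := by
    refine hcont.eventually_mem ?_
    rw [Function.comp_apply, (extChartAt (𝓡 d) c).left_inv hz]
    exact extChartAt_source_mem_nhds' hz'
  -- Strict differentiability controls both points of the pair, so the same linear map serves at all
  -- base points `x` near `z`.
  have e2 := hT.isLittleO.def (show 0 < δ / (K₁ * K₂) by positivity)
  rw [nhds_prod_eq] at e2
  obtain ⟨s, hs, e1⟩ := Metric.eventually_nhds_iff_ball.1 e1
  obtain ⟨P, hP, e2⟩ := eventually_prod_self_iff'.1 e2
  obtain ⟨s', hs', hP⟩ := Metric.mem_nhds_iff.1 hP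
  set t := min s s'
  have ht : 0 < t := lt_min hs hs'
  obtain ⟨q, hq, hball⟩ := Metric.eventually_nhds_iff_ball.1
    ((continuousAt_extChartAt' (I := 𝓡 d) hz).eventually (Metric.ball_mem_nhds _ (half_pos ht)))
  have hr : ∀ᶠ r in 𝓝[>] (0 : ℝ), r < min q (t / (2 * K₂)) :=
    mem_nhdsWithin_of_mem_nhds (gt_mem_nhds (by positivity))
  filter_upwards [hr] with r hr x hx
  have hx2 := hball x (Metric.ball_subset_ball (hr.le.trans (min_le_left _ _)) hx)
  have hmem : ∀ h, X.n h ≤ r →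
      extChartAt (𝓡 d) c x + h ∈ Metric.ball (extChartAt (𝓡 d) c z) t := by
    intro h hh
    have hht : ‖h‖ < t / 2 := by
      have h5 := h₂ h
      have h6 : K₂ * X.n h ≤ K₂ * r := by gcongr
      have h7 := hr.trans_le (min_le_right _ _)
      rw [lt_div_iff₀ (by positivity)] at h7
      linarith
    rw [Metric.mem_ball]
    calc _ ≤ dist (extChartAt (𝓡 d) c x + h) (extChartAt (𝓡 d) c x) +
          dist (extChartAt (𝓡 d) c x) (extChartAt (𝓡 d) c z) := dist_triangle _ _ _
      _ < t / 2 + t / 2 := by rw [dist_self_add_left]; gcongr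
      _ = t := add_halves t
  refine ⟨T.toLinearMap, hcomp,
    fun h hh => e1 _ (Metric.ball_subset_ball (min_le_left _ _) (hmem h hh)), fun h k hh hk => ?_⟩
  have h3 := e2 _ (hP (Metric.ball_subset_ball (min_le_right _ _) (hmem h hh)))
    _ (hP (Metric.ball_subset_ball (min_le_right _ _) (hmem k hk)))
  simp only [Function.comp_apply, add_sub_add_left_eq_sub] at h3
  calc _ ≤ K₁ * (δ / (K₁ * K₂) * ‖h - k‖) := (h₁ _).trans (by gcongr; exact h3)
    _ = δ * (‖h - k‖ / K₂) := by field_simp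
    _ ≤ _ := by
      gcongr
      rw [div_le_iff₀ hK₂, mul_comm]
      exact h₂ _

/-- If `f` is close to a compatible linear map, then it has a cross form. -/
theorem IsApproxCompatible.hasCrossForm {X X' : SplitNorm (EuclideanSpace ℝ (Fin d))}
    {c c' x x' : M} {a b B δ r α κ : ℝ} (h : IsApproxCompatible f X X' c c' a b B δ r x)
    (hdim : Module.finrank ℝ (LinearMap.range X.proj) = Module.finrank ℝ (LinearMap.range X'.proj))
    (hδ : 0 ≤ δ) (hb : 1 ≤ b - δ) (hα : (b - δ)⁻¹ ≤ α) (haα : a ≤ α)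
    (hx : x ∈ (extChartAt (𝓡 d) c).source)
    (hκ : X'.n (extChartAt (𝓡 d) c' (f x) - extChartAt (𝓡 d) c' x') ≤ κ) :
    X.HasCrossForm X' r α (2 * δ) κ fun h h' =>
      f ((extChartAt (𝓡 d) c).symm (extChartAt (𝓡 d) c x + h)) =
        (extChartAt (𝓡 d) c').symm (extChartAt (𝓡 d) c' x' + h') := by
  obtain ⟨T, hT, hsrc, happ⟩ := h
  refine (SplitNorm.hasCrossForm_of_linear_approx hdim hδ hb hα haα hT.1 hT.2.1 hT.2.2
    (F := fun h => extChartAt (𝓡 d) c'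
      (f ((extChartAt (𝓡 d) c).symm (extChartAt (𝓡 d) c x + h))) - extChartAt (𝓡 d) c' x')
    (fun h k hh hk => ?_) fun h hh _ => ?_).mono ?_
  · rw [sub_sub_sub_cancel_right]
    exact happ h k hh hk
  · rw [add_sub_cancel, (extChartAt (𝓡 d) c').left_inv (hsrc h hh)]
  · rwa [add_zero, (extChartAt (𝓡 d) c).left_inv hx]

variable [IsManifold (𝓡 d) 1 M]

namespace AdaptedSplitting

/-- The centres `c` and `c'` are arbitrary: if `z` or `f z` is outside the full ball, no nearby `x`
and `x'` lie in the half balls and the claim is vacuous. It can therefore be imposed for all pairs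
from a finite set. -/
theorem eventually_isApproxCompatible (A : AdaptedSplitting d f Λ)
    (hf : ContMDiff (𝓡 d) (𝓡 d) 1 f) (hmaps : MapsTo f Λ Λ) {δ δ' : ℝ} (hδ : 0 < δ)
    (hδ4 : δ ≤ 1 / 4) (hδ' : (4 * A.B + A.b) * δ ≤ δ') {c c' : Λ} {R R' : ℝ} (hR : 0 < R)
    (hR' : 0 < R')
    (hc : ∀ z ∈ Metric.ball (c : M) R, z ∈ (chartAt (EuclideanSpace ℝ (Fin d)) (c : M)).source)
    (hc' : ∀ z ∈ Metric.ball (c' : M) R', z ∈ (chartAt (EuclideanSpace ℝ (Fin d)) (c' : M)).source)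
    (hcl : ∀ z ∈ Λ, z ∈ Metric.ball (c : M) R → A.IsCloseAt δ c z)
    (hcl' : ∀ z ∈ Λ, z ∈ Metric.ball (c' : M) R' → A.IsCloseAt δ c' z) {z : M} (hz : z ∈ Λ) :
    ∀ᶠ r in 𝓝[>] (0 : ℝ), ∀ x ∈ Metric.ball z r, ∀ x', dist (f x) x' ≤ r →
      x ∈ Metric.ball (c : M) (R / 2) → x' ∈ Metric.ball (c' : M) (R' / 2) →
      IsApproxCompatible f (A.splitNorm c) (A.splitNorm c') c c' A.a A.b A.B δ' r x := by
  have hB := A.one_le_B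
  have hb := A.one_lt_b
  have hδ0 : 0 < δ' := lt_of_lt_of_le (by positivity) hδ'
  by_cases h1 : z ∈ Metric.ball (c : M) R
  · by_cases h2 : f z ∈ Metric.ball (c' : M) R'
    · obtain ⟨T, hT, hT'⟩ := exists_hasStrictFDerivAt_chart hf (hc z h1) (hc' _ h2)
      have hcomp := A.isCompatible hz (hc z h1) hδ.le hδ4 hδ' (hcl z hz h1) (hcl' _ (hmaps hz) h2)
        (T := T.toLinearMap) hT'
      filter_upwards [exists_isApproxCompatible hf.continuous hδ0 (by
        rw [extChartAt_source]; exact hc z h1) (by rw [extChartAt_source]; exact hc' _ h2) hT hcomp]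
        with r hr x hx _ _ _ _ using hr x hx
    · obtain ⟨t, ht, hball⟩ := Metric.eventually_nhds_iff_ball.1
        (hf.continuous.continuousAt.eventually (Metric.ball_mem_nhds (f z) (show 0 < R' / 4 by positivity)))
      have hr : ∀ᶠ r in 𝓝[>] (0 : ℝ), r < min t (R' / 4) :=
        mem_nhdsWithin_of_mem_nhds (gt_mem_nhds (by positivity))
      filter_upwards [hr] with r hr x hx x' hxx' _ hx'
      refine absurd ?_ h2
      have h3 := hball x (Metric.ball_subset_ball (hr.le.trans (min_le_left _ _)) hx)
      have h4 := hr.trans_le (min_le_right _ _)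
      rw [Metric.mem_ball] at hx' ⊢
      have h5 := dist_triangle (f z) x' (c' : M)
      have h6 := dist_triangle_left (f z) x' (f x)
      rw [dist_comm] at h3
      rw [dist_comm (f x) (f z)] at h6
      linarith
  · have hr : ∀ᶠ r in 𝓝[>] (0 : ℝ), r < R / 2 :=
      mem_nhdsWithin_of_mem_nhds (gt_mem_nhds (by positivity))
    filter_upwards [hr] with r hr x hx x' _ hxc _
    refine absurd ?_ h1
    rw [Metric.mem_ball] at hx hxc ⊢
    have := dist_triangle_left z (c : M) x
    linarith

/-- A finite subcover assigns a centre to every point near `Λ`. The splitting at a point is that of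
its centre, and its parametrization is the chart of the centre translated to the point, so all
constants take finitely many values. -/
theorem exists_hyperbolicCharts (A : AdaptedSplitting d f Λ) {F : FinslerNorm d M}
    (hF : ∀ x y : M, edist x y = F.pathEDist x y) (hf : ContMDiff (𝓡 d) (𝓡 d) 1 f)
    (hne : Λ.Nonempty) (hΛc : IsCompact Λ) (hmaps : MapsTo f Λ Λ) :
    Nonempty (HyperbolicCharts (EuclideanSpace ℝ (Fin d)) f Λ) := by
  have ha0 := A.a_pos
  have ha := A.a_lt_one
  have hb := A.one_lt_b
  have hB := A.one_le_B
  obtain ⟨α, haα, hbα, hα1⟩ : ∃ α, A.a ≤ α ∧ ((1 + A.b) / 2)⁻¹ ≤ α ∧ α < 1 :=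
    ⟨max A.a ((1 + A.b) / 2)⁻¹, le_max_left _ _, le_max_right _ _,
      max_lt ha (inv_lt_one_of_one_lt₀ (by linarith))⟩
  -- With `β = 2 * δ'`, the rate `α + 2 * β` is at most `(1 + α) / 2`, and `A.b - δ'` stays above
  -- `(1 + A.b) / 2`.
  obtain ⟨δ', hδ'0, hδ'α, hδ'b⟩ : ∃ δ' > 0, δ' ≤ (1 - α) / 8 ∧ δ' ≤ (A.b - 1) / 2 :=
    ⟨min ((1 - α) / 8) ((A.b - 1) / 2), lt_min (by linarith) (by linarith),
      min_le_left _ _, min_le_right _ _⟩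
  obtain ⟨δ, hδ, hδ4, hδ'⟩ : ∃ δ > 0, δ ≤ 1 / 4 ∧ (4 * A.B + A.b) * δ ≤ δ' :=
    ⟨min (1 / 4) (δ' / (4 * A.B + A.b)), by positivity, min_le_left _ _, by
      rw [← le_div_iff₀' (by positivity)]; exact min_le_right _ _⟩
  have hchart : ∀ c : Λ, ∃ L ≥ 1, ∃ r > 0,
      (∀ x ∈ Metric.ball (c : M) r, x ∈ (chartAt (EuclideanSpace ℝ (Fin d)) (c : M)).source) ∧
      (∀ x ∈ Metric.ball (c : M) r, ∀ y ∈ Metric.ball (c : M) r, (A.splitNorm c).n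
        (extChartAt (𝓡 d) (c : M) x - extChartAt (𝓡 d) (c : M) y) ≤ L * dist x y) ∧
      (∀ x ∈ Metric.ball (c : M) r, ∀ h, (A.splitNorm c).n h ≤ r →
        dist x ((extChartAt (𝓡 d) (c : M)).symm (extChartAt (𝓡 d) (c : M) x + h)) ≤
          L * (A.splitNorm c).n h) ∧
      ∀ z ∈ Λ, z ∈ Metric.ball (c : M) r → A.IsCloseAt δ c z := by
    intro c
    obtain ⟨L, hL, hb⟩ := FinslerNorm.exists_chart_bounds hF
      (A.splitNorm c).eq_zero_of_n_eq_zero (c : M)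
    obtain ⟨t, ht, hcl⟩ := Metric.eventually_nhds_iff_ball.1
      (eventually_nhdsWithin_iff.1 (A.eventually_isCloseAt hδ c))
    have hrt : ∀ᶠ r in 𝓝[>] (0 : ℝ), r < t := mem_nhdsWithin_of_mem_nhds (gt_mem_nhds ht)
    obtain ⟨r, ⟨⟨h1, h2, h3⟩, hrt⟩, hr⟩ := ((hb.and hrt).and self_mem_nhdsWithin).exists
    exact ⟨L, hL, r, hr, h1, h2, h3,
      fun z hz hzr => hcl z (Metric.ball_subset_ball hrt.le hzr) hz⟩
  choose L hL R hR hsrc hlip hdist hcl using hchart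
  obtain ⟨s, hs⟩ := hΛc.elim_finite_subcover (fun c : Λ => Metric.ball (c : M) (R c / 2))
    (fun c => Metric.isOpen_ball) fun x hx => mem_iUnion.2
      ⟨⟨x, hx⟩, Metric.mem_ball_self (half_pos (hR _))⟩
  have hsne : s.Nonempty := by
    obtain ⟨x, hx⟩ := hne
    obtain ⟨c, hc, -⟩ := mem_iUnion₂.1 (hs hx)
    exact ⟨c, hc⟩
  obtain ⟨ε₁, hε₁, hthick⟩ := hΛc.exists_thickening_subset_open
    (isOpen_biUnion fun c _ => Metric.isOpen_ball) hs
  obtain ⟨c₀, -⟩ := hsne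
  have hcenter : ∀ x : M, ∃ c : Λ, x ∈ Metric.thickening ε₁ Λ →
      c ∈ s ∧ x ∈ Metric.ball (c : M) (R c / 2) := fun x => by
    by_cases hx : x ∈ Metric.thickening ε₁ Λ
    · obtain ⟨c, hc, hxc⟩ := mem_iUnion₂.1 (hthick hx)
      exact ⟨c, fun _ => ⟨hc, hxc⟩⟩
    · exact ⟨c₀, fun h => absurd h hx⟩
  choose center hcenter using hcenter
  have hedge : ∃ r > 0, ∀ z ∈ Λ, ∀ x ∈ Metric.ball z r, ∀ c ∈ s, ∀ c' ∈ s, ∀ x',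
      dist (f x) x' ≤ r → x ∈ Metric.ball (c : M) (R c / 2) → x' ∈ Metric.ball (c' : M) (R c' / 2) →
      IsApproxCompatible f (A.splitNorm c) (A.splitNorm c') c c' A.a A.b A.B δ' r x := by
    refine hΛc.induction_on (p := fun S => ∃ r > 0, ∀ z ∈ S, ∀ x ∈ Metric.ball z r, ∀ c ∈ s,
      ∀ c' ∈ s, ∀ x', dist (f x) x' ≤ r → x ∈ Metric.ball (c : M) (R c / 2) →
      x' ∈ Metric.ball (c' : M) (R c' / 2) →
      IsApproxCompatible f (A.splitNorm c) (A.splitNorm c') c c' A.a A.b A.B δ' r x) ?_ ?_ ?_ ?_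
    · exact ⟨1, one_pos, by simp⟩
    · rintro S S' hSS' ⟨r, hr, h⟩
      exact ⟨r, hr, fun z hz => h z (hSS' hz)⟩
    · rintro S S' ⟨r, hr, h⟩ ⟨r', hr', h'⟩
      refine ⟨min r r', lt_min hr hr', fun z hz x hx c hc c' hc' x' hxx' hxc hxc' => ?_⟩
      rcases hz with hz | hz
      · exact (h z hz x (Metric.ball_subset_ball (min_le_left _ _) hx) c hc c' hc' x'
          (hxx'.trans (min_le_left _ _)) hxc hxc').mono (min_le_left _ _)
      · exact (h' z hz x (Metric.ball_subset_ball (min_le_right _ _) hx) c hc c' hc' x'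
          (hxx'.trans (min_le_right _ _)) hxc hxc').mono (min_le_right _ _)
    · intro z hz
      have key := (Filter.eventually_all_finset s).2 fun c _ => (Filter.eventually_all_finset s).2
        fun c' _ => A.eventually_isApproxCompatible hf hmaps hδ hδ4 hδ' (hR c) (hR c') (hsrc c)
          (hsrc c') (hcl c) (hcl c') hz
      obtain ⟨r, hr, hr0⟩ := (key.and self_mem_nhdsWithin).exists
      -- Halving the radius makes the estimate at `z` valid around every `w` in the ball.
      refine ⟨Metric.ball z (r / 2), mem_nhdsWithin_of_mem_nhds (Metric.ball_mem_nhds z (half_pos hr0)),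
        r / 2, half_pos hr0, fun w hw x hx c hc c' hc' x' hxx' hxc hxc' => ?_⟩
      refine (hr c hc c' hc' x ?_ x' (hxx'.trans (by linarith)) hxc hxc').mono (by linarith)
      rw [Metric.mem_ball] at hw hx ⊢
      linarith [dist_triangle x w z]
  obtain ⟨r, hr, hedge⟩ := hedge
  obtain ⟨R₀, hR₀, hR₀le⟩ : ∃ R₀ > 0, ∀ c ∈ s, R₀ ≤ R c := by
    have : ∀ᶠ t in 𝓝[>] (0 : ℝ), ∀ c ∈ s, t < R c :=
      (Filter.eventually_all_finset s).2 fun c _ => mem_nhdsWithin_of_mem_nhds (gt_mem_nhds (hR c))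
    obtain ⟨t, h, ht⟩ := (this.and self_mem_nhdsWithin).exists
    exact ⟨t, ht, fun c hc => (h c hc).le⟩
  obtain ⟨L₀, hL₀, hL₀le⟩ : ∃ L₀ ≥ 1, ∀ c ∈ s, L c ≤ L₀ := by
    have : ∀ᶠ t in atTop, ∀ c ∈ s, L c ≤ t :=
      (Filter.eventually_all_finset s).2 fun c _ => eventually_ge_atTop _
    obtain ⟨t, h, ht⟩ := (this.and (eventually_ge_atTop 1)).exists
    exact ⟨t, ht, h⟩
  -- With `R₀ / 4`, the point `f x` stays in the full ball around the centre of `x'`, where the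
  -- chart is Lipschitz.
  have hε : min ε₁ (min r (R₀ / 4)) ≤ ε₁ := min_le_left _ _
  have hεr : min ε₁ (min r (R₀ / 4)) ≤ r := (min_le_right _ _).trans (min_le_left _ _)
  have hεR : min ε₁ (min r (R₀ / 4)) ≤ R₀ / 4 := (min_le_right _ _).trans (min_le_right _ _)
  have hmem : ∀ x ∈ Metric.thickening (min ε₁ (min r (R₀ / 4))) Λ,
      center x ∈ s ∧ x ∈ Metric.ball (center x : M) (R (center x) / 2) := fun x hx =>
    hcenter x (Metric.thickening_mono hε _ hx)
  refine ⟨{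
    ε := min ε₁ (min r (R₀ / 4))
    ρ := min r R₀
    L := L₀
    α := α
    β := 2 * δ'
    ε_pos := by positivity
    ρ_pos := by positivity
    one_le_L := hL₀
    α_nonneg := by linarith
    β_nonneg := by linarith
    rate_lt_one := by linarith
    X := fun x => A.splitNorm (center x)
    Ψ := fun x h => (extChartAt (𝓡 d) (center x : M)).symm (extChartAt (𝓡 d) (center x : M) x + h)
    dist_le := fun x hx h hh => ?_
    hasCrossForm := fun x hx x' hx' hxx' => ?_ }⟩
  · obtain ⟨hc, hxc⟩ := hmem x hx
    have h0 : 0 ≤ (A.splitNorm (center x)).n h := apply_nonneg _ _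
    refine (hdist _ x (Metric.ball_subset_ball (by linarith [hR (center x)]) hxc) h
      (hh.trans ((min_le_right _ _).trans (hR₀le _ hc)))).trans ?_
    gcongr
    exact hL₀le _ hc
  · obtain ⟨hc, hxc⟩ := hmem x hx
    obtain ⟨hc', hxc'⟩ := hmem x' hx'
    obtain ⟨z, hz, hxz⟩ := Metric.mem_thickening_iff.1 (Metric.thickening_mono hεr _ hx)
    have hR1 := hR (center x)
    have hR2 := hR (center x')
    have hR3 := hR₀le _ hc'
    have happ := (hedge z hz x hxz _ hc _ hc' x' (hxx'.trans hεr) hxc hxc').mono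
      (min_le_left r R₀)
    have hbδ : (1 + A.b) / 2 ≤ A.b - δ' := by linarith
    refine happ.hasCrossForm ((A.finrank_range _ (center x).2).trans
      (A.finrank_range _ (center x').2).symm) hδ'0.le (by linarith)
      ((inv_anti₀ (by linarith) hbδ).trans hbα) haα ?_ ?_
    · rw [extChartAt_source]
      exact hsrc _ x (Metric.ball_subset_ball (by linarith) hxc)
    · refine (hlip _ (f x) ?_ x' (Metric.ball_subset_ball (by linarith) hxc')).trans
        (by gcongr; exact hL₀le _ hc')
      rw [Metric.mem_ball] at hxc' ⊢
      linarith [dist_triangle (f x) x' (center x' : M)]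

end AdaptedSplitting

end ChartMaps

end

theorem theorem1 {d : ℕ} {M : Type*} [MetricSpace M]
    [ChartedSpace (EuclideanSpace ℝ (Fin d)) M] [IsManifold (𝓡 d) 1 M]
    (F : FinslerNorm d M) (hF : ∀ x y : M, edist x y = F.pathEDist x y)
    (f : M → M) (hf : ContMDiff (𝓡 d) (𝓡 d) 1 f)
    (Λ : Set M) (hΛne : Λ.Nonempty) (hΛc : IsCompact Λ)
    (hΛhyp : IsHyperbolicSet F f Λ) (hΛmax : IsLocallyMaximal f Λ) :
    ∃ ε K lam : ℝ,
      IsShadowingConstants f Λ ε K lam ∧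
      IsPeriodicShadowing f Λ ε (periodicShadowingConst K lam) ∧
      IsCompact (closure (Metric.thickening ε Λ)) ∧
      ∀ φ : M → ℝ, (∃ L, LipschitzWith L φ) →
        Tendsto (fun n : ℕ => (1 / (n : ℝ)) * ⨅ x : Λ, birkhoffSum f φ n (x : M)) atTop
          (𝓝 (ergodicMinimizingValue f Λ φ)) ∧
        ∃ Ω : Set M, IsOpen Ω ∧ Λ ⊆ Ω ∧
          ∃ u : M → ℝ, (∃ L, LipschitzWith L u) ∧
            (∀ x ∈ Ω, φ x - ergodicMinimizingValue f Λ φ ≥ u (f x) - u x) ∧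
            lipConst u ≤ subactionConst Λ ε K lam * lipConst φ := by
  have hfΛ := hΛhyp.1
  have hmaps : MapsTo f Λ Λ := fun x hx => hfΛ ▸ mem_image_of_mem f hx
  obtain ⟨A⟩ := hΛhyp.exists_adaptedSplitting hf hΛc
  obtain ⟨D⟩ := A.exists_hyperbolicCharts hF hf hΛne hΛc hmaps
  obtain ⟨lam, hlam, ε₁, hε₁, K₁, h₁⟩ := D.exists_isShadowingConstants
  obtain ⟨ε₂, hε₂, K₂, h₂⟩ := D.exists_isPeriodicShadowing hΛc hΛmax
  obtain ⟨U, hU, hΛU, hUc, -⟩ := hΛmax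
  obtain ⟨ε₃, hε₃, h₃⟩ := hΛc.exists_thickening_subset_open hU hΛU
  obtain ⟨ε, hε, hεε₁, hεε₂, hεε₃⟩ : ∃ ε > 0, ε ≤ ε₁ ∧ ε ≤ ε₂ ∧ ε ≤ ε₃ :=
    ⟨min ε₁ (min ε₂ ε₃), by positivity, min_le_left _ _,
      (min_le_right _ _).trans (min_le_left _ _), (min_le_right _ _).trans (min_le_right _ _)⟩
  have hcpt : IsCompact (closure (Metric.thickening ε Λ)) :=
    hUc.of_isClosed_subset isClosed_closure
      (closure_mono ((Metric.thickening_mono hεε₃ Λ).trans h₃))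
  -- Periodic shadowing is first used with a provisional constant, so that `K₃` depends on `ε` but
  -- not on the final `K`.
  obtain ⟨K₃, hK₃, hsub⟩ := (h₂ ε hε hεε₂ (max K₂ 0) (le_max_left _ _)).exists_subaction hε
    (le_max_right _ _) hΛne hmaps hcpt
  -- Only now is `K` fixed, large enough to dominate `K₃`; the second entry of the maximum in
  -- `subactionConst` then suffices.
  obtain ⟨K, hKK₁, hKK₂, hKK₃⟩ : ∃ K, K₁ ≤ K ∧ K₂ ≤ K ∧ K₃ ≤ K :=
    ⟨max K₁ (max K₂ K₃), le_max_left _ _, (le_max_left _ _).trans (le_max_right _ _),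
      (le_max_right _ _).trans (le_max_right _ _)⟩
  have hper : K ≤ periodicShadowingConst K lam := by
    have h4 : Real.exp (-lam) < 1 := Real.exp_lt_one_iff.2 (by linarith)
    have h5 := Real.exp_pos (-lam)
    refine le_mul_of_one_le_right (hK₃.trans hKK₃) ?_
    rw [one_le_div (by linarith)]
    linarith
  have hconst : K₃ ≤ subactionConst Λ ε K lam := (hKK₃.trans hper).trans (le_max_right _ _)
  refine ⟨ε, K, lam, h₁ ε hε hεε₁ K hKK₁, h₂ ε hε hεε₂ _ (hKK₂.trans hper), hcpt, fun φ hφ => ?_⟩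
  obtain ⟨hlim, hu⟩ := hsub φ hφ
  obtain ⟨u, huL, hux⟩ := hu _ hconst
  have hL : 0 ≤ subactionConst Λ ε K lam * lipConst φ :=
    mul_nonneg (hK₃.trans hconst) (lipConst_nonneg φ)
  exact ⟨hlim, Metric.thickening ε Λ, Metric.isOpen_thickening, Metric.self_subset_thickening hε Λ, u,
    ⟨⟨_, hL⟩, LipschitzWith.of_dist_le_mul fun x y => by
      rw [dist_comm, Real.dist_eq]; exact huL x y⟩,
    hux, lipConst_le hL huL⟩
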